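/- Let $V$ be a $3$-dimensional handlebody of genus $g\ge 1$, let $D\subset\partial V$ be a closed disk, and let $\Sigma=\partial V\setminus\operatorname{int}(D)$, with a base point $\star\in\partial D=\partial\Sigma$. Put $\pi=\pi_1(\Sigma,\star)$ and $A=\ker\big(\pi_1(\Sigma,\star)\to\pi_1(V,\star)\big)$, the kernel of the homomorphism induced by the inclusion. Let $A_0=\pi$ and let $A_m=\Gamma_mA$ for $m\ge 1$, where $\Gamma_1A=A$ and $\Gamma_{i+1}A=[\Gamma_iA,A]$. Let $\mathcal H$ be the handlebody group, i.e. the group of isotopy classes rel $D$ of self-homeomorphisms of $V$ fixing $D$ pointwise, regarded through its action on $\pi$ as a subgroup of $\operatorname{Aut}(\pi)$. Let $\operatorname{Aut}(\pi,A)=\{f\in\operatorname{Aut}(\pi): f(A)=A\}$, and for $m,j\ge 0$ put $$\mathcal G_m^j=\{f\in\operatorname{Aut}(\pi,A) : f(x)x^{-1}\in A_{m+j}\text{ for all }x\in A_j\},\qquad \mathcal H_m^j=\mathcal H\cap\mathcal G_m^j,\qquad \mathcal H_m=\bigcap_{j\ge 0}\mathcal H_m^j .$$ Thus $\mathcal H_m^0$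 is the kernel of the action of $\mathcal H$ on $\pi/A_m$, and $\mathcal H_m^1$ is the kernel of the action of $\mathcal H$ on $A/A_{m+1}$; the filtration $(\mathcal H_m)_{m\ge0}$ is called the Johnson filtration of $\mathcal H$. Then $\mathcal H\le\operatorname{Aut}(\pi,A)$, and for every $m\ge 0$ $$\mathcal H_m^0=\mathcal H_m=\mathcal H_m^1 .$$ Moreover the Johnson filtration is an extended N-series of the group $\mathcal H$ with trivial intersection: $\mathcal H=\mathcal H_0\ge\mathcal H_1\ge\mathcal H_2\ge\cdots$, $[\mathcal H_m,\mathcal H_n]\le\mathcal H_{m+n}$ for all $m,n\ge 0$, and $\bigcap_{m\ge 0}\mathcal H_m=\{1\}$. -/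

import Mathlib

noncomputable section

namespace HandlebodyJohnson

open Topology unitInterval

/-! ### Handlebodies with a marked disk in the boundary -/

/-- A disk with `g` holes: the rectangle `[0, 2g+1] × [0, 3]` minus the `g` disjoint open squares
`(2i+1, 2i+2) × (1, 2)` for `0 ≤ i < g`. -/
def holedRectangle (g : ℕ) : Set (ℝ × ℝ) :=
  {p | p.1 ∈ Set.Icc (0 : ℝ) (2 * (g : ℝ) + 1) ∧ p.2 ∈ Set.Icc (0 : ℝ) 3 ∧
    ∀ i : ℕ, i < g →
      ¬ (p.1 ∈ Set.Ioo (2 * (i : ℝ) + 1) (2 * (i : ℝ) + 2) ∧ p.2 ∈ Set.Ioo (1 : ℝ) 2)}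

/-- The standard handlebody of genus `g` in `ℝ³`: (disk with `g` holes) `× [0, 1]`. -/
def stdHandlebody (g : ℕ) : Set (ℝ × ℝ × ℝ) :=
  {p | (p.1, p.2.1) ∈ holedRectangle g ∧ p.2.2 ∈ Set.Icc (0 : ℝ) 1}

/-- The boundary surface of the standard handlebody, its topological frontier in `ℝ³`. -/
def stdBoundary (g : ℕ) : Set (ℝ × ℝ × ℝ) := frontier (stdHandlebody g)

/-- The standard disk in the boundary of the standard handlebody: the face `{0} × [0,3] × [0,1]`. -/
def stdDisk : Set (ℝ × ℝ × ℝ) :=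
  {p | p.1 = 0 ∧ p.2.1 ∈ Set.Icc (0 : ℝ) 3 ∧ p.2.2 ∈ Set.Icc (0 : ℝ) 1}

/-- `V` is a handlebody of genus `g` with boundary surface `S = ∂V`, and `D` is a disk in `S`:
the triple `(V, S, D)` is homeomorphic to the standard one. (All pairs consisting of a handlebody
of genus `g` and a closed disk in its boundary are homeomorphic to each other.) -/
def IsHandlebodyWithDisk (g : ℕ) {V : Type*} [TopologicalSpace V] (S D : Set V) : Prop :=
  ∃ h : V ≃ₜ stdHandlebody g,
    (∀ x, x ∈ S ↔ (h x : ℝ × ℝ × ℝ) ∈ stdBoundary g) ∧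
    (∀ x, x ∈ D ↔ (h x : ℝ × ℝ × ℝ) ∈ stdDisk)

section Topology

variable {V : Type*} [TopologicalSpace V]

/-- The interior of `D` relative to the subspace `S`. -/
def relInterior (S D : Set V) : Set V :=
  (Subtype.val : S → V) '' interior ((Subtype.val : S → V) ⁻¹' D)

theorem relInterior_subset (S D : Set V) : relInterior S D ⊆ D := by
  rintro _ ⟨x, hx, rfl⟩
  exact (interior_subset hx : x ∈ (Subtype.val : S → V) ⁻¹' D)

/-- The surface `Σ = ∂V \ int D`, where `S = ∂V`. Its boundary curve is `∂D = Σ ∩ D`. -/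
def surface (S D : Set V) : Set V := S \ relInterior S D

/-- The group of self-homeomorphisms of the pair `(V, S)` fixing `D` pointwise. When `V` is a
handlebody and `S = ∂V`, these are all self-homeomorphisms of `V` fixing `D` pointwise: preserving
the boundary of a manifold is automatic, by invariance of domain. -/
def homeoRel (S D : Set V) : Subgroup (V ≃ₜ V) where
  carrier := {f | (∀ x, f x ∈ S ↔ x ∈ S) ∧ ∀ x ∈ D, f x = x}
  mul_mem' := by
    rintro f f' ⟨h1, h2⟩ ⟨h1', h2'⟩
    refine ⟨fun x => ?_, fun x hx => ?_⟩
    · rw [Homeomorph.mul_apply, h1, h1']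
    · rw [Homeomorph.mul_apply, h2' x hx, h2 x hx]
  one_mem' := ⟨fun _ => Iff.rfl, fun _ _ => rfl⟩
  inv_mem' := by
    rintro f ⟨h1, h2⟩
    refine ⟨fun x => ?_, fun x hx => ?_⟩
    · rw [← h1, Homeomorph.inv_apply, Homeomorph.apply_symm_apply]
    · rw [Homeomorph.inv_apply, Homeomorph.symm_apply_eq, h2 x hx]

variable {S D : Set V}

theorem homeoRel_mapsTo (f : homeoRel S D) {x : V} (hx : x ∈ surface S D) :
    f.1 x ∈ surface S D := by
  refine ⟨(f.2.1 x).2 hx.1, fun h => hx.2 ?_⟩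
  have h3 : f.1 x = x := f.1.injective (f.2.2 _ (relInterior_subset S D h))
  rwa [h3] at h

/-- The self-map of `Σ` obtained by restricting a self-homeomorphism of `V` rel `D`. -/
def surfaceMap (f : homeoRel S D) : C(surface S D, surface S D) where
  toFun x := ⟨f.1 x, homeoRel_mapsTo f x.2⟩
  continuous_toFun := by
    refine Continuous.subtype_mk ?_ _
    exact f.1.continuous.comp continuous_subtype_val

/-- A self-homeomorphism of `V` rel `D` is isotopic to the identity rel `D`. -/
def IsotopicToId (f : homeoRel S D) : Prop :=
  ∃ F : I → homeoRel S D,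
    Continuous (fun p : I × V => (F p.1).1 p.2) ∧
    Continuous (fun p : I × V => (F p.1)⁻¹.1 p.2) ∧
    F 0 = 1 ∧ F 1 = f

/-- The normal subgroup of self-homeomorphisms of `V` that are isotopic to the identity rel `D`. -/
def isotopyId (S D : Set V) : Subgroup (homeoRel S D) where
  carrier := {f | IsotopicToId f}
  one_mem' := ⟨fun _ => 1, continuous_snd, continuous_snd, rfl, rfl⟩
  mul_mem' := by
    rintro f f' ⟨F, h1, h2, h3, h4⟩ ⟨F', h1', h2', h3', h4'⟩
    refine ⟨fun t => F t * F' t, h1.comp (continuous_fst.prodMk h1'), ?_,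
      by simp only [h3, h3', mul_one], by simp only [h4, h4']⟩
    simp only [mul_inv_rev]
    exact h2'.comp (continuous_fst.prodMk h2)
  inv_mem' := by
    rintro f ⟨F, h1, h2, h3, h4⟩
    refine ⟨fun t => (F t)⁻¹, h2, ?_, by simp only [h3, inv_one], by simp only [h4]⟩
    simpa only [inv_inv] using h1

instance isotopyId_normal : (isotopyId S D).Normal where
  conj_mem := by
    rintro f ⟨F, h1, h2, h3, h4⟩ k
    refine ⟨fun t => k * F t * k⁻¹, ?_, ?_, by simp [h3], by simp only [h4]⟩
    · exact k.1.continuous.comp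
        (h1.comp (continuous_fst.prodMk ((k⁻¹).1.continuous.comp continuous_snd)))
    · simp only [mul_inv_rev, inv_inv, ← mul_assoc]
      exact k.1.continuous.comp
        (h2.comp (continuous_fst.prodMk ((k⁻¹).1.continuous.comp continuous_snd)))

/-- The mapping class group of `V` rel `D`. -/
abbrev MappingClassGroup (S D : Set V) : Type _ := homeoRel S D ⧸ isotopyId S D

theorem surfaceMap_star {star : surface S D} (hstar : (star : V) ∈ D) (f : homeoRel S D) :
    surfaceMap f star = star :=
  Subtype.ext (f.2.2 _ hstar)

/-- The group `π = π₁(Σ, ⋆)`. -/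
abbrev Pi1 (star : surface S D) : Type _ := FundamentalGroup (surface S D) star

/-- The endomorphism of `π` induced by a self-homeomorphism of `V` rel `D`. -/
def inducedHom {star : surface S D} (hstar : (star : V) ∈ D) (f : homeoRel S D) :
    Pi1 star →* Pi1 star :=
  FundamentalGroup.mapOfEq (surfaceMap f) (surfaceMap_star hstar f)

/-- The inclusion `ι : Σ → V`. -/
def surfaceIncl (S D : Set V) : C(surface S D, V) := ⟨Subtype.val, continuous_subtype_val⟩

/-- The subgroup `A = ker (ι_* : π₁(Σ, ⋆) → π₁(V, ⋆))` of `π`. -/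
def kerA (star : surface S D) : Subgroup (Pi1 star) :=
  (FundamentalGroup.map (surfaceIncl S D) star).ker

/-- The class of a loop in the fundamental group. -/
def loopClass {star : surface S D} (γ : Path star star) : Pi1 star :=
  FundamentalGroup.fromPath (Path.Homotopic.Quotient.mk γ)

theorem inducedHom_loopClass {star : surface S D} (hstar : (star : V) ∈ D) (f : homeoRel S D)
    (γ : Path star star) :
    inducedHom hstar f (loopClass γ) =
      loopClass ((γ.map (surfaceMap f).continuous).cast (surfaceMap_star hstar f).symm
        (surfaceMap_star hstar f).symm) :=
  FundamentalGroup.mapOfEq_apply _ _ _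

theorem loopClass_surjective {star : surface S D} (x : Pi1 star) :
    ∃ γ : Path star star, loopClass γ = x :=
  Path.Homotopic.Quotient.mk_surjective x

theorem inducedHom_one {star : surface S D} (hstar : (star : V) ∈ D) :
    inducedHom hstar (1 : homeoRel S D) = MonoidHom.id _ := by
  ext x
  obtain ⟨γ, rfl⟩ := loopClass_surjective x
  rw [inducedHom_loopClass]
  rfl

theorem inducedHom_mul {star : surface S D} (hstar : (star : V) ∈ D) (f f' : homeoRel S D) :
    inducedHom hstar (f * f') = (inducedHom hstar f).comp (inducedHom hstar f') := by
  ext x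
  obtain ⟨γ, rfl⟩ := loopClass_surjective x
  rw [MonoidHom.comp_apply, inducedHom_loopClass, inducedHom_loopClass, inducedHom_loopClass]
  rfl

/-- The action of self-homeomorphisms of `V` rel `D` on `π`. -/
def homeoAction {star : surface S D} (hstar : (star : V) ∈ D) :
    homeoRel S D →* MulAut (Pi1 star) where
  toFun f := MonoidHom.toMulEquiv (inducedHom hstar f) (inducedHom hstar f⁻¹)
    (by rw [← inducedHom_mul, inv_mul_cancel, inducedHom_one])
    (by rw [← inducedHom_mul, mul_inv_cancel, inducedHom_one])
  map_one' := by
    ext x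
    exact DFunLike.congr_fun (inducedHom_one hstar) x
  map_mul' f f' := by
    ext x
    exact DFunLike.congr_fun (inducedHom_mul hstar f f') x

theorem homeoAction_apply {star : surface S D} (hstar : (star : V) ∈ D) (f : homeoRel S D)
    (x : Pi1 star) : homeoAction hstar f x = inducedHom hstar f x := rfl

theorem isotopyId_le_ker {star : surface S D} (hstar : (star : V) ∈ D) :
    isotopyId S D ≤ (homeoAction hstar).ker := by
  rintro f ⟨F, h1, -, h3, h4⟩
  rw [MonoidHom.mem_ker]
  ext x
  obtain ⟨γ, rfl⟩ := loopClass_surjective x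
  rw [homeoAction_apply, inducedHom_loopClass, MulAut.one_apply]
  refine Path.Homotopic.Quotient.eq.2 (Path.Homotopic.symm ⟨⟨⟨⟨fun p =>
    ⟨(F p.1).1 (γ p.2), homeoRel_mapsTo _ (γ p.2).2⟩, ?_⟩, ?_, ?_⟩, ?_⟩⟩)
  · refine Continuous.subtype_mk ?_ _
    exact h1.comp (continuous_fst.prodMk
      (continuous_subtype_val.comp (γ.continuous.comp continuous_snd)))
  · intro t
    apply Subtype.ext
    simp [h3]
  · intro t
    apply Subtype.ext
    simp only [h4]
    rfl
  · rintro t s (rfl | rfl)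
    · apply Subtype.ext
      simpa using (F t).2.2 _ hstar
    · apply Subtype.ext
      simpa using (F t).2.2 _ hstar

/-- The action of the mapping class group of `V` rel `D` on `π = π₁(Σ, ⋆)`, for `⋆ ∈ ∂D`. -/
def mcgAction {star : surface S D} (hstar : (star : V) ∈ D) :
    MappingClassGroup S D →* MulAut (Pi1 star) :=
  QuotientGroup.lift (isotopyId S D) (homeoAction hstar) (isotopyId_le_ker hstar)

/-- The handlebody group, i.e. the mapping class group of `V` rel `D`, regarded (through its
action on `π`) as a subgroup of `Aut(π)`. -/
def handlebodyGroup {star : surface S D} (hstar : (star : V) ∈ D) :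
    Subgroup (MulAut (Pi1 star)) :=
  (mcgAction hstar).range

end Topology

/-! ### Extended N-series and Johnson filtrations -/

/-- An extended N-series: a descending series `K 0 ≥ K 1 ≥ ⋯` of subgroups with
`[K m, K n] ≤ K (m + n)` for all `m, n ≥ 0`. -/
structure IsExtendedNSeries {P : Type*} [Group P] (K : ℕ → Subgroup P) : Prop where
  antitone : Antitone K
  commutator_le : ∀ m n : ℕ, ⁅K m, K n⁆ ≤ K (m + n)

section Series

variable {P : Type*} [Group P]

/-- The series `A_0 = π`, `A_m = Γ_m A` for `m ≥ 1`, where `Γ_1 A = A` and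
`Γ_{i+1} A = [Γ_i A, A]`, of subgroups of `π`. -/
def lowerSeries (A : Subgroup P) : ℕ → Subgroup P
  | 0 => ⊤
  | 1 => A
  | (m + 2) => ⁅lowerSeries A (m + 1), A⁆

/-- The group `Aut(π, A)` of automorphisms `f` of `π` with `f(A) = A`. -/
def autPair (A : Subgroup P) : Subgroup (MulAut P) where
  carrier := {f | A.map f.toMonoidHom = A}
  one_mem' := Subgroup.map_id A
  mul_mem' := by
    intro f f' (hf : A.map f.toMonoidHom = A) (hf' : A.map f'.toMonoidHom = A)
    change A.map (f.toMonoidHom.comp f'.toMonoidHom) = A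
    rw [← Subgroup.map_map, hf', hf]
  inv_mem' := by
    intro f (hf : A.map f.toMonoidHom = A)
    change A.map (f⁻¹).toMonoidHom = A
    conv_lhs => rw [← hf]
    rw [Subgroup.map_map]
    convert Subgroup.map_id A
    ext x
    exact MulAut.inv_apply_self P f x

theorem map_lowerSeries {A : Subgroup P} {f : MulAut P} (hf : f ∈ autPair A) (m : ℕ) :
    (lowerSeries A m).map f.toMonoidHom = lowerSeries A m := by
  induction m using lowerSeries.induct with
  | case1 => exact Subgroup.map_top_of_surjective _ f.surjective
  | case2 => exact hf
  | case3 m ih =>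
    have hf' : A.map f.toMonoidHom = A := hf
    rw [lowerSeries, Subgroup.map_commutator, ih, hf']

theorem apply_mem_lowerSeries {A : Subgroup P} {f : MulAut P} (hf : f ∈ autPair A) {m : ℕ} {x : P}
    (hx : x ∈ lowerSeries A m) : f x ∈ lowerSeries A m := by
  rw [← map_lowerSeries hf m]
  exact ⟨x, hx, rfl⟩

/-- The subgroup `G_m^j = {f ∈ Aut(π, A) | f(x) x⁻¹ ∈ A_{m+j} for all x ∈ A_j}`. Thus `G_m^0` is
the kernel of the action of `Aut(π, A)` on `π / A_m`, and `G_m^1` is the kernel of its action on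
`A / A_{m+1}`. -/
def johnsonStep (A : Subgroup P) (m j : ℕ) : Subgroup (MulAut P) where
  carrier := {f | f ∈ autPair A ∧ ∀ x ∈ lowerSeries A j, f x * x⁻¹ ∈ lowerSeries A (m + j)}
  one_mem' := ⟨one_mem _, fun x _ => by simp⟩
  mul_mem' := by
    rintro f f' ⟨h, hf⟩ ⟨h', hf'⟩
    refine ⟨mul_mem h h', fun x hx => ?_⟩
    have := mul_mem (hf _ (apply_mem_lowerSeries h' hx)) (hf' x hx)
    simpa using this
  inv_mem' := by
    rintro f ⟨h, hf⟩
    refine ⟨inv_mem h, fun x hx => ?_⟩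
    have := inv_mem (hf _ (apply_mem_lowerSeries (inv_mem h) hx))
    simpa using this

/-- The Johnson filtration `G_m = ⋂_j G_m^j` of `Aut(π, A)`. -/
def johnsonFiltration (A : Subgroup P) (m : ℕ) : Subgroup (MulAut P) :=
  ⨅ j : ℕ, johnsonStep A m j

end Series

section HandlebodyFiltrations

variable {V : Type*} [TopologicalSpace V] {S D : Set V}

/-- `H_m^j = H ∩ G_m^j`; in particular `H_m^0` is the kernel of the action of `H` on `π / A_m`, and
`H_m^1` is the kernel of its action on `A / A_{m+1}`. -/
def handlebodyStep {star : surface S D} (hstar : (star : V) ∈ D) (m j : ℕ) :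
    Subgroup (MulAut (Pi1 star)) :=
  handlebodyGroup hstar ⊓ johnsonStep (kerA star) m j

/-- The Johnson filtration `H_m = H ∩ G_m` of the handlebody group. -/
def handlebodyFiltration {star : surface S D} (hstar : (star : V) ∈ D) (m : ℕ) :
    Subgroup (MulAut (Pi1 star)) :=
  handlebodyGroup hstar ⊓ johnsonFiltration (kerA star) m

end HandlebodyFiltrations

end HandlebodyJohnson

end

/-! The group `π` is free on generators `S i`, `B i` (`i < g`) such that `A` is the normal closure
of the `B i` and the boundary curve is `ζ = ∏ B i * (∏ S i * B i * (S i)⁻¹)⁻¹`, with products in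
descending order (`exists_isSplitPair`). Hence `π = A ⋊ F(S)`, where `A` is free on the conjugates
of the `B i` by elements of `F(S)`, and `F(S)` permutes this basis freely. An element of the
handlebody group comes from a homeomorphism of `V`, so it preserves `A`; it fixes `ζ`, which runs in
`∂D`. The rest is algebra of the pair `(π, A)`.

Step 0. Let `f` act trivially on `π / A_m` with `m ≥ 1`, and put `δ i = f (B i) * (B i)⁻¹`. In the
abelian group `A_m / A_{m+1}` the equation `f ζ = ζ` becomes `∑ δ i = ∑ S i • δ i`. Leading Magnus
coefficients embed this quotient into the finitely supported functions on words of length `m` in the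
basis of `A`, and `F(S)` acts freely on these words. On each orbit the coefficients of the `δ i`
form a finitely supported circulation on the Cayley graph of `F(S)`. That graph is a tree, so the
circulation vanishes (`eq_zero_of_circulation`, `mem_lowerSeries_splitKer_of_prod`). Thus `f` is
trivial on `A / A_{m+1}` (`apply_mem_of_fixes`), and commutator calculus gives all the other
conditions (`mem_johnsonFiltration_of_apply_mem`).

Step 1. Here `ζ` plays no role. If `f` is trivial on `A / A_{m+1}`, then `y = f x * x⁻¹` satisfies
`⁅y, A⁆ ≤ A_{m+1}`. This forces `y` down the series as far as `A_m`, because `F(S)` acts freely on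
the basis of `A / [A, A]` and a free group of rank at least two has a graded Lie ring without
central elements in positive degree (`mem_lowerSeries_succ`).

The N-series property is a direct commutator computation, and the intersection is trivial because
`A` is residually nilpotent (`eq_one_of_forall_mem_lcs`).

Two classical inputs are proved along the way. Magnus's theorem that leading coefficients detect the
lower central series (`mem_lcs_succ`) rests on the embedding of the free Lie ring into the free
associative ring (`toFree_injective`), obtained by Lazard elimination. The fundamental group of the
surface is found by covering a model with four contractible patches: holonomy of a cocycle maps it
to a free group, and subdivision of paths shows that this is an isomorphism (`holEquiv`). Holonomy
also identifies the kernel (`stdKer_eq`) and the boundary curve (`exists_boundary_loop`). -/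

noncomputable section

/-! ### Free Lie algebras: substitution of letters and weights -/

namespace FreeLieAlgebra

attribute [local instance 100] LieRing.ofAssociativeRing
attribute [local instance 100] LieAlgebra.ofAssociativeAlgebra

variable {R : Type*} [CommRing R]

/-- A subset of the free Lie algebra that contains the letters and is closed under the operations
is everything. -/
theorem induction_on {X : Type*} {p : FreeLieAlgebra R X → Prop} (hof : ∀ x, p (of R x))
    (hzero : p 0) (hadd : ∀ a b, p a → p b → p (a + b)) (hsmul : ∀ (c : R) a, p a → p (c • a))
    (hlie : ∀ a b, p a → p b → p ⁅a, b⁆) (a : FreeLieAlgebra R X) : p a := by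
  let S : LieSubalgebra R (FreeLieAlgebra R X) :=
    { carrier := {a | p a}
      zero_mem' := hzero
      add_mem' := fun h1 h2 => hadd _ _ h1 h2
      smul_mem' := fun c x hx => hsmul c x hx
      lie_mem' := fun h1 h2 => hlie _ _ h1 h2 }
  have h : S.incl.comp (lift R (fun x => (⟨of R x, hof x⟩ : S))) = LieHom.id := by
    ext x; simp
  have := DFunLike.congr_fun h a
  rw [LieHom.comp_apply, LieHom.id_apply] at this
  rw [← this]
  exact (lift R (fun x => (⟨of R x, hof x⟩ : S)) a).2

variable (R) in
/-- The canonical map from the free Lie algebra to the free associative algebra. -/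
def toFree (X : Type*) : FreeLieAlgebra R X →ₗ⁅R⁆ FreeAlgebra R X :=
  lift R (FreeAlgebra.ι R)

@[simp] theorem toFree_of {X : Type*} (x : X) : toFree R X (of R x) = FreeAlgebra.ι R x :=
  lift_of_apply _ _

/-- The homomorphism of free Lie algebras induced by a map of letters to letters or zero. -/
def mapLetters {X Y : Type*} (f : X → Option Y) : FreeLieAlgebra R X →ₗ⁅R⁆ FreeLieAlgebra R Y :=
  lift R (fun x => (f x).elim 0 (of R))

@[simp] theorem mapLetters_of {X Y : Type*} (f : X → Option Y) (x : X) :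
    mapLetters f (of R x) = (f x).elim 0 (of R) :=
  lift_of_apply _ _

theorem mapLetters_comp {X Y Z : Type*} (f : X → Option Y) (g : Y → Option Z)
    (a : FreeLieAlgebra R X) :
    mapLetters g (mapLetters f a) = mapLetters (fun x => (f x).bind g) a := by
  rw [← LieHom.comp_apply]
  congr 1
  ext x
  cases h : f x <;> simp [h]

theorem mapLetters_some {X : Type*} (a : FreeLieAlgebra R X) : mapLetters some a = a := by
  have : mapLetters (R := R) (some : X → Option X) = LieHom.id := by ext x; simp
  rw [this, LieHom.id_apply]

theorem toFree_mapLetters {X Y : Type*} (f : X → Option Y) (a : FreeLieAlgebra R X) :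
    toFree R Y (mapLetters f a) =
      FreeAlgebra.lift R (fun x => (f x).elim 0 (FreeAlgebra.ι R)) (toFree R X a) := by
  induction a using induction_on with
  | hof x => cases h : f x <;> simp [h]
  | hzero => simp
  | hadd a b h1 h2 => simp only [map_add, h1, h2]
  | hsmul c a h => simp only [map_smul, h]
  | hlie a b h1 h2 =>
    simp only [LieHom.map_lie, h1, h2, LieRing.of_associative_ring_bracket, map_sub, map_mul]

/-- `Weight w n a`: the element `a` is a combination of brackets of total weight at most `n`,
where the letter `x` has weight `w x`. -/
inductive Weight {X : Type*} (w : X → ℕ) : ℕ → FreeLieAlgebra R X → Prop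
  | of (x : X) (n : ℕ) (h : w x ≤ n) : Weight w n (of R x)
  | zero (n : ℕ) : Weight w n 0
  | add {n : ℕ} {a b : FreeLieAlgebra R X} : Weight w n a → Weight w n b → Weight w n (a + b)
  | smul {n : ℕ} (c : R) {a : FreeLieAlgebra R X} : Weight w n a → Weight w n (c • a)
  | lie {m n k : ℕ} {a b : FreeLieAlgebra R X} (h : m + n ≤ k) :
      Weight w m a → Weight w n b → Weight w k ⁅a, b⁆

namespace Weight

variable {X : Type*} {w : X → ℕ}

theorem mono {m n : ℕ} (h : m ≤ n) {a : FreeLieAlgebra R X} (ha : Weight w m a) :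
    Weight w n a := by
  induction ha generalizing n with
  | of x k hk => exact .of x n (hk.trans h)
  | zero k => exact .zero n
  | add _ _ h1 h2 => exact .add (h1 h) (h2 h)
  | smul c _ h1 => exact .smul c (h1 h)
  | lie hk h1 h2 _ _ => exact .lie (hk.trans h) h1 h2

theorem eq_zero (hw : ∀ x, 0 < w x) {n : ℕ} {a : FreeLieAlgebra R X} (ha : Weight w n a)
    (hn : n = 0) : a = 0 := by
  induction ha with
  | of x k hk => have := hw x; omega
  | zero k => rfl
  | add _ _ h1 h2 => rw [h1 hn, h2 hn, add_zero]
  | smul c _ h1 => rw [h1 hn, smul_zero]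
  | lie hk _ _ h1 h2 => rw [h1 (by omega), zero_lie]

theorem mapLetters {Y : Type*} {v : Y → ℕ} (f : X → Option Y)
    (hf : ∀ x, ∀ y ∈ f x, v y ≤ w x) {n : ℕ} {a : FreeLieAlgebra R X} (ha : Weight w n a) :
    Weight v n (mapLetters f a) := by
  induction ha with
  | of x k hk =>
    rw [mapLetters_of]
    cases h : f x with
    | none => exact .zero k
    | some y => exact .of y k ((hf x y h).trans hk)
  | zero k => rw [map_zero]; exact .zero k
  | add _ _ h1 h2 => rw [map_add]; exact .add h1 h2
  | smul c _ h1 => rw [map_smul]; exact .smul c h1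
  | lie hk _ _ h1 h2 => rw [LieHom.map_lie]; exact .lie hk h1 h2

theorem exists_weight (w : X → ℕ) (a : FreeLieAlgebra R X) : ∃ n, Weight w n a := by
  induction a using induction_on with
  | hof x => exact ⟨_, .of x _ le_rfl⟩
  | hzero => exact ⟨0, .zero 0⟩
  | hadd a b h1 h2 =>
    obtain ⟨m, h1⟩ := h1
    obtain ⟨n, h2⟩ := h2
    exact ⟨max m n, .add (h1.mono (le_max_left _ _)) (h2.mono (le_max_right _ _))⟩
  | hsmul c a h =>
    obtain ⟨m, h⟩ := h
    exact ⟨m, .smul c h⟩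
  | hlie a b h1 h2 =>
    obtain ⟨m, h1⟩ := h1
    obtain ⟨n, h2⟩ := h2
    exact ⟨m + n, .lie le_rfl h1 h2⟩

end Weight

/-! ### Elimination of a letter -/

variable (R) in
/-- The homomorphism sending the letter `(i, x)` to the `i`-fold bracket of the eliminated letter
with `x`. -/
def unElim (X : Type*) : FreeLieAlgebra R (ℕ × X) →ₗ⁅R⁆ FreeLieAlgebra R (Option X) :=
  lift R (fun z => (fun b => ⁅(of R none : FreeLieAlgebra R (Option X)), b⁆)^[z.1] (of R (some z.2)))

theorem unElim_of {X : Type*} (i : ℕ) (x : X) :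
    unElim R X (of R (i, x)) = (fun b => ⁅(of R none : FreeLieAlgebra R (Option X)), b⁆)^[i] (of R (some x)) :=
  lift_of_apply _ _

theorem unElim_of_zero {X : Type*} (x : X) : unElim R X (of R (0, x)) = of R (some x) :=
  unElim_of 0 x

theorem unElim_of_succ {X : Type*} (i : ℕ) (x : X) :
    unElim R X (of R (i + 1, x)) = ⁅(of R none : FreeLieAlgebra R (Option X)), unElim R X (of R (i, x))⁆ := by
  rw [unElim_of, unElim_of, Function.iterate_succ_apply']

/-- Bracketing with the eliminated letter is a derivation that moves `(i, x)` to `(i + 1, x)`. The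
weight `z.1 + 1` counts the original letters in the bracket that `z` stands for, so it grows by one.
-/
theorem exists_lie_none_unElim {X : Type*} {n : ℕ} {a : FreeLieAlgebra R (ℕ × X)}
    (ha : Weight (fun z => z.1 + 1) n a) :
    ∃ b, Weight (fun z => z.1 + 1) (n + 1) b ∧ ⁅(of R none : FreeLieAlgebra R (Option X)), unElim R X a⁆ = unElim R X b := by
  induction ha with
  | of z k hk =>
    obtain ⟨i, x⟩ := z
    exact ⟨of R (i + 1, x), .of _ _ (by simpa using hk), (unElim_of_succ i x).symm⟩
  | zero k => exact ⟨0, .zero _, by simp⟩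
  | add _ _ h1 h2 =>
    obtain ⟨b1, h1, e1⟩ := h1
    obtain ⟨b2, h2, e2⟩ := h2
    exact ⟨b1 + b2, .add h1 h2, by rw [map_add, lie_add, e1, e2, map_add]⟩
  | smul c _ h =>
    obtain ⟨b, h, e⟩ := h
    exact ⟨c • b, .smul c h, by rw [map_smul, lie_smul, e, map_smul]⟩
  | @lie m n k a1 a2 hk w1 w2 h1 h2 =>
    obtain ⟨b1, h1, e1⟩ := h1
    obtain ⟨b2, h2, e2⟩ := h2
    exact ⟨⁅b1, a2⁆ + ⁅a1, b2⁆, .add (.lie (by omega) h1 w2) (.lie (by omega) w1 h2), by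
      rw [LieHom.map_lie, leibniz_lie, e1, e2, map_add, LieHom.map_lie, LieHom.map_lie]⟩

/-- The spanning half of Lazard elimination: brackets of the eliminated letter with the image of
`unElim` stay in that image. The clause for `n = 0` protects the weight bound in the bracket case,
where a term `c1 • d2` of weight `n + 1` fits below `m + n` only if `m > 0` or `c1 = 0`. -/
theorem exists_eq_unElim {X : Type*} {n : ℕ} {a : FreeLieAlgebra R (Option X)}
    (ha : Weight (fun _ => 1) n a) :
    ∃ (c : R) (b : FreeLieAlgebra R (ℕ × X)), Weight (fun z => z.1 + 1) n b ∧
      a = c • of R none + unElim R X b ∧ (n = 0 → c = 0) := by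
  induction ha with
  | of x k hk =>
    cases x with
    | none => exact ⟨1, 0, .zero _, by simp, by omega⟩
    | some x => exact ⟨0, of R (0, x), .of _ _ hk, by simp [unElim_of_zero], fun _ => rfl⟩
  | zero k => exact ⟨0, 0, .zero _, by simp, fun _ => rfl⟩
  | add _ _ h1 h2 =>
    obtain ⟨c1, b1, h1, e1, z1⟩ := h1
    obtain ⟨c2, b2, h2, e2, z2⟩ := h2
    exact ⟨c1 + c2, b1 + b2, .add h1 h2, by rw [e1, e2, map_add, add_smul]; abel,
      fun h => by rw [z1 h, z2 h, add_zero]⟩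
  | smul c _ h =>
    obtain ⟨c1, b1, h1, e1, z1⟩ := h
    exact ⟨c * c1, c • b1, .smul c h1, by rw [e1, smul_add, map_smul, smul_smul],
      fun h => by rw [z1 h, mul_zero]⟩
  | @lie m n k a1 a2 hk w1 w2 h1 h2 =>
    obtain ⟨c1, b1, h1, e1, z1⟩ := h1
    obtain ⟨c2, b2, h2, e2, z2⟩ := h2
    obtain ⟨d1, g1, f1⟩ := exists_lie_none_unElim h1
    obtain ⟨d2, g2, f2⟩ := exists_lie_none_unElim h2
    refine ⟨0, ⁅b1, b2⁆ + (c1 • d2 + (-c2) • d1), .add (.lie hk h1 h2) (.add ?_ ?_), ?_,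
      fun _ => rfl⟩
    · rcases Nat.eq_zero_or_pos m with h0 | h0
      · rw [z1 h0, zero_smul]; exact .zero _
      · exact .smul _ (g2.mono (by omega))
    · rcases Nat.eq_zero_or_pos n with h0 | h0
      · rw [z2 h0, neg_zero, zero_smul]; exact .zero _
      · exact .smul _ (g1.mono (by omega))
    · rw [e1, e2, zero_smul, zero_add, map_add, map_add, map_smul, map_smul, ← f1, ← f2,
        LieHom.map_lie, lie_add, add_lie, add_lie, smul_lie, smul_lie, lie_smul, lie_smul, lie_self,
        ← lie_skew (unElim R X b1) (of R none)]
      module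

/-- A letter `(i + 1, x)` weighs at least two, so brackets containing one have length at most `n -
1`. Collecting the other brackets in `b` leaves a remainder within reach of induction on length; the
last clause lets a projection of letters recover `b` from `a`. -/
theorem exists_eq_mapLetters_add {X : Type*} {n : ℕ} {a : FreeLieAlgebra R (ℕ × X)}
    (ha : Weight (fun z => z.1 + 1) n a) :
    ∃ (b : FreeLieAlgebra R X) (c : FreeLieAlgebra R (ℕ × X)),
      Weight (fun _ => 1) n b ∧ Weight (fun _ => 1) (n - 1) c ∧
      a = mapLetters (fun x => some (0, x)) b + c ∧
      mapLetters (fun z => if z.1 = 0 then some z.2 else none) c = 0 := by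
  induction ha with
  | of z k hk =>
    obtain ⟨i, x⟩ := z
    cases i with
    | zero => exact ⟨of R x, 0, .of _ _ (by simpa using hk), .zero _, by simp, by simp⟩
    | succ i =>
      exact ⟨0, of R (i + 1, x), .zero _, .of _ _ (by simp at hk; omega), by simp, by simp⟩
  | zero k => exact ⟨0, 0, .zero _, .zero _, by simp, by simp⟩
  | add _ _ h1 h2 =>
    obtain ⟨b1, c1, u1, v1, e1, z1⟩ := h1
    obtain ⟨b2, c2, u2, v2, e2, z2⟩ := h2
    exact ⟨b1 + b2, c1 + c2, .add u1 u2, .add v1 v2, by rw [e1, e2, map_add]; abel,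
      by rw [map_add, z1, z2, add_zero]⟩
  | smul c _ h =>
    obtain ⟨b1, c1, u1, v1, e1, z1⟩ := h
    exact ⟨c • b1, c • c1, .smul c u1, .smul c v1, by rw [e1, map_smul, smul_add],
      by rw [map_smul, z1, smul_zero]⟩
  | @lie m n k a1 a2 hk w1 w2 h1 h2 =>
    -- Weight zero forces the zero element; once it is excluded, the truncated subtractions below
    -- behave.
    rcases Nat.eq_zero_or_pos m with h0 | h0
    · rw [w1.eq_zero (fun _ => Nat.succ_pos _) h0, zero_lie]
      exact ⟨0, 0, .zero _, .zero _, by simp, by simp⟩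
    rcases Nat.eq_zero_or_pos n with h0' | h0'
    · rw [w2.eq_zero (fun _ => Nat.succ_pos _) h0', lie_zero]
      exact ⟨0, 0, .zero _, .zero _, by simp, by simp⟩
    obtain ⟨b1, c1, u1, v1, e1, z1⟩ := h1
    obtain ⟨b2, c2, u2, v2, e2, z2⟩ := h2
    have x1 : Weight (fun _ => 1) m (mapLetters (fun x => some (0, x)) b1 :
      FreeLieAlgebra R (ℕ × X)) := u1.mapLetters _ (fun _ _ _ => le_rfl)
    have x2 : Weight (fun _ => 1) n (mapLetters (fun x => some (0, x)) b2 :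
      FreeLieAlgebra R (ℕ × X)) := u2.mapLetters _ (fun _ _ _ => le_rfl)
    refine ⟨⁅b1, b2⁆, ⁅mapLetters (fun x => some (0, x)) b1, c2⁆ +
      (⁅c1, mapLetters (fun x => some (0, x)) b2⁆ + ⁅c1, c2⁆), .lie hk u1 u2, ?_, ?_, ?_⟩
    · exact .add (.lie (by omega) x1 v2) (.add (.lie (by omega) v1 x2) (.lie (by omega) v1 v2))
    · rw [e1, e2, LieHom.map_lie, lie_add, add_lie, add_lie]; abel
    · simp [z1, z2]

/-! ### The free Lie algebra embeds into the free associative algebra -/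

/-- The derivation of the free associative algebra shifting the first index of the letters. -/
theorem exists_shift (X : Type*) : ∃ D : Module.End R (FreeAlgebra R (ℕ × X)),
    (∀ a b, D (a * b) = D a * b + a * D b) ∧
    ∀ i x, D (FreeAlgebra.ι R (i, x)) = FreeAlgebra.ι R (i + 1, x) := by
  -- A derivation `D` is the same as an algebra homomorphism `a ↦ a + ε D a` into the square-zero
  -- extension, and freeness provides the latter.
  let φ : FreeAlgebra R (ℕ × X) →ₐ[R] TrivSqZeroExt (FreeAlgebra R (ℕ × X))
      (FreeAlgebra R (ℕ × X)) :=
    FreeAlgebra.lift R (fun z => TrivSqZeroExt.inl (FreeAlgebra.ι R z) +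
      TrivSqZeroExt.inr (FreeAlgebra.ι R (z.1 + 1, z.2)))
  have h1 : ∀ a, (φ a).fst = a := by
    intro a
    have : (TrivSqZeroExt.fstHom R (FreeAlgebra R (ℕ × X)) (FreeAlgebra R (ℕ × X))).comp φ =
        AlgHom.id R _ := by
      ext z; simp [φ]
    exact DFunLike.congr_fun this a
  refine ⟨(TrivSqZeroExt.sndHom _ _).restrictScalars R ∘ₗ φ.toLinearMap, fun a b => ?_,
    fun i x => by simp [φ]⟩
  simp [h1, add_comm]

/-- Let the eliminated letter act on the free associative algebra on `ℕ × X` as the shift derivation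
`D`, and `x` as left multiplication by `(0, x)`. Since `[D, L_u] = L_{D u}`, the image of `a` acts
as left multiplication by its associative image, which evaluation at `1` recovers. -/
theorem toFree_unElim {X : Type*} {a : FreeLieAlgebra R (ℕ × X)}
    (ha : toFree R _ (unElim R X a) = 0) : toFree R _ a = 0 := by
  obtain ⟨D, hD, hι⟩ := exists_shift (R := R) X
  let φ : FreeAlgebra R (Option X) →ₐ[R] Module.End R (FreeAlgebra R (ℕ × X)) :=
    FreeAlgebra.lift R (fun o => o.elim D (fun x => LinearMap.mulLeft R (FreeAlgebra.ι R (0, x))))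
  have key : ∀ a : FreeLieAlgebra R (ℕ × X),
      φ (toFree R _ (unElim R X a)) = LinearMap.mulLeft R (toFree R _ a) := by
    intro a
    induction a using induction_on with
    | hof z =>
      obtain ⟨i, x⟩ := z
      induction i with
      | zero => rw [unElim_of_zero]; simp [φ]
      | succ i ih =>
        rw [unElim_of_succ, LieHom.map_lie, LieRing.of_associative_ring_bracket, map_sub, map_mul,
          map_mul, ih]
        ext b
        simp [φ, hD, hι]
    | hzero => ext; simp
    | hadd a b h1 h2 => ext; simp [h1, h2, add_mul]
    | hsmul c a h => ext; simp [h]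
    | hlie a b h1 h2 =>
      rw [LieHom.map_lie, LieHom.map_lie, LieHom.map_lie, LieRing.of_associative_ring_bracket,
        LieRing.of_associative_ring_bracket, map_sub, map_mul, map_mul, h1, h2]
      ext
      simp [sub_mul, mul_assoc]
  have := key a
  rw [ha, map_zero] at this
  simpa using (DFunLike.congr_fun this 1).symm

/-- Induction on the number of letters, inside an outer induction on length. After a letter is
eliminated, the part in the letters `(0, x)` uses fewer letters, while the rest is shorter but lives
on the infinite alphabet `ℕ × X`; this is why `hn` covers all alphabets. -/
theorem eq_zero_of_toFree_of_finite (n : ℕ) (hn : ∀ (X : Type) (a : FreeLieAlgebra R X),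
    Weight (fun _ => 1) n a → toFree R X a = 0 → a = 0) (X : Type) [Finite X] :
    ∀ a : FreeLieAlgebra R X, Weight (fun _ => 1) (n + 1) a → toFree R X a = 0 → a = 0 := by
  induction X using Finite.induction_empty_option with
  | of_equiv e ih =>
    intro a ha h0
    have h := ih (mapLetters (fun y => some (e.symm y)) a) (ha.mapLetters _ fun _ _ _ => le_rfl)
      (by rw [toFree_mapLetters, h0, map_zero])
    have h' := congrArg (mapLetters (fun x => some (e x))) h
    rw [mapLetters_comp] at h'
    simpa [mapLetters_some] using h'
  | h_empty =>
    intro a ha h0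
    clear ha h0
    induction a using induction_on with
    | hof x => exact x.elim
    | hzero => rfl
    | hadd a b h1 h2 => rw [h1, h2, add_zero]
    | hsmul c a h => rw [h, smul_zero]
    | hlie a b h1 h2 => rw [h1, zero_lie]
  | @h_option X _ ih =>
    intro a ha h0
    obtain ⟨c, b, hb, rfl, -⟩ := exists_eq_unElim ha
    have hc : c = 0 := by
      -- The coefficient of the eliminated letter is read off in a commutative ring, where brackets
      -- vanish, with the other letters sent to zero.
      let φ : FreeAlgebra R (Option X) →ₐ[R] DualNumber R :=
        FreeAlgebra.lift R (fun o => o.elim DualNumber.eps 0)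
      have h1 : ∀ b : FreeLieAlgebra R (ℕ × X), φ (toFree R _ (unElim R X b)) = 0 := by
        intro b
        induction b using induction_on with
        | hof z =>
          obtain ⟨i, x⟩ := z
          cases i with
          | zero => rw [unElim_of_zero]; simp [φ]
          | succ i =>
            rw [unElim_of_succ, LieHom.map_lie, LieRing.of_associative_ring_bracket, map_sub,
              map_mul, map_mul, mul_comm, sub_self]
        | hzero => simp
        | hadd a b h1 h2 => simp [h1, h2]
        | hsmul c a h => simp [h]
        | hlie a b h1 h2 =>
          rw [LieHom.map_lie, LieHom.map_lie, LieRing.of_associative_ring_bracket, map_sub,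
            map_mul, map_mul, mul_comm, sub_self]
      have h2 := congrArg (fun t => TrivSqZeroExt.snd (φ t)) h0
      simpa [h1, φ] using h2
    rw [hc, zero_smul, zero_add] at h0 ⊢
    have hb0 := toFree_unElim h0
    obtain ⟨b', c', u, v, e, z⟩ := exists_eq_mapLetters_add hb
    have hb' : b' = 0 := by
      refine ih b' u ?_
      have h3 : mapLetters (fun z => if z.1 = 0 then some z.2 else none) b = b' := by
        rw [e, map_add, z, add_zero, mapLetters_comp]
        simp [mapLetters_some]
      rw [← h3, toFree_mapLetters, hb0, map_zero]
    rw [hb', map_zero, zero_add] at e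
    rw [e, hn _ c' v (e ▸ hb0), map_zero]

/-- Quantifying over all larger alphabets `t` allows the two parts of a sum or a bracket to be
written in a common one. -/
theorem exists_finset_mapLetters {X : Type*} {n : ℕ} {a : FreeLieAlgebra R X}
    (ha : Weight (fun _ => 1) n a) :
    ∃ s : Finset X, ∀ t : Finset X, s ⊆ t → ∃ b : FreeLieAlgebra R t, Weight (fun _ => 1) n b ∧
      mapLetters (fun x => some x.1) b = a := by
  classical
  induction ha with
  | of x k hk =>
    exact ⟨{x}, fun t ht => ⟨of R ⟨x, ht (Finset.mem_singleton_self x)⟩, .of _ _ hk, by simp⟩⟩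
  | zero k => exact ⟨∅, fun t _ => ⟨0, .zero _, by simp⟩⟩
  | add _ _ h1 h2 =>
    obtain ⟨s1, h1⟩ := h1
    obtain ⟨s2, h2⟩ := h2
    refine ⟨s1 ∪ s2, fun t ht => ?_⟩
    obtain ⟨b1, w1, rfl⟩ := h1 t (Finset.union_subset_left ht)
    obtain ⟨b2, w2, rfl⟩ := h2 t (Finset.union_subset_right ht)
    exact ⟨b1 + b2, .add w1 w2, map_add _ _ _⟩
  | smul c _ h =>
    obtain ⟨s, h⟩ := h
    refine ⟨s, fun t ht => ?_⟩
    obtain ⟨b1, w1, rfl⟩ := h t ht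
    exact ⟨c • b1, .smul c w1, map_smul _ _ _⟩
  | lie hk _ _ h1 h2 =>
    obtain ⟨s1, h1⟩ := h1
    obtain ⟨s2, h2⟩ := h2
    refine ⟨s1 ∪ s2, fun t ht => ?_⟩
    obtain ⟨b1, w1, rfl⟩ := h1 t (Finset.union_subset_left ht)
    obtain ⟨b2, w2, rfl⟩ := h2 t (Finset.union_subset_right ht)
    exact ⟨⁅b1, b2⁆, .lie hk w1 w2, LieHom.map_lie _ _ _⟩

theorem eq_zero_of_toFree (n : ℕ) : ∀ (X : Type) (a : FreeLieAlgebra R X),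
    Weight (fun _ => 1) n a → toFree R X a = 0 → a = 0 := by
  classical
  induction n with
  | zero => exact fun X a ha _ => ha.eq_zero (fun _ => Nat.one_pos) rfl
  | succ n ih =>
    intro X a ha h0
    obtain ⟨s, hs⟩ := exists_finset_mapLetters ha
    obtain ⟨b, wb, rfl⟩ := hs s subset_rfl
    have h3 : mapLetters (fun x => if h : x ∈ s then some ⟨x, h⟩ else none)
        (mapLetters (fun x : s => some x.1) b) = b := by
      rw [mapLetters_comp]
      simp [mapLetters_some]
    rw [eq_zero_of_toFree_of_finite n ih s b wb (by rw [← h3, toFree_mapLetters, h0, map_zero]),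
      map_zero]

/-- The free Lie algebra embeds into the free associative algebra. -/
theorem toFree_injective (X : Type) : Function.Injective (toFree R X) := by
  refine (injective_iff_map_eq_zero _).2 fun a ha => ?_
  obtain ⟨n, hn⟩ := Weight.exists_weight (fun _ => 1) a
  exact eq_zero_of_toFree n X a hn ha

end FreeLieAlgebra
end

noncomputable section

namespace HandlebodyJohnson

open Subgroup
open scoped commutatorElement

/-! ### Commutator calculus for the series of a normal subgroup -/

section LowerSeries

variable {P : Type*} [Group P] (A : Subgroup P)

theorem lowerSeries_succ_succ (m : ℕ) :
    lowerSeries A (m + 2) = ⁅lowerSeries A (m + 1), A⁆ := rfl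

instance lowerSeries_normal [A.Normal] (m : ℕ) : (lowerSeries A m).Normal := by
  induction m using lowerSeries.induct with
  | case1 => exact (inferInstance : (⊤ : Subgroup P).Normal)
  | case2 => assumption
  | case3 m ih => exact Subgroup.commutator_normal _ _

theorem commutator_lowerSeries_self_le [A.Normal] (m : ℕ) :
    ⁅lowerSeries A m, A⁆ ≤ lowerSeries A (m + 1) := by
  cases m with
  -- In degree zero the claim is `[π, A] ≤ A`, that is, normality.
  | zero => exact Subgroup.commutator_le_right _ _
  | succ m => exact le_rfl

theorem lowerSeries_antitone [A.Normal] : Antitone (lowerSeries A) := by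
  refine antitone_nat_of_succ_le fun m => ?_
  cases m with
  | zero => exact le_top
  | succ m => exact Subgroup.commutator_le_left _ _

/-- The three subgroups lemma, applied in the quotient by `N`. -/
theorem commutator_le_of_rotate {H₁ H₂ H₃ N : Subgroup P} [N.Normal] (h1 : ⁅⁅H₂, H₃⁆, H₁⁆ ≤ N)
    (h2 : ⁅⁅H₃, H₁⁆, H₂⁆ ≤ N) : ⁅⁅H₁, H₂⁆, H₃⁆ ≤ N := by
  have key : ∀ K : Subgroup P, K.map (QuotientGroup.mk' N) = ⊥ ↔ K ≤ N := fun K => by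
    rw [Subgroup.map_eq_bot_iff, QuotientGroup.ker_mk']
  rw [← key] at h1 h2 ⊢
  simp only [Subgroup.map_commutator] at h1 h2 ⊢
  exact Subgroup.commutator_commutator_eq_bot_of_rotate h1 h2

/-- By the three subgroups lemma, `[[A_{n+1}, A], A_m]` is controlled by `[[A, A_m], A_{n+1}]` and
`[[A_m, A_{n+1}], A]`, both covered by induction on `n`. -/
theorem commutator_lowerSeries_le [A.Normal] (m n : ℕ) :
    ⁅lowerSeries A m, lowerSeries A n⁆ ≤ lowerSeries A (m + n) := by
  induction n generalizing m with
  | zero => exact Subgroup.commutator_le_left _ _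
  | succ n ih =>
    cases n with
    | zero => exact commutator_lowerSeries_self_le A m
    | succ n =>
      rw [lowerSeries_succ_succ, Subgroup.commutator_comm]
      refine commutator_le_of_rotate ?_ ?_
      · rw [Subgroup.commutator_comm A]
        refine (Subgroup.commutator_mono (commutator_lowerSeries_self_le A m) le_rfl).trans
          ((ih (m + 1)).trans (lowerSeries_antitone A (by omega)))
      · exact (Subgroup.commutator_mono (ih m) le_rfl).trans
          (commutator_lowerSeries_self_le A _)

theorem map_lowerSeries_of_surjective {Q : Type*} [Group Q] (f : P →* Q)
    (hf : Function.Surjective f) (m : ℕ) :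
    (lowerSeries A m).map f = lowerSeries (A.map f) m := by
  induction m using lowerSeries.induct with
  | case1 => exact Subgroup.map_top_of_surjective f hf
  | case2 => rfl
  | case3 m ih => rw [lowerSeries, Subgroup.map_commutator, ih, lowerSeries]

end LowerSeries

/-! ### The graded Lie ring of a group -/

section Graded

variable (G : Type*) [Group G]

/-- The lower central series of a group, indexed by degrees: `G = Γ_0 = Γ_1 ≥ Γ_2 ≥ ⋯`. -/
abbrev lcs (k : ℕ) : Subgroup G := lowerSeries (⊤ : Subgroup G) k

variable {G} in
theorem commutatorElement_mem_lcs {i j : ℕ} {x y : G} (hx : x ∈ lcs G i) (hy : y ∈ lcs G j) :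
    ⁅x, y⁆ ∈ lcs G (i + j) :=
  commutator_lowerSeries_le _ _ _ (Subgroup.commutator_mem_commutator hx hy)

variable {G} in
theorem commutatorElement_mem_lcs_succ {i : ℕ} {x : G} (y : G) (hx : x ∈ lcs G i) :
    ⁅x, y⁆ ∈ lcs G (i + 1) :=
  commutatorElement_mem_lcs hx (Subgroup.mem_top y)

/-- The degree `k` part `Γ_k / Γ_{k+1}` of the graded Lie ring, in multiplicative notation. -/
abbrev GrMul (k : ℕ) : Type _ := lcs G k ⧸ (lcs G (k + 1)).subgroupOf (lcs G k)

variable {G}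

theorem GrMul.mk_eq {k : ℕ} {x y : G} (hx : x ∈ lcs G k) (hy : y ∈ lcs G k) :
    ((⟨x, hx⟩ : lcs G k) : GrMul G k) = ((⟨y, hy⟩ : lcs G k) : GrMul G k) ↔
      x⁻¹ * y ∈ lcs G (k + 1) := by
  rw [QuotientGroup.eq, Subgroup.mem_subgroupOf]
  rfl

instance (k : ℕ) : CommGroup (GrMul G k) :=
  { (inferInstance : Group (GrMul G k)) with
    mul_comm := by
      rintro ⟨x, hx⟩ ⟨y, hy⟩
      refine (GrMul.mk_eq (mul_mem hx hy) (mul_mem hy hx)).2 ?_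
      have : (x * y)⁻¹ * (y * x) = ⁅y⁻¹, x⁻¹⁆ := by rw [commutatorElement_def]; group
      rw [this]
      exact commutatorElement_mem_lcs_succ _ (inv_mem hy) }

theorem commutatorElement_mul_left (x y z : G) : ⁅x * y, z⁆ = ⁅x, ⁅y, z⁆⁆ * ⁅y, z⁆ * ⁅x, z⁆ := by
  simp only [commutatorElement_def]; group

theorem commutatorElement_mul_right (x y z : G) :
    ⁅x, y * z⁆ = ⁅x, y⁆ * (⁅y, ⁅x, z⁆⁆ * ⁅x, z⁆) := by
  simp only [commutatorElement_def]; group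

/-- The commutator is additive up to `⁅x, ⁅y, z⁆⁆`, which lies one degree deeper and dies in the
quotient. -/
theorem grMul_comm_mul_left {i j : ℕ} {x y z : G} (hx : x ∈ lcs G i) (hy : y ∈ lcs G i)
    (hz : z ∈ lcs G j) :
    (⟨⁅x * y, z⁆, commutatorElement_mem_lcs (mul_mem hx hy) hz⟩ : lcs G (i + j)) =
    ((⟨⁅x, z⁆, commutatorElement_mem_lcs hx hz⟩ : lcs G (i + j)) : GrMul G (i + j)) *
      (⟨⁅y, z⁆, commutatorElement_mem_lcs hy hz⟩ : lcs G (i + j)) := by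
  rw [mul_comm, ← QuotientGroup.mk_mul]
  refine ((GrMul.mk_eq _ _).2 ?_).symm
  rw [commutatorElement_mul_left, mul_assoc, mul_inv_rev, ← mul_assoc, mul_assoc]
  have : ⁅x, ⁅y, z⁆⁆ ∈ lcs G (i + j + 1) := by
    have := commutatorElement_mem_lcs_succ x (commutatorElement_mem_lcs hy hz)
    rw [← commutatorElement_inv]
    exact inv_mem this
  have h := (lowerSeries_normal (⊤ : Subgroup G) (i + j + 1)).conj_mem _ this
    ((⁅x, z⁆)⁻¹ * (⁅y, z⁆)⁻¹)
  convert h using 1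
  group

theorem grMul_comm_mul_right {i j : ℕ} {x y z : G} (hx : x ∈ lcs G i) (hy : y ∈ lcs G j)
    (hz : z ∈ lcs G j) :
    (⟨⁅x, y * z⁆, commutatorElement_mem_lcs hx (mul_mem hy hz)⟩ : lcs G (i + j)) =
    ((⟨⁅x, y⁆, commutatorElement_mem_lcs hx hy⟩ : lcs G (i + j)) : GrMul G (i + j)) *
      (⟨⁅x, z⁆, commutatorElement_mem_lcs hx hz⟩ : lcs G (i + j)) := by
  rw [← QuotientGroup.mk_mul]
  refine ((GrMul.mk_eq _ _).2 ?_).symm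
  rw [commutatorElement_mul_right]
  have : ⁅y, ⁅x, z⁆⁆ ∈ lcs G (i + j + 1) := by
    have := commutatorElement_mem_lcs_succ y (commutatorElement_mem_lcs hx hz)
    rw [← commutatorElement_inv]
    exact inv_mem this
  have h := (lowerSeries_normal (⊤ : Subgroup G) (i + j + 1)).conj_mem _ this (⁅x, z⁆)⁻¹
  convert h using 1
  group

/-- The bracket of the graded Lie ring, induced by group commutators. -/
def grBracket (i j : ℕ) : GrMul G i →* GrMul G j →* GrMul G (i + j) :=
  QuotientGroup.lift _
    (MonoidHom.mk' (fun x : lcs G i => QuotientGroup.lift _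
      (MonoidHom.mk' (fun y : lcs G j =>
        ((⟨⁅x.1, y.1⁆, commutatorElement_mem_lcs x.2 y.2⟩ : lcs G (i + j)) : GrMul G (i + j)))
        (fun y z => grMul_comm_mul_right x.2 y.2 z.2))
      (fun y hy => (QuotientGroup.eq_one_iff _).2
        (commutatorElement_mem_lcs (j := j + 1) x.2 hy)))
      (fun x y => by
        ext z
        exact grMul_comm_mul_left x.2 y.2 z.2))
    (fun x hx => by
      ext z
      refine (QuotientGroup.eq_one_iff _).2 ?_
      have := commutatorElement_mem_lcs (i := i + 1) hx z.2
      rw [Nat.add_right_comm] at this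
      exact this)

variable (G) in
/-- The degree `k` part `Γ_k / Γ_{k+1}` of the graded Lie ring. -/
abbrev GrPart (k : ℕ) : Type _ := Additive (GrMul G k)

instance : DirectSum.GNonUnitalNonAssocSemiring (GrPart G) where
  mul {i j} a b := Additive.ofMul (grBracket i j a.toMul b.toMul)
  mul_zero {i j} a := congrArg Additive.ofMul (map_one (grBracket i j a.toMul))
  zero_mul {i j} b := congrArg Additive.ofMul (DFunLike.congr_fun (map_one (grBracket i j)) b.toMul)
  mul_add {i j} a b c := congrArg Additive.ofMul (map_mul (grBracket i j a.toMul) b.toMul c.toMul)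
  add_mul {i j} a b c := congrArg Additive.ofMul
    (DFunLike.congr_fun (map_mul (grBracket i j) a.toMul b.toMul) c.toMul)

variable (G) in
/-- The graded Lie ring of a group. -/
abbrev GrLie : Type _ := DirectSum ℕ (GrPart G)

instance : NonUnitalNonAssocRing (GrLie G) :=
  { (inferInstance : AddCommGroup (GrLie G)),
    (inferInstance : NonUnitalNonAssocSemiring (GrLie G)) with }

/-- The class of an element of `Γ_k` in the degree `k` part of the graded Lie ring. -/
def cl (k : ℕ) (x : G) (hx : x ∈ lcs G k) : GrLie G :=
  DirectSum.of (GrPart G) k (Additive.ofMul ((⟨x, hx⟩ : lcs G k) : GrMul G k))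

theorem cl_congr {k l : ℕ} {x y : G} (hx : x ∈ lcs G k) (hkl : k = l) (hxy : x = y) :
    cl k x hx = cl l y (hkl ▸ hxy ▸ hx) := by
  subst hkl hxy; rfl

theorem cl_eq_zero_iff {k : ℕ} {x : G} (hx : x ∈ lcs G k) :
    cl k x hx = 0 ↔ x ∈ lcs G (k + 1) := by
  rw [cl, ← map_zero (DirectSum.of (GrPart G) k), (DirectSum.of_injective k).eq_iff]
  exact QuotientGroup.eq_one_iff _

theorem cl_mul {k : ℕ} {x y : G} (hx : x ∈ lcs G k) (hy : y ∈ lcs G k) :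
    cl k (x * y) (mul_mem hx hy) = cl k x hx + cl k y hy :=
  map_add (DirectSum.of (GrPart G) k) (Additive.ofMul ((⟨x, hx⟩ : lcs G k) : GrMul G k))
    (Additive.ofMul ((⟨y, hy⟩ : lcs G k) : GrMul G k))

theorem cl_inv {k : ℕ} {x : G} (hx : x ∈ lcs G k) :
    cl k x⁻¹ (inv_mem hx) = -cl k x hx :=
  map_neg (DirectSum.of (GrPart G) k) (Additive.ofMul ((⟨x, hx⟩ : lcs G k) : GrMul G k))

theorem cl_one (k : ℕ) : cl k (1 : G) (one_mem _) = 0 :=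
  map_zero (DirectSum.of (GrPart G) k)

theorem cl_conj {k : ℕ} {x : G} (g : G) (hx : x ∈ lcs G k) :
    cl k (g * x * g⁻¹) ((lowerSeries_normal _ k).conj_mem x hx g) = cl k x hx := by
  have h : ⁅x⁻¹, g⁆ ∈ lcs G (k + 1) := commutatorElement_mem_lcs_succ g (inv_mem hx)
  have h1 : g * x * g⁻¹ = x * ⁅x⁻¹, g⁆ := by rw [commutatorElement_def]; group
  rw [cl_congr _ rfl h1, cl_mul hx (lowerSeries_antitone _ k.le_succ h),
    (cl_eq_zero_iff _).2 h, add_zero]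

theorem cl_mul_cl {i j : ℕ} {x y : G} (hx : x ∈ lcs G i) (hy : y ∈ lcs G j) :
    cl i x hx * cl j y hy = cl (i + j) ⁅x, y⁆ (commutatorElement_mem_lcs hx hy) :=
  DirectSum.of_mul_of _ _

theorem GrLie.induction_on {p : GrLie G → Prop} (h0 : p 0) (hcl : ∀ k x hx, p (cl k x hx))
    (hadd : ∀ a b, p a → p b → p (a + b)) (a : GrLie G) : p a := by
  induction a using DirectSum.induction_on with
  | zero => exact h0
  | of k x =>
    obtain ⟨x, hx⟩ := x
    exact hcl k x hx
  | add a b h1 h2 => exact hadd a b h1 h2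

theorem grLie_mul_comm (a b : GrLie G) : a * b = -(b * a) := by
  induction a using GrLie.induction_on with
  | h0 => simp
  | hadd a a' h1 h2 => rw [add_mul, h1, h2, mul_add, neg_add]
  | hcl i x hx =>
    induction b using GrLie.induction_on with
    | h0 => simp
    | hadd b b' h1 h2 => rw [mul_add, h1, h2, add_mul, neg_add]
    | hcl j y hy =>
      rw [cl_mul_cl, cl_mul_cl, ← cl_inv]
      exact cl_congr _ (add_comm i j) (commutatorElement_inv y x).symm

theorem grLie_mul_self (a : GrLie G) : a * a = 0 := by
  induction a using GrLie.induction_on with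
  | h0 => simp
  | hadd a b h1 h2 => rw [add_mul, mul_add, mul_add, h1, h2, grLie_mul_comm a b]; abel
  | hcl i x hx =>
    rw [cl_mul_cl, cl_congr _ rfl (commutatorElement_self x), cl_one]

/-- This is the Hall–Witt identity: its conjugations are invisible in the graded ring by `cl_conj`,
and its inverses only contribute an overall sign. -/
theorem grLie_jacobi_cl {i j k : ℕ} {x y z : G} (hx : x ∈ lcs G i) (hy : y ∈ lcs G j)
    (hz : z ∈ lcs G k) :
    cl i x hx * cl j y hy * cl k z hz + cl k z hz * cl i x hx * cl j y hy +
      cl j y hy * cl k z hz * cl i x hx = 0 := by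
  have hw : x * ⁅⁅x⁻¹, y⁆, z⁆ * x⁻¹ * (z * ⁅⁅z⁻¹, x⁆, y⁆ * z⁻¹) * (y * ⁅⁅y⁻¹, z⁆, x⁆ * y⁻¹) = 1 := by
    simp only [commutatorElement_def]; group
  have m1 := commutatorElement_mem_lcs (commutatorElement_mem_lcs (inv_mem hx) hy) hz
  have m2 := commutatorElement_mem_lcs (commutatorElement_mem_lcs (inv_mem hz) hx) hy
  have m3 := commutatorElement_mem_lcs (commutatorElement_mem_lcs (inv_mem hy) hz) hx
  have e1 : cl _ _ m1 = -(cl i x hx * cl j y hy * cl k z hz) := by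
    rw [← cl_mul_cl (commutatorElement_mem_lcs (inv_mem hx) hy) hz, ← cl_mul_cl (inv_mem hx) hy,
      cl_inv, neg_mul, neg_mul]
  have e2 : cl _ _ m2 = -(cl k z hz * cl i x hx * cl j y hy) := by
    rw [← cl_mul_cl (commutatorElement_mem_lcs (inv_mem hz) hx) hy, ← cl_mul_cl (inv_mem hz) hx,
      cl_inv, neg_mul, neg_mul]
  have e3 : cl _ _ m3 = -(cl j y hy * cl k z hz * cl i x hx) := by
    rw [← cl_mul_cl (commutatorElement_mem_lcs (inv_mem hy) hz) hx, ← cl_mul_cl (inv_mem hy) hz,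
      cl_inv, neg_mul, neg_mul]
  have d2 : k + i + j = i + j + k := by omega
  have d3 : j + k + i = i + j + k := by omega
  rw [cl_congr m2 d2 rfl, ← cl_conj z] at e2
  rw [cl_congr m3 d3 rfl, ← cl_conj y] at e3
  rw [← cl_conj x] at e1
  have n1 := (lowerSeries_normal (⊤ : Subgroup G) _).conj_mem _ m1 x
  have n2 := (lowerSeries_normal (⊤ : Subgroup G) _).conj_mem _ (d2 ▸ m2) z
  have n3 := (lowerSeries_normal (⊤ : Subgroup G) _).conj_mem _ (d3 ▸ m3) y
  have h := (cl_congr (mul_mem (mul_mem n1 n2) n3) rfl hw).trans (cl_one (G := G) (i + j + k))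
  rw [cl_mul (mul_mem n1 n2) n3, cl_mul n1 n2, e1, e2, e3] at h
  rw [← neg_eq_zero, ← h]
  abel

theorem grLie_jacobi (a b c : GrLie G) : a * b * c + c * a * b + b * c * a = 0 := by
  induction a using GrLie.induction_on with
  | h0 => simp
  | hadd a a' h1 h2 =>
    have h := congrArg₂ (· + ·) h1 h2
    refine Eq.trans ?_ (h.trans (add_zero 0))
    simp only [add_mul, mul_add]
    abel
  | hcl i x hx =>
    induction b using GrLie.induction_on with
    | h0 => simp
    | hadd a a' h1 h2 =>
      have h := congrArg₂ (· + ·) h1 h2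
      refine Eq.trans ?_ (h.trans (add_zero 0))
      simp only [add_mul, mul_add]
      abel
    | hcl j y hy =>
      induction c using GrLie.induction_on with
      | h0 => simp
      | hadd a a' h1 h2 =>
        have h := congrArg₂ (· + ·) h1 h2
        refine Eq.trans ?_ (h.trans (add_zero 0))
        simp only [add_mul, mul_add]
        abel
      | hcl k z hz => exact grLie_jacobi_cl hx hy hz

instance : LieRing (GrLie G) :=
  { (inferInstance : AddCommGroup (GrLie G)) with
    bracket := fun a b => a * b
    add_lie := add_mul
    lie_add := mul_add
    lie_self := grLie_mul_self
    leibniz_lie := fun a b c => by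
      have h := grLie_jacobi a b c
      change a * (b * c) = a * b * c + b * (a * c)
      rw [grLie_mul_comm a (b * c), grLie_mul_comm b (a * c), grLie_mul_comm a c, neg_mul, neg_neg,
        neg_eq_iff_add_eq_zero, ← h]
      abel }

theorem lie_cl_cl {i j : ℕ} {x y : G} (hx : x ∈ lcs G i) (hy : y ∈ lcs G j) :
    ⁅cl i x hx, cl j y hy⁆ = cl (i + j) ⁅x, y⁆ (commutatorElement_mem_lcs hx hy) :=
  cl_mul_cl hx hy

end Graded

end HandlebodyJohnson
end

noncomputable section

namespace HandlebodyJohnson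

open scoped commutatorElement

attribute [local instance 100] LieRing.ofAssociativeRing
attribute [local instance 100] LieAlgebra.ofAssociativeAlgebra

/-! ### The Magnus representation of a free group -/

section Magnus

variable {Y : Type*}

/-- Formal noncommutative power series with integer coefficients, as functions on words. -/
abbrev Series (Y : Type*) : Type _ := List Y → ℤ

/-- The series `1`. -/
def Series.unit : Series Y := fun w => if w = [] then 1 else 0

open Classical in
/-- Left multiplication by a letter. -/
def letterMul (y : Y) : Module.End ℤ (Series Y) where
  toFun f w := match w with
    | [] => 0
    | z :: w => if z = y then f w else 0
  map_add' f f' := by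
    funext w
    match w with
    | [] => simp
    | z :: w => simp only [Pi.add_apply]; split_ifs <;> simp
  map_smul' c f := by
    funext w
    match w with
    | [] => simp
    | z :: w => simp

theorem letterMul_nil (y : Y) (f : Series Y) : letterMul y f [] = 0 := rfl

open Classical in
theorem letterMul_cons (y z : Y) (f : Series Y) (w : List Y) :
    letterMul y f (z :: w) = if z = y then f w else 0 := rfl

open Classical in
/-- The values of the inverse of `1 + X_y` on a series. -/
def letterInvFun (y : Y) (f : Series Y) : List Y → ℤ
  | [] => f []
  | z :: w => f (z :: w) - if z = y then letterInvFun y f w else 0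

/-- The inverse of left multiplication by `1 + X_y`. -/
def letterInv (y : Y) : Module.End ℤ (Series Y) where
  toFun f := letterInvFun y f
  map_add' f f' := by
    funext w
    induction w with
    | nil => simp [letterInvFun]
    | cons z w ih =>
      simp only [letterInvFun, Pi.add_apply] at ih ⊢
      split_ifs
      · rw [ih]; ring
      · ring
  map_smul' c f := by
    funext w
    induction w with
    | nil => simp [letterInvFun]
    | cons z w ih =>
      simp only [letterInvFun, Pi.smul_apply, smul_eq_mul, RingHom.id_apply] at ih ⊢
      split_ifs
      · rw [ih]; ring
      · ring

/-- Multiplication by `1 + X_y` as a unit. -/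
def magnusLetter (y : Y) : (Module.End ℤ (Series Y))ˣ where
  val := 1 + letterMul y
  inv := letterInv y
  val_inv := by
    ext f w
    cases w with
    | nil => simp [letterMul_nil, letterInv, letterInvFun]
    | cons z w => simp [letterMul_cons, letterInv, letterInvFun]
  inv_val := by
    ext f w
    induction w with
    | nil => simp [letterMul_nil, letterInv, letterInvFun]
    | cons z w ih =>
      simp only [Module.End.mul_apply, letterInv, LinearMap.coe_mk, AddHom.coe_mk,
        Module.End.one_apply] at ih ⊢
      rw [letterInvFun, ih]
      simp [letterMul_cons]

/-- The Magnus representation of a free group on noncommutative power series. -/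
def magnus (Y : Type*) : FreeGroup Y →* (Module.End ℤ (Series Y))ˣ :=
  FreeGroup.lift magnusLetter

/-- The Magnus representation as a family of operators. -/
def magnusOp (x : FreeGroup Y) : Module.End ℤ (Series Y) := (magnus Y x).val

theorem magnusOp_of (y : Y) : magnusOp (FreeGroup.of y) = 1 + letterMul y := by
  rw [magnusOp, magnus, FreeGroup.lift_apply_of]; rfl

theorem magnusOp_one : magnusOp (1 : FreeGroup Y) = 1 := by
  rw [magnusOp, map_one, Units.val_one]

theorem magnusOp_mul (x y : FreeGroup Y) : magnusOp (x * y) = magnusOp x * magnusOp y := by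
  rw [magnusOp, map_mul, Units.val_mul]; rfl

theorem magnusOp_mul_inv (x : FreeGroup Y) : magnusOp x * magnusOp x⁻¹ = 1 := by
  rw [← magnusOp_mul, mul_inv_cancel, magnusOp_one]

theorem magnusOp_inv_mul (x : FreeGroup Y) : magnusOp x⁻¹ * magnusOp x = 1 := by
  rw [← magnusOp_mul, inv_mul_cancel, magnusOp_one]

variable (Y) in
/-- The operators that raise the order of a series by at least `k`. -/
def raising (k : ℕ) : AddSubgroup (Module.End ℤ (Series Y)) where
  carrier := {T | ∀ (n : ℕ) (f : Series Y), (∀ w, w.length < n → f w = 0) →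
    ∀ w, w.length < n + k → T f w = 0}
  zero_mem' := fun _ _ _ _ _ => rfl
  add_mem' := fun {T T'} h h' n f hf w hw => by
    rw [LinearMap.add_apply, Pi.add_apply, h n f hf w hw, h' n f hf w hw, add_zero]
  neg_mem' := fun {T} h n f hf w hw => by
    rw [LinearMap.neg_apply, Pi.neg_apply, h n f hf w hw, neg_zero]

theorem raising_antitone : Antitone (raising Y) :=
  fun _ _ hkl _ hT n f hf w hw => hT n f hf w (by omega)

theorem mul_mem_raising {i j : ℕ} {S T : Module.End ℤ (Series Y)} (hS : S ∈ raising Y i)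
    (hT : T ∈ raising Y j) : S * T ∈ raising Y (i + j) := fun n f hf w hw =>
  hS (n + j) (T f) (fun v hv => hT n f hf v hv) w (by omega)

theorem letterMul_mem_raising (y : Y) : letterMul y ∈ raising Y 1 := by
  intro n f hf w hw
  cases w with
  | nil => rfl
  | cons z w =>
    rw [letterMul_cons, hf w (by simpa using hw), ite_self]

variable (Y) in
/-- The operators that raise the order by at least `k` and that are homogeneous of degree `k`. -/
def homogeneousOp (k : ℕ) : AddSubgroup (Module.End ℤ (Series Y)) where
  carrier := {T | T ∈ raising Y k ∧ ∀ (n : ℕ) (f : Series Y), (∀ w, w.length ≠ n → f w = 0) →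
    ∀ w, w.length ≠ n + k → T f w = 0}
  zero_mem' := ⟨zero_mem _, fun _ _ _ _ _ => rfl⟩
  add_mem' := fun {T T'} h h' => ⟨add_mem h.1 h'.1, fun n f hf w hw => by
    rw [LinearMap.add_apply, Pi.add_apply, h.2 n f hf w hw, h'.2 n f hf w hw, add_zero]⟩
  neg_mem' := fun {T} h => ⟨neg_mem h.1, fun n f hf w hw => by
    rw [LinearMap.neg_apply, Pi.neg_apply, h.2 n f hf w hw, neg_zero]⟩

theorem mul_mem_homogeneousOp {i j : ℕ} {S T : Module.End ℤ (Series Y)}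
    (hS : S ∈ homogeneousOp Y i) (hT : T ∈ homogeneousOp Y j) : S * T ∈ homogeneousOp Y (i + j) :=
  ⟨mul_mem_raising hS.1 hT.1, fun n f hf w hw =>
    hS.2 (n + j) (T f) (fun v hv => hT.2 n f hf v hv) w (by omega)⟩

theorem letterMul_mem_homogeneousOp (y : Y) : letterMul y ∈ homogeneousOp Y 1 := by
  refine ⟨letterMul_mem_raising y, fun n f hf w hw => ?_⟩
  cases w with
  | nil => rfl
  | cons z w =>
    rw [letterMul_cons, hf w (by simpa using hw), ite_self]

variable (Y) in
/-- The action of the free associative ring on power series. -/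
def freeOp : FreeAlgebra ℤ Y →ₐ[ℤ] Module.End ℤ (Series Y) := FreeAlgebra.lift ℤ letterMul

theorem freeOp_ι (y : Y) : freeOp Y (FreeAlgebra.ι ℤ y) = letterMul y :=
  FreeAlgebra.lift_ι_apply _ _

open Classical in
theorem freeOp_word_unit (p : FreeMonoid Y) (w : List Y) :
    freeOp Y (FreeMonoid.lift (FreeAlgebra.ι ℤ) p) Series.unit w = if w = p.toList then 1 else 0 := by
  induction p using FreeMonoid.inductionOn' generalizing w with
  | one => simp only [map_one, Module.End.one_apply, Series.unit, FreeMonoid.toList_one]; congr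
  | of_mul y p ih =>
    rw [map_mul, map_mul, FreeMonoid.lift_eval_of, freeOp_ι, Module.End.mul_apply]
    cases w with
    | nil => simp [letterMul_nil]
    | cons z w =>
      rw [letterMul_cons, ih]
      by_cases hz : z = y <;> simp [hz]

/-- A word applied to the series `1` gives the indicator of that word, so the action on `1` alone
records every coefficient. -/
theorem freeOp_unit (u : FreeAlgebra ℤ Y) (w : List Y) :
    freeOp Y u Series.unit w =
      (FreeAlgebra.equivMonoidAlgebraFreeMonoid u : MonoidAlgebra ℤ (FreeMonoid Y)).coeff
        (FreeMonoid.ofList w) := by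
  classical
  obtain ⟨m, rfl⟩ := (FreeAlgebra.equivMonoidAlgebraFreeMonoid (R := ℤ) (X := Y)).symm.surjective u
  rw [AlgEquiv.apply_symm_apply]
  induction m using MonoidAlgebra.induction_linear with
  | zero => simp
  | add a b h1 h2 => simp only [map_add, LinearMap.add_apply, Pi.add_apply, h1, h2]; rfl
  | single p r =>
    have h : FreeAlgebra.equivMonoidAlgebraFreeMonoid.symm (MonoidAlgebra.single p r) =
        r • FreeMonoid.lift (FreeAlgebra.ι ℤ : Y → FreeAlgebra ℤ Y) p :=
      MonoidAlgebra.lift_single _ _ _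
    rw [h, map_smul, LinearMap.smul_apply, Pi.smul_apply, freeOp_word_unit,
      MonoidAlgebra.coeff_single, Finsupp.single_apply]
    by_cases hw : w = p.toList
    · rw [if_pos hw, if_pos (by rw [hw, FreeMonoid.ofList_toList]), smul_eq_mul, mul_one]
    · rw [if_neg hw, if_neg, smul_zero]
      rintro rfl
      exact hw rfl

theorem eq_zero_of_freeOp_unit {u : FreeAlgebra ℤ Y}
    (hu : ∀ w, freeOp Y u Series.unit w = 0) : u = 0 := by
  apply (FreeAlgebra.equivMonoidAlgebraFreeMonoid (R := ℤ) (X := Y)).injective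
  rw [map_zero, ← MonoidAlgebra.coeff_eq_zero]
  ext w
  rw [← FreeMonoid.ofList_toList w, ← freeOp_unit]
  exact hu _

theorem finite_freeOp_unit (u : FreeAlgebra ℤ Y) : {w | freeOp Y u Series.unit w ≠ 0}.Finite := by
  refine ((FreeAlgebra.equivMonoidAlgebraFreeMonoid u : MonoidAlgebra ℤ
    (FreeMonoid Y)).coeff.support.finite_toSet.image FreeMonoid.toList).subset fun w hw => ?_
  rw [Set.mem_ofPred_eq, freeOp_unit] at hw
  exact ⟨FreeMonoid.ofList w, Finsupp.mem_support_iff.2 hw, rfl⟩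

/-! ### Leading terms -/

variable (Y) in
/-- The homomorphism from the free Lie ring to the graded Lie ring of the free group. -/
def toGr : FreeLieAlgebra ℤ Y →ₗ⁅ℤ⁆ GrLie (FreeGroup Y) :=
  FreeLieAlgebra.lift ℤ (fun y => cl 1 (FreeGroup.of y) trivial)

theorem toGr_of (y : Y) : toGr Y (FreeLieAlgebra.of ℤ y) = cl 1 (FreeGroup.of y) trivial :=
  FreeLieAlgebra.lift_of_apply _ _

/-- `a` represents the class of `x` in degree `k`, both in the graded Lie ring of the free group
and as leading term of the Magnus expansion. -/
structure LeadsTo (k : ℕ) (x : FreeGroup Y) (a : FreeLieAlgebra ℤ Y) : Prop where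
  mem : x ∈ lcs (FreeGroup Y) k
  toGr : toGr Y a = cl k x mem
  homogeneous : freeOp Y (FreeLieAlgebra.toFree ℤ Y a) ∈ homogeneousOp Y k
  magnus : magnusOp x - 1 - freeOp Y (FreeLieAlgebra.toFree ℤ Y a) ∈ raising Y (k + 1)

theorem LeadsTo.sub_one_mem {k : ℕ} {x : FreeGroup Y} {a : FreeLieAlgebra ℤ Y}
    (h : LeadsTo k x a) : magnusOp x - 1 ∈ raising Y k := by
  have := add_mem (raising_antitone k.le_succ h.magnus) h.homogeneous.1
  rwa [sub_add_cancel] at this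

theorem LeadsTo.one (k : ℕ) : LeadsTo k (1 : FreeGroup Y) 0 where
  mem := one_mem _
  toGr := by rw [map_zero, cl_one]
  homogeneous := by rw [map_zero, map_zero]; exact zero_mem _
  magnus := by rw [map_zero, map_zero, magnusOp_one, sub_self, sub_zero]; exact zero_mem _

theorem LeadsTo.mul {k : ℕ} (hk : 0 < k) {x y : FreeGroup Y} {a b : FreeLieAlgebra ℤ Y}
    (ha : LeadsTo k x a) (hb : LeadsTo k y b) : LeadsTo k (x * y) (a + b) where
  mem := mul_mem ha.mem hb.mem
  toGr := by rw [map_add, ha.toGr, hb.toGr, cl_mul]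
  homogeneous := by rw [map_add, map_add]; exact add_mem ha.homogeneous hb.homogeneous
  magnus := by
    -- In `xy - 1 = (x - 1)(y - 1) + (x - 1) + (y - 1)` the product is negligible because `k > 0`.
    have h := raising_antitone (show k + 1 ≤ k + k by omega)
      (mul_mem_raising ha.sub_one_mem hb.sub_one_mem)
    have := add_mem h (add_mem ha.magnus hb.magnus)
    rw [map_add, map_add, magnusOp_mul]
    convert this using 1
    noncomm_ring

theorem LeadsTo.inv {k : ℕ} {x : FreeGroup Y} {a : FreeLieAlgebra ℤ Y}
    (ha : LeadsTo k x a) (hx : magnusOp x⁻¹ - 1 ∈ raising Y 1) : LeadsTo k x⁻¹ (-a) where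
  mem := inv_mem ha.mem
  toGr := by rw [map_neg, ha.toGr, cl_inv]
  homogeneous := by rw [map_neg, map_neg]; exact neg_mem ha.homogeneous
  magnus := by
    -- The identity used is `x⁻¹ - 1 = -(x - 1) - (x⁻¹ - 1)(x - 1)`.
    have h := mul_mem_raising hx ha.sub_one_mem
    rw [add_comm 1 k] at h
    have := neg_mem (add_mem h ha.magnus)
    rw [map_neg, map_neg]
    convert this using 1
    rw [sub_mul, mul_sub, magnusOp_inv_mul]
    noncomm_ring

open Classical in
theorem magnusOp_sub_one_mem (x : FreeGroup Y) : magnusOp x - 1 ∈ raising Y 1 := by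
  have hmul : ∀ x y : FreeGroup Y, magnusOp x - 1 ∈ raising Y 1 → magnusOp y - 1 ∈ raising Y 1 →
      magnusOp (x * y) - 1 ∈ raising Y 1 := fun x y hx hy => by
    have := add_mem (raising_antitone (show 1 ≤ 1 + 1 by omega) (mul_mem_raising hx hy))
      (add_mem hx hy)
    rw [magnusOp_mul]
    convert this using 1
    noncomm_ring
  induction x using FreeGroup.induction_on with
  | C1 => rw [magnusOp_one, sub_self]; exact zero_mem _
  | of y => rw [magnusOp_of, add_sub_cancel_left]; exact letterMul_mem_raising y
  | inv_of y hy =>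
    rw [magnusOp_of, add_sub_cancel_left] at hy
    -- The recursion for the inverse reads only suffixes of the word, so it does not lower the
    -- order. The claim then follows from `(1 + X)⁻¹ - 1 = -(1 + X)⁻¹ X`.
    have h0 : magnusOp (FreeGroup.of y)⁻¹ ∈ raising Y 0 := by
      intro n f hf w hw
      have e : magnusOp (FreeGroup.of y)⁻¹ f = letterInvFun y f := by
        rw [magnusOp, magnus, map_inv, FreeGroup.lift_apply_of]; rfl
      rw [e]
      induction w generalizing n f with
      | nil => exact hf _ hw
      | cons z w ih =>
        rw [letterInvFun, hf _ hw, zero_sub, neg_eq_zero, ite_eq_right_iff]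
        intro _
        refine ih n f hf ?_ ?_
        · simp at hw ⊢; omega
        · rw [magnusOp, magnus, map_inv, FreeGroup.lift_apply_of]; rfl
    have := neg_mem (mul_mem_raising h0 hy)
    rw [zero_add] at this
    convert this using 1
    have h2 := magnusOp_inv_mul (FreeGroup.of y)
    rw [magnusOp_of, mul_add, mul_one] at h2
    rw [sub_eq_iff_eq_add, ← h2]
    abel
  | mul x y hx hy => exact hmul x y hx hy

/-- Multiplying `xy - yx = (x - 1)(y - 1) - (y - 1)(x - 1)` by `(yx)⁻¹` gives `⁅x, y⁆ - 1`, with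
leading term `αβ - βα`. Degree one in the second entry suffices to generate `Γ_{k+1} = [Γ_k, G]`. -/
theorem LeadsTo.commutatorElement {k : ℕ} {x y : FreeGroup Y}
    {a b : FreeLieAlgebra ℤ Y} (ha : LeadsTo k x a) (hb : LeadsTo 1 y b) :
    LeadsTo (k + 1) ⁅x, y⁆ ⁅a, b⁆ where
  mem := commutatorElement_mem_lcs ha.mem hb.mem
  toGr := by rw [LieHom.map_lie, ha.toGr, hb.toGr, lie_cl_cl]
  homogeneous := by
    rw [LieHom.map_lie, LieRing.of_associative_ring_bracket, map_sub, map_mul, map_mul]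
    have h := mul_mem_homogeneousOp hb.homogeneous ha.homogeneous
    rw [add_comm] at h
    exact sub_mem (mul_mem_homogeneousOp ha.homogeneous hb.homogeneous) h
  magnus := by
    rw [LieHom.map_lie, LieRing.of_associative_ring_bracket, map_sub, map_mul, map_mul]
    set α := freeOp Y (FreeLieAlgebra.toFree ℤ Y a)
    set β := freeOp Y (FreeLieAlgebra.toFree ℤ Y b)
    have e : magnusOp ⁅x, y⁆ - 1 - (α * β - β * α) =
        ((magnusOp x - 1) * (magnusOp y - 1 - β) + (magnusOp x - 1 - α) * β
          - ((magnusOp y - 1) * (magnusOp x - 1 - α) + (magnusOp y - 1 - β) * α)) +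
        ((magnusOp x - 1) * (magnusOp y - 1) - (magnusOp y - 1) * (magnusOp x - 1)) *
          (magnusOp (x⁻¹ * y⁻¹) - 1) := by
      have h1 : magnusOp y * magnusOp x * magnusOp (x⁻¹ * y⁻¹) = 1 := by
        rw [← magnusOp_mul, ← magnusOp_mul, mul_assoc, ← mul_assoc x, mul_inv_cancel, one_mul,
          mul_inv_cancel, magnusOp_one]
      have h2 : magnusOp ⁅x, y⁆ = magnusOp x * magnusOp y * magnusOp (x⁻¹ * y⁻¹) := by
        rw [← magnusOp_mul, ← magnusOp_mul, commutatorElement_def, ← mul_assoc]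
      have h3 : (magnusOp x - 1) * (magnusOp y - 1) - (magnusOp y - 1) * (magnusOp x - 1) =
          magnusOp x * magnusOp y - magnusOp y * magnusOp x := by noncomm_ring
      have h4 : (magnusOp x * magnusOp y - magnusOp y * magnusOp x) *
          (magnusOp (x⁻¹ * y⁻¹) - 1) =
          magnusOp ⁅x, y⁆ - 1 - (magnusOp x * magnusOp y - magnusOp y * magnusOp x) := by
        rw [mul_sub, sub_mul, h1, ← h2, mul_one]
      rw [h3, h4]
      noncomm_ring
    rw [e]
    have hx := ha.sub_one_mem
    have hy := hb.sub_one_mem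
    have hxy := mul_mem_raising hx hy
    have hyx := mul_mem_raising hy hx
    have a1 := mul_mem_raising hx hb.magnus
    have a2 := mul_mem_raising ha.magnus hb.homogeneous.1
    have a3 := mul_mem_raising hy ha.magnus
    have a4 := mul_mem_raising hb.magnus ha.homogeneous.1
    rw [show 1 + k = k + 1 by omega] at hyx
    rw [show k + (1 + 1) = k + 1 + 1 by omega] at a1
    rw [show 1 + (k + 1) = k + 1 + 1 by omega] at a3
    rw [show 1 + 1 + k = k + 1 + 1 by omega] at a4
    exact add_mem (sub_mem (add_mem a1 a2) (add_mem a3 a4))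
      (mul_mem_raising (sub_mem hxy hyx) (magnusOp_sub_one_mem _))

theorem leadsTo_of (y : Y) : LeadsTo 1 (FreeGroup.of y) (FreeLieAlgebra.of ℤ y) where
  mem := trivial
  toGr := toGr_of y
  homogeneous := by
    rw [FreeLieAlgebra.toFree_of, freeOp_ι]; exact letterMul_mem_homogeneousOp y
  magnus := by
    rw [FreeLieAlgebra.toFree_of, freeOp_ι, magnusOp_of, add_sub_cancel_left, sub_self]
    exact zero_mem _

theorem exists_leadsTo_one (x : FreeGroup Y) : ∃ a, LeadsTo 1 x a := by
  induction x using FreeGroup.induction_on with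
  | C1 => exact ⟨0, .one 1⟩
  | of y => exact ⟨_, leadsTo_of y⟩
  | inv_of y => exact ⟨_, (leadsTo_of y).inv (magnusOp_sub_one_mem _)⟩
  | mul x y h1 h2 =>
    obtain ⟨a, ha⟩ := h1
    obtain ⟨b, hb⟩ := h2
    exact ⟨_, ha.mul Nat.one_pos hb⟩

/-- Commutators with elements of degree one generate the next term of the series. So the free Lie
ring reaches every class of positive degree, with the Magnus expansion under control at the same
time. -/
theorem exists_leadsTo {k : ℕ} {x : FreeGroup Y} (hx : x ∈ lcs (FreeGroup Y) (k + 1)) :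
    ∃ a, LeadsTo (k + 1) x a := by
  induction k generalizing x with
  | zero => exact exists_leadsTo_one x
  | succ k ih =>
    rw [lcs, lowerSeries_succ_succ, Subgroup.commutator_def] at hx
    induction hx using Subgroup.closure_induction with
    | mem x hx =>
      obtain ⟨y, hy, z, -, rfl⟩ := hx
      obtain ⟨a, ha⟩ := ih hy
      obtain ⟨b, hb⟩ := exists_leadsTo_one z
      exact ⟨_, ha.commutatorElement hb⟩
    | one => exact ⟨0, .one _⟩
    | mul x y _ _ h1 h2 =>
      obtain ⟨a, ha⟩ := h1
      obtain ⟨b, hb⟩ := h2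
      exact ⟨_, ha.mul (Nat.succ_pos _) hb⟩
    | inv x _ h =>
      obtain ⟨a, ha⟩ := h
      exact ⟨_, ha.inv (magnusOp_sub_one_mem _)⟩

/-- The coefficient of a word in the Magnus expansion of an element of a free group. -/
def magnusCoeff (x : FreeGroup Y) (w : List Y) : ℤ := magnusOp x Series.unit w

theorem unit_apply_of_length {w : List Y} (hw : 0 < w.length) : Series.unit w = 0 := by
  rw [Series.unit, if_neg]
  rintro rfl
  simp at hw

theorem magnusCoeff_eq_sub {w : List Y} (hw : 0 < w.length) (x : FreeGroup Y) :
    magnusCoeff x w = (magnusOp x - 1) Series.unit w := by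
  rw [LinearMap.sub_apply, Pi.sub_apply, Module.End.one_apply, unit_apply_of_length hw, sub_zero]
  rfl

theorem magnusCoeff_eq_zero {k : ℕ} {x : FreeGroup Y} (hx : x ∈ lcs (FreeGroup Y) k)
    {w : List Y} (hw : 0 < w.length) (hk : w.length < k) : magnusCoeff x w = 0 := by
  cases k with
  | zero => omega
  | succ k =>
    obtain ⟨a, ha⟩ := exists_leadsTo hx
    rw [magnusCoeff_eq_sub hw]
    exact ha.sub_one_mem 0 _ (fun v hv => by omega) w (by omega)

theorem magnusCoeff_mul {k : ℕ} {x y : FreeGroup Y} (hx : x ∈ lcs (FreeGroup Y) k)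
    (hy : y ∈ lcs (FreeGroup Y) k) {w : List Y} (hw : 0 < w.length) (hk : w.length = k) :
    magnusCoeff (x * y) w = magnusCoeff x w + magnusCoeff y w := by
  cases k with
  | zero => omega
  | succ k =>
    obtain ⟨a, ha⟩ := exists_leadsTo hx
    obtain ⟨b, hb⟩ := exists_leadsTo hy
    have h := mul_mem_raising ha.sub_one_mem hb.sub_one_mem 0 Series.unit
      (fun v hv => by omega) w (by omega)
    have e : magnusOp (x * y) - 1 =
        (magnusOp x - 1) * (magnusOp y - 1) + ((magnusOp x - 1) + (magnusOp y - 1)) := by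
      rw [magnusOp_mul]; noncomm_ring
    rw [magnusCoeff_eq_sub hw, magnusCoeff_eq_sub hw, magnusCoeff_eq_sub hw, e,
      LinearMap.add_apply, Pi.add_apply, h, zero_add]
    rfl

theorem LeadsTo.magnusCoeff_eq {k : ℕ} {x : FreeGroup Y} {a : FreeLieAlgebra ℤ Y}
    (ha : LeadsTo k x a) {w : List Y} (hw : 0 < w.length) (hk : w.length = k) :
    magnusCoeff x w = freeOp Y (FreeLieAlgebra.toFree ℤ Y a) Series.unit w := by
  have := ha.magnus 0 Series.unit (fun v hv => by omega) w (by omega)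
  rwa [LinearMap.sub_apply, Pi.sub_apply, sub_eq_zero, ← magnusCoeff_eq_sub hw] at this

theorem finite_magnusCoeff {k : ℕ} (hk : 0 < k) {x : FreeGroup Y} (hx : x ∈ lcs (FreeGroup Y) k) :
    {w : List Y | w.length = k ∧ magnusCoeff x w ≠ 0}.Finite := by
  obtain ⟨k, rfl⟩ : ∃ l, k = l + 1 := ⟨k - 1, by omega⟩
  obtain ⟨a, ha⟩ := exists_leadsTo hx
  refine (finite_freeOp_unit (FreeLieAlgebra.toFree ℤ Y a)).subset ?_
  rintro w ⟨hw, h⟩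
  rwa [ha.magnusCoeff_eq (by omega) hw] at h

/-- The leading coefficients of the Magnus expansion detect the lower central series. -/
theorem mem_lcs_succ {Y : Type} {k : ℕ} (hk : 0 < k) {x : FreeGroup Y}
    (hx : x ∈ lcs (FreeGroup Y) k)
    (h : ∀ w : List Y, w.length = k → magnusCoeff x w = 0) : x ∈ lcs (FreeGroup Y) (k + 1) := by
  obtain ⟨k, rfl⟩ : ∃ l, k = l + 1 := ⟨k - 1, by omega⟩
  obtain ⟨a, ha⟩ := exists_leadsTo hx
  -- Homogeneity kills the coefficients in the other degrees, so the associative image of `a`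
  -- vanishes. Injectivity of `toFree` then kills `a`, and with it the class of `x`.
  have h0 : FreeLieAlgebra.toFree ℤ Y a = 0 := by
    refine eq_zero_of_freeOp_unit fun w => ?_
    by_cases hw : w.length = k + 1
    · rw [← ha.magnusCoeff_eq (by omega) hw, h w hw]
    · exact ha.homogeneous.2 0 _ (fun v hv => unit_apply_of_length (by omega)) w (by omega)
  have h1 : a = 0 := FreeLieAlgebra.toFree_injective Y (h0.trans (map_zero _).symm)
  rw [← cl_eq_zero_iff hx, ← ha.toGr, h1, map_zero]

/-! ### Commutators with letters -/

open Classical in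
/-- Right multiplication by a letter. -/
def letterMulRight (y : Y) : Module.End ℤ (Series Y) where
  toFun f w := if w.getLast? = some y then f w.dropLast else 0
  map_add' f f' := by
    funext w
    simp only [Pi.add_apply]; split_ifs <;> simp
  map_smul' c f := by
    funext w
    simp

open Classical in
theorem letterMulRight_apply (y : Y) (f : Series Y) (w : List Y) :
    letterMulRight y f w = if w.getLast? = some y then f w.dropLast else 0 := rfl

/-- Group elements act by left multiplications. This turns `x X_y`, applied to the series `1`, into
an operation on the coefficients of `x`. -/
theorem magnusOp_letterMulRight (x : FreeGroup Y) (y : Y) :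
    Commute (magnusOp x) (letterMulRight y) := by
  classical
  have hof : ∀ z : Y, Commute (magnusOp (FreeGroup.of z)) (letterMulRight y) := fun z => by
    rw [magnusOp_of]
    refine (Commute.one_left _).add_left ?_
    ext f w
    rcases w with _ | ⟨t, _ | ⟨t', w⟩⟩
    · simp [letterMul_nil, letterMulRight_apply]
    · simp [letterMul_cons, letterMul_nil, letterMulRight_apply]
    · by_cases hz : t = z <;> simp [letterMul_cons, letterMulRight_apply, hz]
  induction x using FreeGroup.induction_on with
  | C1 => rw [magnusOp_one]; exact Commute.one_left _
  | of z => exact hof z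
  | inv_of z =>
    have : Commute ((magnus Y (FreeGroup.of z)).val) (letterMulRight y) := hof z
    rw [magnusOp, map_inv]
    exact this.units_inv_left
  | mul a b h1 h2 => rw [magnusOp_mul]; exact h1.mul_left h2

theorem letterMul_unit (y : Y) : letterMul y Series.unit = letterMulRight y Series.unit := by
  classical
  funext w
  rcases w with _ | ⟨t, _ | ⟨t', w⟩⟩
  · simp [letterMul_nil, letterMulRight_apply]
  · simp [letterMul_cons, letterMulRight_apply, Series.unit]
  · simp [letterMul_cons, letterMulRight_apply, Series.unit]

-- To first order `⁅x, y⁆ - 1` is the ring commutator of `x` with the letter of `y`; the error is a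
-- product of an operator raising the order by `k + 1` and one raising it by `1`.
open Classical in
theorem magnusCoeff_commutator_of {k : ℕ} {x : FreeGroup Y} (hx : x ∈ lcs (FreeGroup Y) k) (y : Y)
    {w : List Y} (hk : w.length = k + 1) (hk0 : 0 < k) :
    magnusCoeff ⁅x, FreeGroup.of y⁆ w =
      letterMulRight y (magnusCoeff x) w - letterMul y (magnusCoeff x) w := by
  have h1 : ⁅x, FreeGroup.of y⁆ ∈ lcs (FreeGroup Y) (k + 1) :=
    commutatorElement_mem_lcs_succ _ hx
  have e : magnusOp x * letterMul y - letterMul y * magnusOp x =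
      (magnusOp ⁅x, FreeGroup.of y⁆ - 1) +
        (magnusOp ⁅x, FreeGroup.of y⁆ - 1) * (magnusOp (FreeGroup.of y * x) - 1) := by
    have h2 : magnusOp ⁅x, FreeGroup.of y⁆ * magnusOp (FreeGroup.of y * x) =
        magnusOp (x * FreeGroup.of y) := by
      rw [← magnusOp_mul, commutatorElement_def]
      congr 1
      group
    rw [mul_sub, sub_mul, h2, magnusOp_mul, magnusOp_mul, magnusOp_of]
    noncomm_ring
  obtain ⟨a, ha⟩ := exists_leadsTo h1
  have h3 := mul_mem_raising ha.sub_one_mem (magnusOp_sub_one_mem (FreeGroup.of y * x)) 0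
    Series.unit (fun v hv => by omega) w (by omega)
  have h4 := congrFun (DFunLike.congr_fun e Series.unit) w
  rw [LinearMap.add_apply, Pi.add_apply, h3, add_zero, ← magnusCoeff_eq_sub (by omega),
    LinearMap.sub_apply, Pi.sub_apply, Module.End.mul_apply, Module.End.mul_apply,
    letterMul_unit, ← Module.End.mul_apply, (magnusOp_letterMulRight x y).eq] at h4
  exact h4.symm

/-- In a free group of rank at least two, an element of `Γ_k` whose commutators with the generators
lie in `Γ_{k+2}` lies in `Γ_{k+1}`. -/
theorem mem_lcs_succ_of_commutator {Y : Type} [Nontrivial Y] {k : ℕ} (hk : 0 < k)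
    {x : FreeGroup Y} (hx : x ∈ lcs (FreeGroup Y) k)
    (h : ∀ y : Y, ⁅x, FreeGroup.of y⁆ ∈ lcs (FreeGroup Y) (k + 2)) :
    x ∈ lcs (FreeGroup Y) (k + 1) := by
  classical
  refine mem_lcs_succ hk hx fun w hw => ?_
  cases w with
  | nil => simp at hw; omega
  | cons t w =>
    -- The word `t w y` does not begin with `y`, so its coefficient in `x X_y - X_y x` is exactly
    -- that of `t w` in `x`.
    obtain ⟨y, hy⟩ := exists_ne t
    have h1 := magnusCoeff_eq_zero (h y) (w := (t :: w) ++ [y]) (by simp) (by simp; simp at hw; omega)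
    rwa [magnusCoeff_commutator_of hx y (by simp; simp at hw; omega) hk, letterMulRight_apply,
      if_pos List.getLast?_concat, List.dropLast_concat, List.cons_append, letterMul_cons,
      if_neg hy.symm, sub_zero] at h1

/-! ### Residual nilpotence -/

open Classical in
theorem magnusOp_zpow_of_head_ne (y : Y) (e : ℤ) (f : Series Y) {w : List Y}
    (hw : w.head? ≠ some y) : magnusOp (FreeGroup.of y ^ e) f w = f w := by
  have h1 : ∀ g : Series Y, magnusOp (FreeGroup.of y) g w = g w := fun g => by
    rw [magnusOp_of, LinearMap.add_apply, Pi.add_apply, Module.End.one_apply]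
    cases w with
    | nil => simp [letterMul_nil]
    | cons z w => rw [letterMul_cons, if_neg (by simpa using hw), add_zero]
  induction e using Int.induction_on with
  | zero => rw [zpow_zero, magnusOp_one, Module.End.one_apply]
  | succ i ih => rw [add_comm, zpow_add, zpow_one, magnusOp_mul, Module.End.mul_apply, h1, ih]
  | pred i ih =>
    have e2 : FreeGroup.of y * FreeGroup.of y ^ (-(i : ℤ) - 1) = FreeGroup.of y ^ (-(i : ℤ)) := by
      group
    rw [← h1 (magnusOp _ f), ← Module.End.mul_apply, ← magnusOp_mul, e2, ih]

open Classical in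
theorem magnusOp_zpow_cons (y : Y) (e : ℤ) (f : Series Y) {w : List Y}
    (hw : w.head? ≠ some y) :
    magnusOp (FreeGroup.of y ^ e) f (y :: w) = f (y :: w) + e * f w := by
  have h1 : ∀ g : Series Y, magnusOp (FreeGroup.of y) g (y :: w) = g (y :: w) + g w := fun g => by
    rw [magnusOp_of, LinearMap.add_apply, Pi.add_apply, Module.End.one_apply, letterMul_cons,
      if_pos rfl]
  induction e using Int.induction_on with
  | zero => rw [zpow_zero, magnusOp_one, Module.End.one_apply, zero_mul, add_zero]
  | succ i ih =>
    rw [add_comm, zpow_add, zpow_one, magnusOp_mul, Module.End.mul_apply, h1, ih,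
      magnusOp_zpow_of_head_ne y _ f hw]
    ring
  | pred i ih =>
    have h2 := h1 (magnusOp (FreeGroup.of y ^ (-(i : ℤ) - 1)) f)
    rw [← Module.End.mul_apply, ← magnusOp_mul, magnusOp_zpow_of_head_ne y _ f hw] at h2
    have e2 : FreeGroup.of y * FreeGroup.of y ^ (-(i : ℤ) - 1) = FreeGroup.of y ^ (-(i : ℤ)) := by
      group
    rw [e2, ih] at h2
    linarith

/-- Multiplication by `y ^ e` changes the coefficient of `y :: w` by `e` times that of `w`, if `w`
does not begin with `y`. Hence the word of bases has the product of the exponents as coefficient;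
the clause on longer words removes the other term in the induction. -/
theorem magnusCoeff_syllables (l : List (Y × ℤ)) (h0 : ∀ p ∈ l, p.2 ≠ 0)
    (hc : (l.map Prod.fst).IsChain (· ≠ ·)) :
    magnusCoeff (l.map fun p => FreeGroup.of p.1 ^ p.2).prod (l.map Prod.fst) ≠ 0 ∧
    ∀ w : List Y, w.IsChain (· ≠ ·) → l.length < w.length →
      magnusCoeff (l.map fun p => FreeGroup.of p.1 ^ p.2).prod w = 0 := by
  induction l with
  | nil =>
    refine ⟨by simp [magnusCoeff, magnusOp_one, Series.unit], fun w _ hw => ?_⟩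
    simp only [List.map_nil, List.prod_nil, magnusCoeff, magnusOp_one, Module.End.one_apply]
    exact unit_apply_of_length hw
  | cons p l ih =>
    obtain ⟨y, e⟩ := p
    obtain ⟨ih1, ih2⟩ := ih (fun q hq => h0 q (List.mem_cons_of_mem _ hq)) hc.of_cons
    have hhead : ∀ {v : List Y}, (y :: v).IsChain (· ≠ ·) → v.head? ≠ some y := by
      intro v hv
      cases v with
      | nil => simp
      | cons z v => simpa using hv.rel.symm
    simp only [List.map_cons, List.prod_cons, magnusCoeff, magnusOp_mul, Module.End.mul_apply]
      at ih1 ih2 hc ⊢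
    refine ⟨?_, fun w hw hl => ?_⟩
    · rw [magnusOp_zpow_cons y e _ (hhead hc), ih2 _ hc (by simp), zero_add]
      exact mul_ne_zero (by exact_mod_cast h0 (y, e) List.mem_cons_self) ih1
    · by_cases hy : w.head? = some y
      · cases w with
        | nil => simp at hy
        | cons z w =>
          obtain rfl : z = y := by simpa using hy
          rw [magnusOp_zpow_cons _ e _ (hhead hw), ih2 _ hw (by simp at hl ⊢; omega),
            ih2 _ hw.of_cons (by simpa using hl), mul_zero, add_zero]
      · rw [magnusOp_zpow_of_head_ne y e _ hy, ih2 _ hw (by simp at hl; omega)]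

/-- The normal form in a coproduct of infinite cyclic groups, with each entry rewritten as a power
of a generator. -/
theorem exists_syllables (x : FreeGroup Y) : ∃ l : List (Y × ℤ), (∀ p ∈ l, p.2 ≠ 0) ∧
    (l.map Prod.fst).IsChain (· ≠ ·) ∧ (l.map fun p => FreeGroup.of p.1 ^ p.2).prod = x := by
  classical
  let W := Monoid.CoprodI.Word.equiv (freeGroupEquivCoprodI x)
  have hW : W.prod = freeGroupEquivCoprodI x := Monoid.CoprodI.Word.equiv.symm_apply_apply _
  refine ⟨W.toList.map fun p => (p.1, FreeGroup.freeGroupUnitEquivInt p.2), ?_, ?_, ?_⟩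
  · simp only [List.mem_map, forall_exists_index, and_imp]
    rintro _ p hm rfl h
    refine W.ne_one p hm (FreeGroup.freeGroupUnitEquivInt.injective (h.trans ?_))
    rfl
  · rw [List.map_map, List.isChain_map]
    exact W.chain_ne
  · apply freeGroupEquivCoprodI.injective
    rw [← hW, Monoid.CoprodI.Word.prod, List.map_map, map_list_prod, List.map_map]
    congr 1
    refine List.map_congr_left fun p _ => ?_
    have h : (FreeGroup.of () : FreeGroup Unit) ^ FreeGroup.freeGroupUnitEquivInt p.2 = p.2 :=
      FreeGroup.freeGroupUnitEquivInt.symm_apply_apply p.2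
    rw [Function.comp_apply, Function.comp_apply, map_zpow]
    conv_rhs => rw [← h, map_zpow]
    simp

/-- Free groups are residually nilpotent. -/
theorem eq_one_of_forall_mem_lcs {x : FreeGroup Y} (hx : ∀ k, x ∈ lcs (FreeGroup Y) k) :
    x = 1 := by
  obtain ⟨l, h0, hc, rfl⟩ := exists_syllables x
  cases l with
  | nil => rfl
  | cons p l =>
    exact absurd (magnusCoeff_eq_zero (hx (l.length + 2)) (by simp) (by simp))
      (magnusCoeff_syllables (p :: l) h0 hc).1

/-! ### Permutations of the letters -/

theorem magnusCoeff_map {Z : Type*} {σ : Y → Z} (hσ : Function.Injective σ) (x : FreeGroup Y)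
    (w : List Y) : magnusCoeff (FreeGroup.map σ x) (w.map σ) = magnusCoeff x w := by
  classical
  have hof : ∀ y : Y, ∀ f : Series Z, (fun v : List Y => magnusOp (FreeGroup.map σ (FreeGroup.of y))
      f (v.map σ)) = magnusOp (FreeGroup.of y) (fun v => f (v.map σ)) := fun y f => by
    funext v
    rw [FreeGroup.map.of, magnusOp_of, magnusOp_of]
    cases v with
    | nil => simp [letterMul_nil]
    | cons z v => simp [letterMul_cons, hσ.eq_iff]
  have key : ∀ f : Series Z, (fun v : List Y => magnusOp (FreeGroup.map σ x) f (v.map σ)) =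
      magnusOp x (fun v => f (v.map σ)) := by
    induction x using FreeGroup.induction_on with
    | C1 => intro f; rw [map_one, magnusOp_one, magnusOp_one]; rfl
    | of y => exact hof y
    | inv_of y =>
      intro f
      have h := hof y (magnusOp (FreeGroup.map σ (FreeGroup.of y))⁻¹ f)
      rw [← Module.End.mul_apply, magnusOp_mul_inv, Module.End.one_apply] at h
      rw [h, ← Module.End.mul_apply, magnusOp_inv_mul, map_inv]
      rfl
    | mul a b h1 h2 =>
      intro f
      rw [map_mul, magnusOp_mul, magnusOp_mul, Module.End.mul_apply, Module.End.mul_apply,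
        h1, h2]
  have h := congrFun (key Series.unit) w
  have hu : (fun v : List Y => (Series.unit : Series Z) (v.map σ)) = Series.unit := by
    funext v; simp [Series.unit]
  rw [hu] at h
  exact h

end Magnus

/-! ### The kernel of a projection between free groups -/

section Flow

/-- A finitely supported circulation on the Cayley graph of a free group vanishes. -/
theorem eq_zero_of_circulation {ι : Type*} [Fintype ι] (D : ι → FreeGroup ι → ℤ)
    (hfin : ∀ i, (Function.support (D i)).Finite)
    (h : ∀ x, ∑ i, D i x = ∑ i, D i ((FreeGroup.of i)⁻¹ * x)) (k : ι) : D k 1 = 0 := by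
  classical
  -- The counter changes exactly when the edge labelled `k` leaving `1` is crossed. Freeness leaves
  -- no relations to check, so this yields a potential `c` on the vertices whose coboundary is that
  -- single edge, which is where the tree property of the Cayley graph enters.
  let act : FreeGroup ι →* Equiv.Perm (FreeGroup ι × ℤ) := FreeGroup.lift fun i =>
    { toFun := fun p => (FreeGroup.of i * p.1, p.2 - if i = k ∧ p.1 = 1 then 1 else 0)
      invFun := fun p => ((FreeGroup.of i)⁻¹ * p.1,
        p.2 + if i = k ∧ (FreeGroup.of i)⁻¹ * p.1 = 1 then 1 else 0)
      left_inv := fun p => by simp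
      right_inv := fun p => by simp }
  have act_of : ∀ i p, act (FreeGroup.of i) p =
      (FreeGroup.of i * p.1, p.2 - if i = k ∧ p.1 = 1 then 1 else 0) := fun i p => by
    simp [act]
  have act_fst : ∀ x p, (act x p).1 = x * p.1 := by
    intro x
    induction x using FreeGroup.induction_on with
    | C1 => simp
    | of i => simp [act_of]
    | inv_of i =>
      intro p
      have := act_of i (act (FreeGroup.of i)⁻¹ p)
      rw [← Equiv.Perm.mul_apply, ← map_mul, mul_inv_cancel, map_one, Equiv.Perm.one_apply] at this
      rw [eq_inv_mul_iff_mul_eq]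
      exact (congrArg Prod.fst this).symm
    | mul x y hx hy => intro p; rw [map_mul, Equiv.Perm.mul_apply, hx, hy, mul_assoc]
  let c : FreeGroup ι → ℤ := fun x => (act x (1, 0)).2
  have hc : ∀ i x, c x - c (FreeGroup.of i * x) = if i = k ∧ x = 1 then 1 else 0 := fun i x => by
    simp only [c, map_mul, Equiv.Perm.mul_apply, act_of, act_fst, mul_one]
    ring
  have hs : ∀ i, (Function.support fun x => c x * D i x).Finite := fun i =>
    (hfin i).subset fun x hx => right_ne_zero_of_mul hx
  have hinj : ∀ i, Function.Injective fun x : FreeGroup ι => (FreeGroup.of i)⁻¹ * x := fun i =>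
    mul_right_injective _
  have hs1 : ∀ i, (Function.support fun x => c x * D i ((FreeGroup.of i)⁻¹ * x)).Finite := fun i =>
    ((hfin i).preimage (hinj i).injOn).subset fun x hx => right_ne_zero_of_mul hx
  have hs2 : ∀ i, (Function.support fun x => c (FreeGroup.of i * x) * D i x).Finite := fun i =>
    (hfin i).subset fun x hx => right_ne_zero_of_mul hx
  -- Pairing the circulation with the potential and summing by parts leaves only the value on the
  -- chosen edge.
  have e1 : ∑ i, ∑ᶠ x, c x * D i x = ∑ i, ∑ᶠ x, c (FreeGroup.of i * x) * D i x := by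
    calc ∑ i, ∑ᶠ x, c x * D i x = ∑ᶠ x, ∑ i, c x * D i x :=
          (finsum_sum_comm _ _ fun i _ => hs i).symm
      _ = ∑ᶠ x, ∑ i, c x * D i ((FreeGroup.of i)⁻¹ * x) := by
          refine finsum_congr fun x => ?_
          rw [← Finset.mul_sum, ← Finset.mul_sum, h]
      _ = ∑ i, ∑ᶠ x, c x * D i ((FreeGroup.of i)⁻¹ * x) :=
          finsum_sum_comm _ _ fun i _ => hs1 i
      _ = _ := by
          refine Finset.sum_congr rfl fun i _ => ?_
          rw [← finsum_comp_equiv (Equiv.mulLeft (FreeGroup.of i))]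
          simp
  rw [← sub_eq_zero, ← Finset.sum_sub_distrib] at e1
  have e2 : ∀ i, ∑ᶠ x, c x * D i x - ∑ᶠ x, c (FreeGroup.of i * x) * D i x =
      if i = k then D i 1 else 0 := fun i => by
    rw [← finsum_sub_distrib (hs i) (hs2 i)]
    simp only [← sub_mul, hc]
    by_cases hi : i = k
    · rw [finsum_eq_single _ 1 fun x hx => by simp [hx]]
      simp [hi]
    · simp [hi]
  simpa [e2] using e1

end Flow

/-! ### The kernel as a free group on conjugates, and its lower central series -/

section Kernel

variable (ι : Type)

/-- The free group on the conjugates of the second half of the letters by words in the first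
half. -/
abbrev ConjFree : Type := FreeGroup (FreeGroup ι × ι)

/-- The permutation action of the free group on its translates. -/
def conjAction : FreeGroup ι →* MulAut (ConjFree ι) where
  toFun x := FreeGroup.freeGroupCongr ((Equiv.mulLeft x).prodCongr (Equiv.refl ι))
  map_one' := by ext z; simp
  map_mul' x y := by
    ext z
    induction z using FreeGroup.induction_on with
    | C1 => simp only [map_one]
    | of z => obtain ⟨z, i⟩ := z; simp [mul_assoc]
    | inv_of z h => rw [map_inv, map_inv, h]
    | mul z w hz hw => rw [map_mul, map_mul, hz, hw]

theorem conjAction_apply (x : FreeGroup ι) (n : ConjFree ι) :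
    conjAction ι x n = FreeGroup.map (fun z => (x * z.1, z.2)) n := rfl

theorem conjAction_of (x y : FreeGroup ι) (i : ι) :
    conjAction ι x (FreeGroup.of (y, i)) = FreeGroup.of (x * y, i) := by
  rw [conjAction_apply, FreeGroup.map.of]

/-- The free group on `ι ⊕ ι`, as a semidirect product of the kernel of the projection killing the
second half of the letters and a free group. -/
abbrev SplitFree : Type := ConjFree ι ⋊[conjAction ι] FreeGroup ι

/-- The kernel of the projection. -/
abbrev splitKer : Subgroup (SplitFree ι) := (SemidirectProduct.inl : ConjFree ι →* SplitFree ι).range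

instance : (splitKer ι).Normal := by
  rw [splitKer, SemidirectProduct.range_inl_eq_ker_rightHom]; infer_instance

variable {ι}

/-- From index one on, the series involves only the kernel and is its own lower central series; at
index zero it is the whole group instead. -/
theorem lowerSeries_splitKer (m : ℕ) : lowerSeries (splitKer ι) (m + 1) =
    (lcs (ConjFree ι) (m + 1)).map SemidirectProduct.inl := by
  induction m with
  | zero => exact MonoidHom.range_eq_map _
  | succ m ih =>
    have h : lcs (ConjFree ι) (m + 1 + 1) = ⁅lcs (ConjFree ι) (m + 1), ⊤⁆ := rfl
    rw [lowerSeries_succ_succ, ih, h, Subgroup.map_commutator, ← MonoidHom.range_eq_map]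

theorem inl_mem_lowerSeries_iff {m : ℕ} {n : ConjFree ι} :
    (SemidirectProduct.inl n : SplitFree ι) ∈ lowerSeries (splitKer ι) (m + 1) ↔
      n ∈ lcs (ConjFree ι) (m + 1) := by
  rw [lowerSeries_splitKer, Subgroup.mem_map_iff_mem SemidirectProduct.inl_injective]

theorem exists_inl_of_mem_lowerSeries {m : ℕ} (hm : 0 < m) {y : SplitFree ι}
    (hy : y ∈ lowerSeries (splitKer ι) m) :
    ∃ n ∈ lcs (ConjFree ι) m, SemidirectProduct.inl n = y := by
  obtain ⟨m, rfl⟩ : ∃ l, m = l + 1 := ⟨m - 1, by omega⟩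
  rwa [lowerSeries_splitKer] at hy

theorem eq_one_of_mem_lowerSeries_splitKer {y : SplitFree ι}
    (hy : ∀ m, y ∈ lowerSeries (splitKer ι) m) : y = 1 := by
  obtain ⟨n, -, rfl⟩ := exists_inl_of_mem_lowerSeries Nat.one_pos (hy 1)
  rw [eq_one_of_forall_mem_lcs (x := n) fun k => ?_, map_one]
  cases k with
  | zero => trivial
  | succ k => exact inl_mem_lowerSeries_iff.1 (hy (k + 1))

/-- Modulo `[A, A]`, conjugation by `y` moves the basis element `(1, i)` to `(y.right, i)`. The
character `χ`, the coordinate at `(1, i)`, sees whether these agree. -/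
theorem mem_splitKer_of_commutator [Nonempty ι] {y : SplitFree ι}
    (h : ∀ a ∈ splitKer ι, ⁅y, a⁆ ∈ lowerSeries (splitKer ι) 2) : y ∈ splitKer ι := by
  classical
  obtain ⟨i⟩ := ‹Nonempty ι›
  let χ : ConjFree ι →* Multiplicative ℤ := FreeGroup.lift fun z =>
    if z = (1, i) then Multiplicative.ofAdd 1 else 1
  have hχ : ∀ n ∈ lcs (ConjFree ι) 2, χ n = 1 := by
    intro n hn
    have : lcs (ConjFree ι) 2 ≤ χ.ker := by
      rw [lcs, lowerSeries_succ_succ, Subgroup.commutator_le]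
      intro a _ b _
      rw [MonoidHom.mem_ker, map_commutatorElement, commutatorElement_eq_one_iff_mul_comm, mul_comm]
    exact this hn
  have h1 := h (SemidirectProduct.inl (FreeGroup.of (1, i))) ⟨_, rfl⟩
  have e : ⁅y, (SemidirectProduct.inl (FreeGroup.of (1, i)) : SplitFree ι)⁆ =
      SemidirectProduct.inl (y.left * FreeGroup.of (y.right, i) * y.left⁻¹ *
        (FreeGroup.of (1, i))⁻¹) := by
    rw [commutatorElement_def]
    ext
    · simp [conjAction_of]
    · simp
  rw [e, inl_mem_lowerSeries_iff] at h1
  have h2 := hχ _ h1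
  rw [map_mul, map_mul, map_mul, map_inv, map_inv, mul_inv_cancel_comm,
    FreeGroup.lift_apply_of, FreeGroup.lift_apply_of, if_pos rfl, mul_inv_eq_one] at h2
  rw [splitKer, SemidirectProduct.range_inl_eq_ker_rightHom, MonoidHom.mem_ker]
  by_contra hne
  rw [if_neg (fun h => hne (congrArg Prod.fst h))] at h2
  exact absurd (congrArg Multiplicative.toAdd h2) (by simp)

theorem mem_lowerSeries_splitKer_of_commutator [Nonempty ι] {k : ℕ} {y : SplitFree ι}
    (hy : y ∈ lowerSeries (splitKer ι) k)
    (h : ∀ a ∈ splitKer ι, ⁅y, a⁆ ∈ lowerSeries (splitKer ι) (k + 2)) :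
    y ∈ lowerSeries (splitKer ι) (k + 1) := by
  cases k with
  | zero => exact mem_splitKer_of_commutator h
  | succ k =>
    obtain ⟨n, hn, rfl⟩ := exists_inl_of_mem_lowerSeries (Nat.succ_pos k) hy
    rw [inl_mem_lowerSeries_iff]
    -- The kernel has infinite rank even when `ι` has a single element, so genus one needs no
    -- separate treatment.
    have : Nontrivial (FreeGroup ι × ι) := by
      have := (inferInstance : Infinite (FreeGroup ι)); infer_instance
    refine mem_lcs_succ_of_commutator (Nat.succ_pos k) hn fun z => ?_
    rw [← inl_mem_lowerSeries_iff, map_commutatorElement]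
    exact h _ ⟨_, rfl⟩

theorem magnusCoeff_list_prod {Y α : Type*} {k : ℕ} (l : List α) {n : α → FreeGroup Y}
    (hn : ∀ i, n i ∈ lcs (FreeGroup Y) k) {w : List Y} (hw : 0 < w.length) (hk : w.length = k) :
    magnusCoeff (l.map n).prod w = (l.map fun i => magnusCoeff (n i) w).sum := by
  induction l with
  | nil =>
    simp only [List.map_nil, List.prod_nil, List.sum_nil, magnusCoeff, magnusOp_one,
      Module.End.one_apply]
    exact unit_apply_of_length hw
  | cons i l ih =>
    rw [List.map_cons, List.prod_cons, List.map_cons, List.sum_cons, ← ih,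
      magnusCoeff_mul (hn i) (list_prod_mem fun x hx => ?_) hw hk]
    obtain ⟨j, -, rfl⟩ := List.mem_map.1 hx
    exact hn j

/-- In degree `m` the hypothesis reads `∑ δ i = ∑ S i • δ i`. Magnus coefficients along the
translates `x • w` of a word give functions `D i` with `∑ D i x = ∑ D i ((S i)⁻¹ x)`, a circulation
on a tree. The list `l` fixes the order of the factors, and `hl` expresses that it runs through `ι`
once. -/
theorem mem_lowerSeries_splitKer_of_prod [Fintype ι] {l : List ι}
    (hl : ∀ c : ι → ℤ, (l.map c).sum = ∑ i, c i) {m : ℕ} (hm : 0 < m) {δ : ι → SplitFree ι}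
    (hδ : ∀ i, δ i ∈ lowerSeries (splitKer ι) m)
    (h : (l.map δ).prod⁻¹ * (l.map fun i => SemidirectProduct.inr (FreeGroup.of i) * δ i *
      (SemidirectProduct.inr (FreeGroup.of i))⁻¹).prod ∈ lowerSeries (splitKer ι) (m + 1)) (k : ι) :
    δ k ∈ lowerSeries (splitKer ι) (m + 1) := by
  choose n hn hδn using fun i => exists_inl_of_mem_lowerSeries hm (hδ i)
  have hn' : ∀ i, conjAction ι (FreeGroup.of i) (n i) ∈ lcs (ConjFree ι) m := fun i => by
    have := map_lowerSeries_of_surjective (⊤ : Subgroup (ConjFree ι))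
      (conjAction ι (FreeGroup.of i)).toMonoidHom (conjAction ι (FreeGroup.of i)).surjective m
    rw [Subgroup.map_top_of_surjective (conjAction ι (FreeGroup.of i)).toMonoidHom
      (conjAction ι (FreeGroup.of i)).surjective] at this
    rw [lcs, ← this]
    exact ⟨n i, hn i, rfl⟩
  have e1 : (l.map δ).prod = SemidirectProduct.inl (l.map n).prod := by
    rw [map_list_prod, List.map_map]
    exact congrArg List.prod (List.map_congr_left fun i _ => (hδn i).symm)
  have e2 : (l.map fun i => SemidirectProduct.inr (FreeGroup.of i) * δ i *
      (SemidirectProduct.inr (FreeGroup.of i))⁻¹).prod =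
      SemidirectProduct.inl (l.map fun i => conjAction ι (FreeGroup.of i) (n i)).prod := by
    rw [map_list_prod, List.map_map]
    refine congrArg List.prod (List.map_congr_left fun i _ => ?_)
    rw [Function.comp_apply, SemidirectProduct.inl_aut, hδn, map_inv]
  rw [e1, e2, ← map_inv, ← map_mul, inl_mem_lowerSeries_iff] at h
  have hsum : ∀ w : List (FreeGroup ι × ι), w.length = m →
      ∑ i, magnusCoeff (n i) w = ∑ i, magnusCoeff (conjAction ι (FreeGroup.of i) (n i)) w := by
    intro w hw
    have hp : (l.map n).prod ∈ lcs (ConjFree ι) m := list_prod_mem fun x hx => by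
      obtain ⟨j, -, rfl⟩ := List.mem_map.1 hx
      exact hn j
    rw [← hl, ← hl, ← magnusCoeff_list_prod l hn (by omega) hw,
      ← magnusCoeff_list_prod l hn' (by omega) hw]
    have h2 := magnusCoeff_mul hp (lowerSeries_antitone _ m.le_succ h) (by omega) hw
    rw [mul_inv_cancel_left, magnusCoeff_eq_zero h (by omega) (by omega), add_zero] at h2
    exact h2.symm
  rw [← hδn, inl_mem_lowerSeries_iff]
  refine mem_lcs_succ hm (hn k) fun w hw => ?_
  have hw0 : w ≠ [] := by rintro rfl; simp at hw; omega
  have htr : ∀ x : FreeGroup ι, Function.Injective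
      (fun z : FreeGroup ι × ι => (x * z.1, z.2)) := fun x a b hab => by
    simpa [Prod.ext_iff] using hab
  have := eq_zero_of_circulation
    (fun i x => magnusCoeff (n i) (w.map fun z => (x * z.1, z.2))) (fun i => ?_) (fun x => ?_) k
  · simpa using this
  -- Distinct elements translate a nonempty word to distinct words, so only finitely many translates
  -- carry a nonzero leading coefficient.
  · have hinj : Function.Injective fun x : FreeGroup ι =>
        w.map fun z : FreeGroup ι × ι => (x * z.1, z.2) := by
      obtain ⟨z, w, rfl⟩ := List.exists_cons_of_ne_nil hw0
      intro x y hxy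
      simpa using (List.cons.inj hxy).1
    refine ((finite_magnusCoeff hm (hn i)).preimage hinj.injOn).subset fun x hx => ⟨?_, hx⟩
    rw [List.length_map, hw]
  · rw [hsum _ (by rw [List.length_map, hw])]
    refine Finset.sum_congr rfl fun i _ => ?_
    rw [conjAction_apply, ← magnusCoeff_map (htr (FreeGroup.of i)) (n i), List.map_map]
    congr 1
    refine List.map_congr_left fun z _ => ?_
    simp [mul_assoc]

/-- The splitting of the free group on `ι ⊕ ι`. -/
def splitEquiv (ι : Type) : FreeGroup (ι ⊕ ι) ≃* SplitFree ι :=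
  MonoidHom.toMulEquiv
    (FreeGroup.lift (Sum.elim (fun i => SemidirectProduct.inr (FreeGroup.of i))
      (fun i => SemidirectProduct.inl (FreeGroup.of (1, i)))))
    (SemidirectProduct.lift
      (FreeGroup.lift fun z => FreeGroup.map Sum.inl z.1 * FreeGroup.of (Sum.inr z.2) *
        (FreeGroup.map Sum.inl z.1)⁻¹)
      (FreeGroup.map Sum.inl)
      (fun x => by
        ext ⟨y, i⟩
        simp [conjAction_of, mul_assoc]))
    (by
      ext z
      rcases z with i | i <;> simp)
    (by
      have h : ∀ x : FreeGroup ι, FreeGroup.lift (Sum.elim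
          (fun i => (SemidirectProduct.inr (FreeGroup.of i) : SplitFree ι))
          (fun i => SemidirectProduct.inl (FreeGroup.of (1, i)))) (FreeGroup.map Sum.inl x) =
          SemidirectProduct.inr x := fun x => by
        rw [← MonoidHom.comp_apply]
        congr 1
        ext i <;> simp
      refine SemidirectProduct.hom_ext ?_ ?_
      · ext ⟨y, i⟩ : 1
        have := SemidirectProduct.inl_aut (φ := conjAction ι) y (FreeGroup.of (1, i))
        rw [conjAction_of, mul_one, map_inv] at this
        simp [h, this]
      · ext i : 1
        simp)

theorem splitEquiv_inl (i : ι) : splitEquiv ι (FreeGroup.of (Sum.inl i)) =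
    SemidirectProduct.inr (FreeGroup.of i) := by
  simp [splitEquiv]

theorem splitEquiv_inr (i : ι) : splitEquiv ι (FreeGroup.of (Sum.inr i)) =
    SemidirectProduct.inl (FreeGroup.of (1, i)) := by
  simp [splitEquiv]

theorem rightHom_comp_splitEquiv : SemidirectProduct.rightHom.comp (splitEquiv ι).toMonoidHom =
    FreeGroup.lift (Sum.elim FreeGroup.of fun _ => (1 : FreeGroup ι)) := by
  ext z
  rcases z with i | i
  · simp [splitEquiv_inl]
  · simp [splitEquiv_inr]

end Kernel

/-! ### Johnson filtrations of automorphism groups fixing a boundary word -/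

section Johnson

variable {P : Type*} [Group P] {A : Subgroup P}

/-- The elements that an automorphism fixes modulo a normal subgroup. -/
def fixedMod (f : MulAut P) (N : Subgroup P) [N.Normal] : Subgroup P :=
  MonoidHom.eqLocus ((QuotientGroup.mk' N).comp f.toMonoidHom) (QuotientGroup.mk' N)

theorem mk_eq_mk_iff {N : Subgroup P} [N.Normal] {x y : P} :
    (QuotientGroup.mk' N) x = QuotientGroup.mk' N y ↔ x * y⁻¹ ∈ N := by
  rw [← mul_inv_eq_one, ← map_inv, ← map_mul, ← MonoidHom.mem_ker, QuotientGroup.ker_mk']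

theorem mem_fixedMod {f : MulAut P} {N : Subgroup P} [N.Normal] {x : P} :
    x ∈ fixedMod f N ↔ f x * x⁻¹ ∈ N :=
  mk_eq_mk_iff

theorem mem_fixedMod' {f : MulAut P} {N : Subgroup P} [N.Normal] {x : P} :
    x ∈ fixedMod f N ↔ QuotientGroup.mk' N (f x) = QuotientGroup.mk' N x :=
  Iff.rfl

theorem commute_mk_lowerSeries [A.Normal] {m n k : ℕ} (hk : k ≤ m + n) {x y : P}
    (hx : x ∈ lowerSeries A m) (hy : y ∈ lowerSeries A n) :
    Commute (QuotientGroup.mk' (lowerSeries A k) x) (QuotientGroup.mk' (lowerSeries A k) y) := by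
  rw [← commutatorElement_eq_one_iff_commute, ← map_commutatorElement, ← MonoidHom.mem_ker,
    QuotientGroup.ker_mk']
  exact lowerSeries_antitone A hk (commutator_lowerSeries_le A m n (Subgroup.commutator_mem_commutator hx hy))

theorem mem_johnsonFiltration {f : MulAut P} {m : ℕ} : f ∈ johnsonFiltration A m ↔
    f ∈ autPair A ∧ ∀ j, ∀ x ∈ lowerSeries A j, f x * x⁻¹ ∈ lowerSeries A (m + j) := by
  rw [johnsonFiltration, Subgroup.mem_iInf]
  exact ⟨fun h => ⟨(h 0).1, fun j => (h j).2⟩, fun h j => ⟨h.1, h.2 j⟩⟩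

theorem johnsonFiltration_zero : johnsonFiltration A 0 = autPair A := by
  ext f
  rw [mem_johnsonFiltration]
  refine ⟨fun h => h.1, fun h => ⟨h, fun j x hx => ?_⟩⟩
  rw [zero_add]
  exact mul_mem (apply_mem_lowerSeries h hx) (inv_mem hx)

theorem johnsonFiltration_antitone [A.Normal] : Antitone (johnsonFiltration A) := by
  intro m n hmn f hf
  rw [mem_johnsonFiltration] at hf ⊢
  exact ⟨hf.1, fun j x hx => lowerSeries_antitone A (by omega) (hf.2 j x hx)⟩

theorem commutator_johnsonFiltration_le [A.Normal] (m n : ℕ) :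
    ⁅johnsonFiltration A m, johnsonFiltration A n⁆ ≤ johnsonFiltration A (m + n) := by
  rw [Subgroup.commutator_le]
  intro f hf h hh
  rw [mem_johnsonFiltration] at hf hh ⊢
  refine ⟨?_, fun j x hx => ?_⟩
  · rw [commutatorElement_def]
    exact mul_mem (mul_mem (mul_mem hf.1 hh.1) (inv_mem hf.1)) (inv_mem hh.1)
  -- With `x = h (f w)` the commutator takes the value `f (h w)`, and it remains to compare `f (h
  -- w)` with `h (f w)`.
  obtain ⟨w, rfl⟩ := (h * f).surjective x
  have hw : w ∈ lowerSeries A j := by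
    have := apply_mem_lowerSeries (inv_mem (mul_mem hh.1 hf.1)) hx
    rwa [MulAut.inv_apply_self] at this
  have e0 : ⁅f, h⁆ ((h * f) w) = f (h w) := by
    rw [← MulAut.mul_apply, ← MulAut.mul_apply, commutatorElement_def]
    congr 1
    group
  rw [e0, MulAut.mul_apply]
  have hξ := hh.2 j w hw
  have hη := hf.2 j w hw
  set ξ := h w * w⁻¹ with ξdef
  set η := f w * w⁻¹ with ηdef
  have e1 : f (h w) = (f ξ * ξ⁻¹) * ξ * (η * w) := by
    simp [ξdef, ηdef, mul_assoc]
  have e2 : h (f w) = (h η * η⁻¹) * η * (ξ * w) := by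
    simp [ξdef, ηdef, mul_assoc]
  have e3 : f (h w) * (h (f w))⁻¹ = (f ξ * ξ⁻¹) * ⁅ξ, η⁆ * (h η * η⁻¹)⁻¹ := by
    rw [e1, e2, commutatorElement_def]
    group
  rw [e3]
  refine mul_mem (mul_mem ?_ ?_) (inv_mem ?_)
  · simpa only [add_assoc] using hf.2 _ _ hξ
  · exact lowerSeries_antitone A (by omega)
      (commutator_lowerSeries_le A _ _ (Subgroup.commutator_mem_commutator hξ hη))
  · have := hh.2 _ _ hη
    rwa [← add_assoc, add_comm n m] at this

/-- An automorphism acting trivially enough on `A` lies in the Johnson filtration. -/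
theorem mem_johnsonFiltration_of_apply_mem [A.Normal] {f : MulAut P} (hf : f ∈ autPair A) {m : ℕ}
    (h0 : ∀ x, f x * x⁻¹ ∈ lowerSeries A m) (h1 : ∀ a ∈ A, f a * a⁻¹ ∈ lowerSeries A (m + 1)) :
    f ∈ johnsonFiltration A m := by
  rw [mem_johnsonFiltration]
  refine ⟨hf, fun j => ?_⟩
  induction j with
  | zero => exact fun x _ => h0 x
  | succ j ih =>
    cases j with
    | zero => exact h1
    | succ j =>
      suffices lowerSeries A (j + 2) ≤ fixedMod f (lowerSeries A (m + (j + 2))) from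
        fun x hx => mem_fixedMod.1 (this hx)
      rw [lowerSeries_succ_succ, Subgroup.commutator_le]
      intro a ha b hb
      have hα := ih a ha
      have hβ := h1 b hb
      obtain ⟨α, αdef⟩ : ∃ α, α = f a * a⁻¹ := ⟨_, rfl⟩
      obtain ⟨β, βdef⟩ : ∃ β, β = f b * b⁻¹ := ⟨_, rfl⟩
      rw [← αdef] at hα
      rw [← βdef] at hβ
      have ea : f a = α * a := by simp [αdef]
      have eb : f b = β * b := by simp [βdef]
      rw [mem_fixedMod', map_commutatorElement, ea, eb, map_commutatorElement,
        map_commutatorElement, map_mul, map_mul]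
      have ha1 : a ∈ lowerSeries A 1 := lowerSeries_antitone A (by omega) ha
      have hb1 : b ∈ lowerSeries A 1 := hb
      have hβ1 : β ∈ lowerSeries A 1 := lowerSeries_antitone A (by omega) hβ
      have hab : b * a⁻¹ * b⁻¹ ∈ lowerSeries A (j + 1) :=
        (lowerSeries_normal A (j + 1)).conj_mem _ (inv_mem ha) _
      -- Modulo `A_{m+j+2}` the deviation `α ∈ A_{m+j+1}` commutes with `A`, and `β ∈ A_{m+1}`
      -- commutes with `A_{j+1}`; so both drop out of `⁅α * a, β * b⁆`.
      have c1 := commute_mk_lowerSeries (k := m + (j + 2)) (by omega) hα ha1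
      have c2 := commute_mk_lowerSeries (k := m + (j + 2)) (by omega) hα hb1
      have c3 := commute_mk_lowerSeries (k := m + (j + 2)) (by omega) hα hβ1
      have c4 := commute_mk_lowerSeries (k := m + (j + 2)) (by omega) hβ ha
      have c5 := commute_mk_lowerSeries (k := m + (j + 2)) (by omega) hβ hab
      simp only [map_mul, map_inv] at c5
      generalize QuotientGroup.mk' (lowerSeries A (m + (j + 2))) a = x at *
      generalize QuotientGroup.mk' (lowerSeries A (m + (j + 2))) b = y at *
      generalize QuotientGroup.mk' (lowerSeries A (m + (j + 2))) α = u at *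
      generalize QuotientGroup.mk' (lowerSeries A (m + (j + 2))) β = v at *
      have c6 : Commute u (v * y) := c3.mul_right c2
      have c7 : Commute v (x * (y * x⁻¹ * y⁻¹)) := c4.mul_right c5
      calc ⁅u * x, v * y⁆ = (x * u) * (v * y) * x⁻¹ * u⁻¹ * (v * y)⁻¹ := by
            rw [commutatorElement_def, c1.eq]; simp [mul_assoc, c1.inv_inv.eq]
        _ = x * (v * y * u) * x⁻¹ * u⁻¹ * (v * y)⁻¹ := by rw [← c6.eq]; group
        _ = x * (v * y) * (u * x⁻¹) * u⁻¹ * (v * y)⁻¹ := by group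
        _ = x * (v * y) * (x⁻¹ * u) * u⁻¹ * (v * y)⁻¹ := by rw [c1.inv_right.eq]
        _ = (x * v) * y * x⁻¹ * y⁻¹ * v⁻¹ := by group
        _ = v * (x * (y * x⁻¹ * y⁻¹)) * v⁻¹ := by rw [← c4.eq]; group
        _ = ⁅x, y⁆ := by rw [c7.eq, commutatorElement_def]; group

theorem list_prod_map_mul {G α : Type*} [Group G] (l : List α) {d b : α → G}
    (h : ∀ i j, Commute (d i) (b j)) :
    (l.map fun i => d i * b i).prod = (l.map d).prod * (l.map b).prod := by
  induction l with
  | nil => simp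
  | cons i l ih =>
    have : Commute (l.map d).prod (b i) := Commute.list_prod_left _ _ fun x hx => by
      obtain ⟨j, -, rfl⟩ := List.mem_map.1 hx
      exact h j i
    rw [List.map_cons, List.prod_cons, ih, List.map_cons, List.prod_cons, List.map_cons,
      List.prod_cons]
    calc d i * b i * ((l.map d).prod * (l.map b).prod)
        = d i * (b i * (l.map d).prod) * (l.map b).prod := by group
      _ = _ := by rw [← this.eq]; group

/-- A pair `(P, A)` isomorphic to a free group on generators `S i`, `B i` and the kernel of the
projection killing the `B i`. -/
structure IsSplitPair {ι : Type} (A : Subgroup P) (S B : ι → P) (e : P ≃* SplitFree ι) : Prop where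
  mem_iff : ∀ x, x ∈ A ↔ e x ∈ splitKer ι
  apply_S : ∀ i, e (S i) = SemidirectProduct.inr (FreeGroup.of i)
  apply_B : ∀ i, e (B i) = SemidirectProduct.inl (FreeGroup.of (1, i))

namespace IsSplitPair

variable {ι : Type} {S B : ι → P} {e : P ≃* SplitFree ι}

theorem map_eq (h : IsSplitPair A S B e) : A.map e.toMonoidHom = splitKer ι := by
  ext y
  obtain ⟨x, rfl⟩ := e.surjective y
  rw [← h.mem_iff]
  exact Subgroup.mem_map_iff_mem e.injective

theorem normal (h : IsSplitPair A S B e) : A.Normal := by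
  have : A = (splitKer ι).comap e.toMonoidHom := by
    ext x
    exact h.mem_iff x
  rw [this]
  infer_instance

theorem mem_lowerSeries_iff (h : IsSplitPair A S B e) (m : ℕ) (x : P) :
    x ∈ lowerSeries A m ↔ e x ∈ lowerSeries (splitKer ι) m := by
  rw [← h.map_eq, ← map_lowerSeries_of_surjective A e.toMonoidHom e.surjective]
  exact (Subgroup.mem_map_iff_mem e.injective).symm

theorem eq_one_of_mem_lowerSeries (h : IsSplitPair A S B e) {x : P}
    (hx : ∀ m, x ∈ lowerSeries A m) : x = 1 := by
  rw [← map_eq_one_iff e e.injective]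
  exact eq_one_of_mem_lowerSeries_splitKer fun m => (h.mem_lowerSeries_iff m x).1 (hx m)

theorem mem_lowerSeries_succ (h : IsSplitPair A S B e) [Nonempty ι] {k : ℕ} {y : P}
    (hy : y ∈ lowerSeries A k) (hya : ∀ a ∈ A, ⁅y, a⁆ ∈ lowerSeries A (k + 2)) :
    y ∈ lowerSeries A (k + 1) := by
  rw [h.mem_lowerSeries_iff] at hy ⊢
  refine mem_lowerSeries_splitKer_of_commutator hy fun a ha => ?_
  obtain ⟨a, rfl⟩ := e.surjective a
  rw [← map_commutatorElement, ← h.mem_lowerSeries_iff]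
  exact hya a ((h.mem_iff a).2 ha)

theorem conj_closure (h : IsSplitPair A S B e) :
    A ≤ Subgroup.closure (Set.range fun p : P × ι => p.1 * B p.2 * p.1⁻¹) := by
  intro a ha
  obtain ⟨n, hn⟩ := (h.mem_iff a).1 ha
  have key : ∀ n : ConjFree ι, e.symm (SemidirectProduct.inl n) ∈
      Subgroup.closure (Set.range fun p : P × ι => p.1 * B p.2 * p.1⁻¹) := by
    intro n
    have : (⊤ : Subgroup (ConjFree ι)) ≤ (Subgroup.closure
        (Set.range fun p : P × ι => p.1 * B p.2 * p.1⁻¹)).comap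
          (e.symm.toMonoidHom.comp SemidirectProduct.inl) := by
      rw [← FreeGroup.closure_range_of, Subgroup.closure_le]
      rintro _ ⟨⟨x, i⟩, rfl⟩
      refine Subgroup.subset_closure ⟨(e.symm (SemidirectProduct.inr x), i), ?_⟩
      apply e.injective
      have := SemidirectProduct.inl_aut (φ := conjAction ι) x (FreeGroup.of (1, i))
      rw [conjAction_of, mul_one, map_inv] at this
      simp [h.apply_B, this]
    exact this trivial
  rw [← e.symm_apply_apply a, ← hn]
  exact key n

/-- Modulo `A_{m+1}` elements of `A_m` commute with `A`. So the deviations `δ i` of the `B i` can be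
collected in front of `f ζ`, while the deviation of `S i` disappears because it conjugates an
element of `A`. What remains is the relation treated in `mem_lowerSeries_splitKer_of_prod`.
Positivity of `m` places the deviations inside `A`. -/
theorem apply_mem_of_fixes (h : IsSplitPair A S B e) [Fintype ι] {l : List ι}
    (hl : ∀ c : ι → ℤ, (l.map c).sum = ∑ i, c i) {m : ℕ} (hm : 0 < m) {f : MulAut P}
    (h0 : ∀ x, f x * x⁻¹ ∈ lowerSeries A m)
    (hζ : f ((l.map B).prod * (l.map fun i => S i * B i * (S i)⁻¹).prod⁻¹) =
      (l.map B).prod * (l.map fun i => S i * B i * (S i)⁻¹).prod⁻¹) :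
    ∀ a ∈ A, f a * a⁻¹ ∈ lowerSeries A (m + 1) := by
  have := h.normal
  have hB : ∀ i, B i ∈ A := fun i => by rw [h.mem_iff, h.apply_B]; exact ⟨_, rfl⟩
  have hcomm : ∀ x, ∀ a ∈ A, Commute (QuotientGroup.mk' (lowerSeries A (m + 1)) (f x * x⁻¹))
      (QuotientGroup.mk' (lowerSeries A (m + 1)) a) := fun x a ha =>
    commute_mk_lowerSeries (n := 1) le_rfl (h0 x) ha
  have hδA : ∀ i, f (B i) * (B i)⁻¹ ∈ A := fun i =>
    lowerSeries_antitone A (Nat.succ_le_of_lt hm : 1 ≤ m) (h0 (B i))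
  have hδ : ∀ i, f (B i) * (B i)⁻¹ ∈ lowerSeries A (m + 1) := by
    intro k
    rw [h.mem_lowerSeries_iff]
    refine mem_lowerSeries_splitKer_of_prod hl hm (δ := fun i => e (f (B i) * (B i)⁻¹))
      (fun i => (h.mem_lowerSeries_iff _ _).1 (h0 _)) ?_ k
    have e1 : (l.map fun i => e (f (B i) * (B i)⁻¹)).prod =
        e (l.map fun i => f (B i) * (B i)⁻¹).prod := by
      rw [map_list_prod, List.map_map]; rfl
    have e2 : (l.map fun i => SemidirectProduct.inr (FreeGroup.of i) * e (f (B i) * (B i)⁻¹) *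
        (SemidirectProduct.inr (FreeGroup.of i))⁻¹).prod =
        e (l.map fun i => S i * (f (B i) * (B i)⁻¹) * (S i)⁻¹).prod := by
      rw [map_list_prod, List.map_map]
      refine congrArg List.prod (List.map_congr_left fun i _ => ?_)
      simp only [Function.comp_apply, map_mul, map_inv, h.apply_S]
    rw [e1, e2, ← map_inv, ← map_mul, ← h.mem_lowerSeries_iff]
    set q := QuotientGroup.mk' (lowerSeries A (m + 1)) with hq
    have hqz : ∀ x : P, x ∈ lowerSeries A (m + 1) ↔ q x = 1 := fun x => by
      rw [← MonoidHom.mem_ker, QuotientGroup.ker_mk']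
    rw [hqz, map_mul, map_inv, inv_mul_eq_one, map_list_prod, map_list_prod, List.map_map,
      List.map_map]
    have hconj : ∀ i, q (f (S i * B i * (S i)⁻¹)) =
        q (S i * (f (B i) * (B i)⁻¹) * (S i)⁻¹) * q (S i * B i * (S i)⁻¹) := fun i => by
      have hmem : S i * f (B i) * (S i)⁻¹ ∈ A := by
        refine Subgroup.Normal.conj_mem this _ ?_ _
        simpa using mul_mem (hδA i) (hB i)
      have c := hcomm (S i) _ hmem
      rw [← map_mul]
      calc q (f (S i * B i * (S i)⁻¹)) = q (f (S i) * (S i)⁻¹) * q (S i * f (B i) * (S i)⁻¹) *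
            (q (f (S i) * (S i)⁻¹))⁻¹ := by
            rw [← map_inv, ← map_mul, ← map_mul]
            congr 1
            rw [map_mul, map_mul, map_inv]
            group
        _ = q (S i * f (B i) * (S i)⁻¹) := by rw [c.eq]; group
        _ = _ := by congr 1; group
    have hBδ : ∀ i, q (f (B i)) = q (f (B i) * (B i)⁻¹) * q (B i) := fun i => by
      rw [← map_mul]; simp
    have p1 : q (f (l.map B).prod) =
        (l.map fun i => q (f (B i) * (B i)⁻¹)).prod * q (l.map B).prod := by
      rw [map_list_prod, map_list_prod, map_list_prod, List.map_map, List.map_map, List.map_map,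
        ← list_prod_map_mul l (d := fun i => q (f (B i) * (B i)⁻¹)) (b := q ∘ B)
          fun i j => hcomm _ _ (hB j)]
      exact congrArg List.prod (List.map_congr_left fun i _ => hBδ i)
    have p2 : q (f (l.map fun i => S i * B i * (S i)⁻¹).prod) =
        (l.map fun i => q (S i * (f (B i) * (B i)⁻¹) * (S i)⁻¹)).prod *
          q (l.map fun i => S i * B i * (S i)⁻¹).prod := by
      rw [map_list_prod, map_list_prod, map_list_prod, List.map_map, List.map_map, List.map_map,
        ← list_prod_map_mul l (d := fun i => q (S i * (f (B i) * (B i)⁻¹) * (S i)⁻¹))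
          (b := q ∘ fun i => S i * B i * (S i)⁻¹) fun i j => ?_]
      · exact congrArg List.prod (List.map_congr_left fun i _ => hconj i)
      · exact commute_mk_lowerSeries (n := 1) le_rfl
          ((lowerSeries_normal A m).conj_mem _ (h0 _) _) (this.conj_mem _ (hB j) _)
    have p3 := congrArg q hζ
    rw [map_mul f, map_inv f, map_mul q, map_inv q, p1, p2, map_mul q, map_inv q] at p3
    -- The collected deviation is moved past `ζ ∈ A`, so that `ζ` cancels from both sides.
    have c1 : Commute (l.map fun i => q (S i * (f (B i) * (B i)⁻¹) * (S i)⁻¹)).prod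
        (q (l.map B).prod * (q (l.map fun i => S i * B i * (S i)⁻¹).prod)⁻¹) := by
      refine Commute.list_prod_left _ _ fun x hx => ?_
      obtain ⟨j, -, rfl⟩ := List.mem_map.1 hx
      rw [← map_inv, ← map_mul]
      refine commute_mk_lowerSeries (n := 1) le_rfl
          ((lowerSeries_normal A m).conj_mem _ (h0 _) _) (mul_mem ?_ (inv_mem ?_))
      · refine list_prod_mem fun x hx => ?_
        obtain ⟨j, -, rfl⟩ := List.mem_map.1 hx
        exact hB j
      · refine list_prod_mem fun x hx => ?_
        obtain ⟨j, -, rfl⟩ := List.mem_map.1 hx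
        exact this.conj_mem _ (hB j) _
    rw [mul_inv_rev, mul_assoc, ← mul_assoc (q (l.map B).prod), ← c1.inv_left.eq, ← mul_assoc,
      mul_eq_right, mul_inv_eq_one] at p3
    exact p3
  -- Elements fixed modulo `A_{m+1}` form a subgroup, so the conjugates `x * B i * x⁻¹` suffice; the
  -- deviation of `x` lies in `A_m` and commutes with them.
  suffices A ≤ fixedMod f (lowerSeries A (m + 1)) from fun a ha => mem_fixedMod.1 (this ha)
  refine h.conj_closure.trans ((Subgroup.closure_le _).2 ?_)
  rintro _ ⟨⟨x, i⟩, rfl⟩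
  change x * B i * x⁻¹ ∈ fixedMod f _
  rw [mem_fixedMod']
  have c := hcomm x _ (this.conj_mem _ (hB i) x)
  have hδi := mem_fixedMod'.1 (mem_fixedMod.2 (hδ i))
  set q := QuotientGroup.mk' (lowerSeries A (m + 1))
  calc q (f (x * B i * x⁻¹)) = q (f x) * q (f (B i)) * (q (f x))⁻¹ := by simp
    _ = q (f x * x⁻¹) * q (x * B i * x⁻¹) * (q (f x * x⁻¹))⁻¹ := by
      rw [hδi]
      simp only [map_mul, map_inv]
      group
    _ = _ := by rw [c.eq]; group

/-- Both `a` and `x⁻¹ * a * x` are fixed modulo `A_{m+1}`, so `f x` and `x` conjugate the latter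
alike. Hence `y = f x * x⁻¹` satisfies `⁅y, A⁆ ≤ A_{m+1}`, and it descends the series one step at a
time while `k + 2 ≤ m + 1`. -/
theorem apply_mem_of_forall_mem (h : IsSplitPair A S B e) [Nonempty ι] {f : MulAut P} {m : ℕ}
    (h1 : ∀ a ∈ A, f a * a⁻¹ ∈ lowerSeries A (m + 1)) (x : P) : f x * x⁻¹ ∈ lowerSeries A m := by
  have := h.normal
  have hc : ∀ a ∈ A, ⁅f x * x⁻¹, a⁆ ∈ lowerSeries A (m + 1) := by
    intro a ha
    have ha' : x⁻¹ * a * x ∈ A := by simpa using this.conj_mem a ha x⁻¹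
    have m1 := mem_fixedMod'.1 (mem_fixedMod.2 (h1 a ha))
    have m2 := mem_fixedMod'.1 (mem_fixedMod.2 (h1 _ ha'))
    rw [← QuotientGroup.ker_mk' (lowerSeries A (m + 1)), MonoidHom.mem_ker, map_commutatorElement,
      commutatorElement_def]
    set q := QuotientGroup.mk' (lowerSeries A (m + 1))
    have m3 : q a = q (f x) * q (f (x⁻¹ * a * x)) * (q (f x))⁻¹ := by
      rw [← m1, ← map_mul, ← map_inv, ← map_mul, ← map_mul, ← map_inv, ← map_mul]
      congr 2
      group
    rw [m2] at m3
    have m4 : q (f x * x⁻¹) * q a * (q (f x * x⁻¹))⁻¹ = q a := by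
      conv_rhs => rw [m3]
      simp [mul_assoc]
    rw [m4, mul_inv_cancel]
  have key : ∀ k ≤ m, f x * x⁻¹ ∈ lowerSeries A k := by
    intro k
    induction k with
    | zero => exact fun _ => trivial
    | succ k ih =>
      intro hk
      exact h.mem_lowerSeries_succ (ih (by omega))
        fun a ha => lowerSeries_antitone A (by omega) (hc a ha)
  exact key m le_rfl

theorem step_zero_eq (h : IsSplitPair A S B e) [Fintype ι] {l : List ι}
    (hl : ∀ c : ι → ℤ, (l.map c).sum = ∑ i, c i) {H : Subgroup (MulAut P)}
    (hζ : ∀ f ∈ H, f ((l.map B).prod * (l.map fun i => S i * B i * (S i)⁻¹).prod⁻¹) =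
      (l.map B).prod * (l.map fun i => S i * B i * (S i)⁻¹).prod⁻¹) (m : ℕ) :
    H ⊓ johnsonStep A m 0 = H ⊓ johnsonFiltration A m := by
  have := h.normal
  refine le_antisymm (fun f hf => ⟨hf.1, ?_⟩) (inf_le_inf_left _ (iInf_le _ 0))
  -- For `m = 0` the filtration is all of `Aut(π, A)`; the boundary word is needed only in positive
  -- degree.
  rcases Nat.eq_zero_or_pos m with rfl | hm
  · rw [johnsonFiltration_zero]
    exact hf.2.1
  · have h0 : ∀ x, f x * x⁻¹ ∈ lowerSeries A m := fun x => hf.2.2 x trivial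
    exact mem_johnsonFiltration_of_apply_mem hf.2.1 h0
      (h.apply_mem_of_fixes hl hm h0 (hζ f hf.1))

theorem step_one_eq (h : IsSplitPair A S B e) [Nonempty ι] (m : ℕ) :
    johnsonStep A m 1 = johnsonFiltration A m := by
  have := h.normal
  refine le_antisymm (fun f hf => ?_) (iInf_le _ 1)
  exact mem_johnsonFiltration_of_apply_mem hf.1 (h.apply_mem_of_forall_mem hf.2) hf.2

theorem isExtendedNSeries (h : IsSplitPair A S B e) (H : Subgroup (MulAut P)) :
    IsExtendedNSeries fun m => H ⊓ johnsonFiltration A m := by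
  have := h.normal
  refine ⟨fun m n hmn => inf_le_inf_left _ (johnsonFiltration_antitone hmn), fun m n => ?_⟩
  refine le_inf ?_ ((Subgroup.commutator_mono inf_le_right inf_le_right).trans
    (commutator_johnsonFiltration_le m n))
  rw [Subgroup.commutator_le]
  intro f hf k hk
  rw [commutatorElement_def]
  exact mul_mem (mul_mem (mul_mem hf.1 hk.1) (inv_mem hf.1)) (inv_mem hk.1)

theorem iInf_eq_bot (h : IsSplitPair A S B e) (H : Subgroup (MulAut P)) :
    ⨅ m, H ⊓ johnsonFiltration A m = ⊥ := by
  rw [eq_bot_iff]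
  intro f hf
  rw [Subgroup.mem_iInf] at hf
  rw [Subgroup.mem_bot]
  ext x
  rw [MulAut.one_apply, ← mul_inv_eq_one]
  refine h.eq_one_of_mem_lowerSeries fun m => ?_
  simpa using (mem_johnsonFiltration.1 (hf m).2).2 0 x trivial

end IsSplitPair

end Johnson

end HandlebodyJohnson
end

noncomputable section

namespace HandlebodyJohnson

open Topology unitInterval Filter

/-! ### Holonomy of locally constant cocycles -/

/-- Local frames `g k` of a principal bundle with discrete group `G` over an open cover `U k`, with
locally constant transition functions. -/
structure Cocycle (κ X G : Type*) [TopologicalSpace X] [Group G] where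
  U : κ → Set X
  isOpen_U : ∀ k, IsOpen (U k)
  cover : ∀ x, ∃ k, x ∈ U k
  g : κ → X → G
  eventually_eq : ∀ k l x, x ∈ U k → x ∈ U l → ∀ᶠ y in 𝓝 x, (g l y)⁻¹ * g k y = (g l x)⁻¹ * g k x

namespace Cocycle

variable {κ X G : Type*} [TopologicalSpace X] [Group G] (C : Cocycle κ X G)

section Bundle

variable [TopologicalSpace G] [DiscreteTopology G]

/-- The bundle core of a cocycle. -/
def core : FiberBundleCore κ X G where
  baseSet := C.U
  isOpen_baseSet := C.isOpen_U
  indexAt x := (C.cover x).choose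
  mem_baseSet_at x := (C.cover x).choose_spec
  coordChange k l x w := (C.g l x)⁻¹ * C.g k x * w
  coordChange_self k x _ w := by simp
  continuousOn_coordChange k l := by
    rintro ⟨x, w⟩ ⟨⟨hk, hl⟩, -⟩
    refine ContinuousAt.continuousWithinAt ?_
    refine ContinuousAt.mul ?_ continuousAt_snd
    have h : ContinuousAt (fun y => (C.g l y)⁻¹ * C.g k y) x :=
      continuousAt_const.congr ((C.eventually_eq k l x hk hl).mono fun y hy => hy.symm)
    exact ContinuousAt.comp (x := (x, w)) (f := Prod.fst) (g := fun y => (C.g l y)⁻¹ * C.g k y) h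
      continuousAt_fst
  coordChange_comp i j k x _ w := by simp [mul_assoc]

/-- The coordinate on the total space in the global set-theoretic trivialization. -/
def coord (p : C.core.TotalSpace) : G := C.g (C.core.indexAt p.1) p.1 * (show G from p.2)

/-- The point of the total space with given coordinate. -/
def point (x : X) (h : G) : C.core.TotalSpace := ⟨x, (C.g (C.core.indexAt x) x)⁻¹ * h⟩

theorem coord_point (x : X) (h : G) : C.coord (C.point x h) = h := mul_inv_cancel_left _ _

theorem localTriv_snd (k : κ) (p : C.core.TotalSpace) :
    (C.core.localTriv k p).2 = (C.g k p.1)⁻¹ * C.coord p :=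
  mul_assoc (G := G) _ _ _

theorem continuousAt_point {Y : Type*} [TopologicalSpace Y] {γ : Y → X} {H : Y → G} {y : Y}
    (hγ : ContinuousAt γ y) {k : κ} (hk : γ y ∈ C.U k)
    (hH : ∀ᶠ z in 𝓝 y, (C.g k (γ z))⁻¹ * H z = (C.g k (γ y))⁻¹ * H y) :
    ContinuousAt (fun z => C.point (γ z) (H z)) y := by
  refine ((C.core.localTriv k).toOpenPartialHomeomorph.continuousAt_iff_continuousAt_comp_left
    ?_).2 ?_
  · exact hγ ((C.isOpen_U k).mem_nhds hk)
  · refine ContinuousAt.prodMk hγ ?_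
    refine ContinuousAt.congr (f := fun _ => (C.g k (γ y))⁻¹ * H y) continuousAt_const
      (hH.mono fun z hz => ?_)
    have := C.localTriv_snd k (C.point (γ z) (H z))
    rw [coord_point] at this
    exact hz.symm.trans this.symm

theorem eventually_coord (p : C.core.TotalSpace) {k : κ} (hk : p.1 ∈ C.U k) :
    ∀ᶠ q in 𝓝 p, (C.g k q.1)⁻¹ * C.coord q = (C.g k p.1)⁻¹ * C.coord p := by
  have h : ContinuousAt (fun q => (C.core.localTriv k q).2) p :=
    continuousAt_snd.comp ((C.core.localTriv k).continuousAt hk)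
  have := h.tendsto.eventually ((isOpen_discrete {(C.core.localTriv k p).2}).mem_nhds rfl)
  filter_upwards [this] with q hq
  rw [← localTriv_snd, ← localTriv_snd]
  exact hq

theorem isCoveringMap : IsCoveringMap C.core.proj := FiberBundle.isCoveringMap

/-- Right multiplication on the total space. -/
def mulRight (h : G) : C(C.core.TotalSpace, C.core.TotalSpace) where
  toFun p := C.point p.1 (C.coord p * h)
  continuous_toFun := by
    rw [continuous_iff_continuousAt]
    intro p
    obtain ⟨k, hk⟩ := C.cover p.1
    refine C.continuousAt_point C.core.continuous_proj.continuousAt hk ?_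
    filter_upwards [C.eventually_coord p hk] with q hq
    rw [← mul_assoc, ← mul_assoc, hq]

/-- Holonomy as the coordinate of a lifted path. -/
def coordHol {x y : X} (γ : Path.Homotopic.Quotient x y) : G :=
  C.coord (C.isCoveringMap.monodromy γ ⟨C.point x 1, rfl⟩).1

/-- Lifting commutes with right multiplication on the fibres, so the lift starting at the coordinate
`1` determines the whole monodromy. -/
theorem monodromy_point {x y : X} (γ : Path.Homotopic.Quotient x y) (h : G) :
    C.isCoveringMap.monodromy γ ⟨C.point x h, rfl⟩ = ⟨C.point y (C.coordHol γ * h), rfl⟩ := by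
  let e : C.core.proj ⁻¹' {x} := ⟨C.point x 1, rfl⟩
  have e1 : C.mulRight h e.1 = C.point x h := by
    change C.point x (C.coord (C.point x 1) * h) = _
    rw [coord_point, one_mul]
  have e2 : C.mulRight h (C.isCoveringMap.monodromy γ e).1 = C.point y (C.coordHol γ * h) := by
    have := (C.isCoveringMap.monodromy γ e).2
    change C.point (C.isCoveringMap.monodromy γ e).1.1 _ = _
    rw [show (C.isCoveringMap.monodromy γ e).1.1 = y from this]
    rfl
  have key : C.isCoveringMap.monodromy γ ⟨C.mulRight h e.1, rfl⟩ =
      ⟨C.mulRight h (C.isCoveringMap.monodromy γ e).1, (C.isCoveringMap.monodromy γ e).2⟩ := by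
    refine C.isCoveringMap.monodromy_eq_of_map_eq
      ((C.isCoveringMap.liftPathQuotient γ e).map (C.mulRight h)) ?_
    rw [← Path.Homotopic.Quotient.map_comp]
    exact C.isCoveringMap.map_liftPathQuotient γ e
  simp only [e1, e2] at key
  exact key

theorem coordHol_trans {x y z : X} (γ : Path.Homotopic.Quotient x y)
    (γ' : Path.Homotopic.Quotient y z) :
    C.coordHol (γ.trans γ') = C.coordHol γ' * C.coordHol γ := by
  rw [coordHol, C.isCoveringMap.monodromy_trans_apply, monodromy_point, monodromy_point,
    coord_point, mul_one]

/-- Over a single chart the lift is explicit: its coordinate follows the frame `g k`. -/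
theorem coordHol_mk {x y : X} (γ : Path x y) {k : κ} (hγ : ∀ t, γ t ∈ C.U k) :
    C.coordHol (.mk γ) = C.g k y * (C.g k x)⁻¹ := by
  let Γ : Path (C.point x 1) (C.point y (C.g k y * (C.g k x)⁻¹)) :=
    { toFun := fun t => C.point (γ t) (C.g k (γ t) * (C.g k x)⁻¹)
      continuous_toFun := by
        rw [continuous_iff_continuousAt]
        intro t
        refine C.continuousAt_point γ.continuous.continuousAt (hγ t) ?_
        simp
      source' := by simp
      target' := by simp }
  have := C.isCoveringMap.monodromy_eq_of_map_eq (γ := .mk γ) (ex := ⟨C.point x 1, rfl⟩)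
    (ey := ⟨C.point y (C.g k y * (C.g k x)⁻¹), rfl⟩) (.mk Γ) rfl
  rw [coordHol, this, coord_point]

end Bundle

/-- The discrete topology on `G` serves only to build the covering space; the existential statement
keeps it out of the definition of holonomy. -/
theorem exists_hol : ∃ hol : ∀ {x y : X}, Path.Homotopic.Quotient x y → G,
    (∀ {x y z : X} (γ : Path.Homotopic.Quotient x y) (γ' : Path.Homotopic.Quotient y z),
      hol (γ.trans γ') = hol γ' * hol γ) ∧
    ∀ {x y : X} (γ : Path x y) (k : κ), (∀ t, γ t ∈ C.U k) →
      hol (.mk γ) = C.g k y * (C.g k x)⁻¹ := by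
  let _ : TopologicalSpace G := ⊥
  have : DiscreteTopology G := ⟨rfl⟩
  exact ⟨C.coordHol, C.coordHol_trans, fun γ _ h => C.coordHol_mk γ h⟩

/-- The holonomy of a path class. -/
def hol {x y : X} (γ : Path.Homotopic.Quotient x y) : G := C.exists_hol.choose γ

theorem hol_trans {x y z : X} (γ : Path.Homotopic.Quotient x y)
    (γ' : Path.Homotopic.Quotient y z) : C.hol (γ.trans γ') = C.hol γ' * C.hol γ :=
  C.exists_hol.choose_spec.1 γ γ'

theorem hol_mk {x y : X} (γ : Path x y) (k : κ) (hγ : ∀ t, γ t ∈ C.U k) :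
    C.hol (.mk γ) = C.g k y * (C.g k x)⁻¹ :=
  C.exists_hol.choose_spec.2 γ k hγ

theorem hol_refl (x : X) : C.hol (.refl x) = 1 := by
  have := C.hol_trans (.refl x) (.refl x)
  rw [Path.Homotopic.Quotient.trans_refl] at this
  simpa using this

theorem hol_symm {x y : X} (γ : Path.Homotopic.Quotient x y) : C.hol γ.symm = (C.hol γ)⁻¹ := by
  have := C.hol_trans γ γ.symm
  rw [Path.Homotopic.Quotient.trans_symm, hol_refl] at this
  exact eq_inv_of_mul_eq_one_left this.symm

/-- Holonomy as a homomorphism on the fundamental group. -/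
def holHom (x : X) : FundamentalGroup X x →* G where
  toFun γ := C.hol γ.toPath
  map_one' := C.hol_refl x
  map_mul' γ γ' := C.hol_trans γ'.toPath γ.toPath

end Cocycle

/-! ### Path induction over an open cover -/

section PathInduction

variable {X κ : Type*} [TopologicalSpace X] {U : κ → Set X}

/-- A Lebesgue number argument: every path splits into pieces that each stay in one open set. -/
theorem path_induction (hU : ∀ k, IsOpen (U k)) (hcover : ∀ x, ∃ k, x ∈ U k)
    {p : ∀ {x y : X}, Path.Homotopic.Quotient x y → Prop}
    (hsmall : ∀ {x y : X} (γ : Path x y) (k : κ), (∀ t, γ t ∈ U k) → p (.mk γ))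
    (htrans : ∀ {x y z : X} (γ : Path.Homotopic.Quotient x y) (γ' : Path.Homotopic.Quotient y z),
      p γ → p γ' → p (γ.trans γ'))
    {x y : X} (γ : Path.Homotopic.Quotient x y) : p γ := by
  induction γ using Path.Homotopic.Quotient.ind with | mk γ => ?_
  obtain ⟨t, ht0, hmono, ⟨N, hN⟩, hsub⟩ := exists_monotone_Icc_subset_open_cover_unitInterval
    (c := fun k => γ ⁻¹' U k) (fun k => (hU k).preimage γ.continuous)
    (fun s _ => by simpa using hcover (γ s))
  have key : ∀ n, p (.mk (γ.subpath (t 0) (t n))) := by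
    intro n
    induction n with
    | zero =>
      obtain ⟨k, hk⟩ := hcover (γ (t 0))
      refine hsmall _ k fun s => ?_
      rw [Path.subpath_self]
      exact hk
    | succ n ih =>
      have h1 : p (.mk (γ.subpath (t n) (t (n + 1)))) := by
        obtain ⟨k, hk⟩ := hsub n
        refine hsmall _ k fun s => ?_
        have := Set.mem_range_self (f := γ.subpath (t n) (t (n + 1))) s
        rw [Path.range_subpath_of_le _ _ _ (hmono n.le_succ)] at this
        obtain ⟨r, hr, hrs⟩ := this
        rw [← hrs]
        exact hk hr
      have h2 := htrans _ _ ih h1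
      rwa [← Path.Homotopic.Quotient.mk_trans,
        Path.Homotopic.Quotient.eq.2 ⟨Path.Homotopy.subpathTransSubpath γ _ _ _⟩] at h2
  have h1 := key N
  rw [ht0, hN N le_rfl, Path.subpath_zero_one, Path.Homotopic.Quotient.mk_cast] at h1
  have hcast : ∀ {x' y' : X} (hx : x' = x) (hy : y' = y) (δ : Path.Homotopic.Quotient x y),
      p (δ.cast hx hy) → p δ := by
    rintro _ _ rfl rfl δ h
    rwa [Path.Homotopic.Quotient.cast_rfl_rfl] at h
  exact hcast _ _ _ h1

end PathInduction

/-! ### The standard surface -/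

section Geometry

variable (g : ℕ)

/-- The surface of the standard handlebody without the interior of the standard disk. -/
def stdSurface : Set (ℝ × ℝ × ℝ) :=
  {p | p ∈ stdHandlebody g ∧ (p.2.2 = 0 ∨ p.2.2 = 1 ∨ p.2.1 = 0 ∨ p.2.1 = 3 ∨
    p.1 = 2 * (g : ℝ) + 1 ∨ ∃ i : ℕ, i < g ∧
      p.1 ∈ Set.Icc (2 * (i : ℝ) + 1) (2 * (i : ℝ) + 2) ∧ p.2.1 ∈ Set.Icc (1 : ℝ) 2)}

/-- The depth coordinate, reflected for `b = true`. -/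
def eta (b : Bool) (y : ℝ) : ℝ := if b then 3 - y else y

/-- The height coordinate, reflected for `a = true`. -/
def zeta (a : Bool) (z : ℝ) : ℝ := if a then 1 - z else z

/-- Four open regions covering the standard surface: the complement of the bottom face (`a = false`)
or of the top face (`a = true`), intersected with the lower (`b = false`) or upper (`b = true`)
half. -/
def region (k : Bool × Bool) : Set (ℝ × ℝ × ℝ) :=
  {p | 0 < zeta k.1 p.2.2 ∧ eta k.2 p.2.1 < 8 / 5}

/-- The point lies over the `i`-th strip between two consecutive holes. -/
def IsTooth (i : ℕ) (p : ℝ × ℝ × ℝ) : Prop :=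
  i ≤ g ∧ p.1 ∈ Set.Icc (2 * (i : ℝ)) (2 * (i : ℝ) + 1)

/-- The point lies over the boundary of the `j`-th hole, or over the outer boundary
for `j = g`. -/
def IsWall (b : Bool) (j : ℕ) (p : ℝ × ℝ × ℝ) : Prop :=
  (j < g ∧ p.1 ∈ Set.Icc (2 * (j : ℝ) + 1) (2 * (j : ℝ) + 2) ∧ p.2.1 ∈ Set.Icc (1 : ℝ) 2) ∨
    (j = g ∧ (eta b p.2.1 = 0 ∨ p.1 = 2 * (g : ℝ) + 1))

variable {g}

theorem continuous_zeta (a : Bool) : Continuous (zeta a) := by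
  cases a
  · exact continuous_id
  · exact continuous_const.sub continuous_id

theorem continuous_eta (b : Bool) : Continuous (eta b) := by
  cases b
  · exact continuous_id
  · exact continuous_const.sub continuous_id

theorem isOpen_region (k : Bool × Bool) : IsOpen (region k) :=
  (isOpen_lt continuous_const ((continuous_zeta k.1).comp
    (continuous_snd.comp continuous_snd))).inter
    (isOpen_lt ((continuous_eta k.2).comp (continuous_fst.comp continuous_snd)) continuous_const)

theorem exists_mem_region (p : ℝ × ℝ × ℝ) : ∃ k, p ∈ region k := by
  have h1 : ∃ a, 0 < zeta a p.2.2 := by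
    by_cases h : 0 < p.2.2
    · exact ⟨false, h⟩
    · exact ⟨true, by simp [zeta]; linarith⟩
  have h2 : ∃ b, eta b p.2.1 < 8 / 5 := by
    by_cases h : p.2.1 < 8 / 5
    · exact ⟨false, h⟩
    · exact ⟨true, by simp [eta]; linarith⟩
  exact ⟨(h1.choose, h2.choose), h1.choose_spec, h2.choose_spec⟩

/-- The bound `8 / 5` lies between `3 / 2` and `2`. So the two halves overlap, and the overlap stays
within the depth range `(1, 2)` of the holes, where the handlebody falls apart into teeth. -/
theorem mem_region_false_true {p : ℝ × ℝ × ℝ} {a : Bool} (h1 : p ∈ region (a, false))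
    (h2 : p ∈ region (a, true)) : 7 / 5 < p.2.1 ∧ p.2.1 < 8 / 5 := by
  have h3 := h1.2
  have h4 := h2.2
  simp only [eta, Bool.false_eq_true, if_false, if_true] at h3 h4
  exact ⟨by linarith, h3⟩

theorem mem_region_height {p : ℝ × ℝ × ℝ} {b : Bool} (h1 : p ∈ region (false, b))
    (h2 : p ∈ region (true, b)) : 0 < p.2.2 ∧ p.2.2 < 1 := by
  have h3 := h1.1
  have h4 := h2.1
  simp only [zeta, Bool.false_eq_true, if_false, if_true] at h3 h4
  exact ⟨h3, by linarith⟩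

/-- Relations between regions containing a point are determined by adjacent regions. -/
theorem region_induction {p : ℝ × ℝ × ℝ} {r : Bool × Bool → Bool × Bool → Prop}
    (hrefl : ∀ k, p ∈ region k → r k k)
    (hsymm : ∀ k l, p ∈ region k → p ∈ region l → r k l → r l k)
    (htrans : ∀ k l m, p ∈ region k → p ∈ region l → p ∈ region m → r k l → r l m → r k m)
    (h1 : ∀ a, p ∈ region (a, false) → p ∈ region (a, true) → r (a, false) (a, true))
    (h2 : ∀ b, p ∈ region (false, b) → p ∈ region (true, b) → r (false, b) (true, b))
    {k l : Bool × Bool} (hk : p ∈ region k) (hl : p ∈ region l) : r k l := by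
  obtain ⟨a, b⟩ := k
  obtain ⟨a', b'⟩ := l
  have hm : p ∈ region (a, b') := ⟨hk.1, hl.2⟩
  refine htrans _ _ _ hk hm hl ?_ ?_
  · cases b <;> cases b'
    · exact hrefl _ hk
    · exact h1 a hk hm
    · exact hsymm _ _ hm hk (h1 a hm hk)
    · exact hrefl _ hk
  · cases a <;> cases a'
    · exact hrefl _ hm
    · exact h2 b' hm hl
    · exact hsymm _ _ hl hm (h2 b' hl hm)
    · exact hrefl _ hm

theorem exists_isTooth {p : ℝ × ℝ × ℝ} (hp : p ∈ stdHandlebody g) (h1 : 7 / 5 < p.2.1)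
    (h2 : p.2.1 < 8 / 5) : ∃ i, IsTooth g i p := by
  obtain ⟨⟨⟨hx0, hx1⟩, -, hole⟩, -⟩ := hp
  simp only at hx0 hx1 hole
  -- Strip `i` and the hole after it fill `2 i ≤ x < 2 i + 2`, hence the floor of `x / 2`.
  have hi := Nat.floor_le (div_nonneg hx0 (zero_le_two (α := ℝ)))
  have hi' := Nat.lt_floor_add_one (p.1 / 2)
  set i := ⌊p.1 / 2⌋₊
  have hig : i ≤ g := by
    have : (i : ℝ) < g + 1 := by linarith
    exact_mod_cast Nat.lt_succ_iff.1 (by exact_mod_cast this)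
  refine ⟨i, hig, by linarith, ?_⟩
  by_contra hlt
  push Not at hlt
  have hig' : i < g := by
    have : (i : ℝ) < g := by linarith
    exact_mod_cast this
  exact hole i hig' ⟨⟨hlt, by linarith⟩, by linarith, by linarith⟩

theorem exists_isWall {p : ℝ × ℝ × ℝ} (hp : p ∈ stdSurface g) {b : Bool}
    (hz0 : 0 < p.2.2) (hz1 : p.2.2 < 1) (hy : eta b p.2.1 < 8 / 5) : ∃ j, IsWall g b j p := by
  obtain ⟨-, h | h | h | h | h | ⟨i, hi, h⟩⟩ := hp
  · exact absurd h hz0.ne'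
  · exact absurd h hz1.ne
  · cases b
    · exact ⟨g, Or.inr ⟨rfl, Or.inl h⟩⟩
    · simp only [eta, if_true] at hy; linarith
  · cases b
    · simp only [eta, Bool.false_eq_true, if_false] at hy; linarith
    · exact ⟨g, Or.inr ⟨rfl, Or.inl (by simp [eta, h])⟩⟩
  · exact ⟨g, Or.inr ⟨rfl, Or.inr h⟩⟩
  · exact ⟨i, Or.inl ⟨hi, h⟩⟩

theorem nat_eq_of_abs_sub_lt {i j : ℕ} (h1 : (i : ℝ) < j + 1) (h2 : (j : ℝ) < i + 1) : i = j := by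
  have h1' : i < j + 1 := by exact_mod_cast h1
  have h2' : j < i + 1 := by exact_mod_cast h2
  omega

/-- The version for two nearby points makes the index locally constant; different strips are at
distance at least one. -/
theorem IsTooth.unique {i j : ℕ} {p q : ℝ × ℝ × ℝ} (hp : IsTooth g i p) (hq : IsTooth g j q)
    (h : |p.1 - q.1| < 1 / 2) : i = j := by
  obtain ⟨-, h1, h2⟩ := hp
  obtain ⟨-, h3, h4⟩ := hq
  rw [abs_lt] at h
  exact nat_eq_of_abs_sub_lt (by linarith) (by linarith)

theorem IsWall.unique {i j : ℕ} {b : Bool} {p q : ℝ × ℝ × ℝ} (hp : IsWall g b i p)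
    (hq : IsWall g b j q) (h : |p.1 - q.1| < 1 / 2) (h' : |p.2.1 - q.2.1| < 1 / 2) : i = j := by
  rw [abs_lt] at h h'
  have key : ∀ {i : ℕ} {p q : ℝ × ℝ × ℝ}, i < g → (p.1 ∈ Set.Icc (2 * (i : ℝ) + 1) (2 * i + 2)) →
      p.2.1 ∈ Set.Icc (1 : ℝ) 2 → (eta b q.2.1 = 0 ∨ q.1 = 2 * (g : ℝ) + 1) →
      -(1 / 2) < p.1 - q.1 → -(1 / 2) < p.2.1 - q.2.1 → p.2.1 - q.2.1 < 1 / 2 → False := by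
    intro i p q hi hx hy h hpq hpq' hpq''
    have hi' : (i : ℝ) + 1 ≤ g := by exact_mod_cast hi
    rcases h with h | h
    · cases b
      · simp only [eta, Bool.false_eq_true, if_false] at h
        linarith [hy.1]
      · simp only [eta, if_true] at h
        linarith [hy.2]
    · linarith [hx.2]
  rcases hp with ⟨hi, hx, hy⟩ | ⟨hi, hp⟩ <;> rcases hq with ⟨hj, hx', hy'⟩ | ⟨hj, hq⟩
  · exact nat_eq_of_abs_sub_lt (by linarith [hx.1, hx'.2]) (by linarith [hx.2, hx'.1])
  · exact (key hi hx hy hq (by linarith) (by linarith) (by linarith)).elim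
  · exact (key hj hx' hy' hp (by linarith) (by linarith) (by linarith)).elim
  · rw [hi, hj]

/-- A wall over the middle band bounds a tooth. -/
theorem IsWall.isTooth {i j : ℕ} {b : Bool} {p : ℝ × ℝ × ℝ} (hp : p ∈ stdHandlebody g)
    (hw : IsWall g b j p) (h1 : 7 / 5 < p.2.1) (h2 : p.2.1 < 8 / 5) (ht : IsTooth g i p) :
    i = j ∨ (j < g ∧ i = j + 1) := by
  rcases hw with ⟨hj, hx, hy⟩ | ⟨rfl, h⟩
  · have hx' : p.1 = 2 * (j : ℝ) + 1 ∨ p.1 = 2 * (j : ℝ) + 2 := by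
      by_contra hne
      push Not at hne
      exact hp.1.2.2 j hj ⟨⟨lt_of_le_of_ne hx.1 hne.1.symm, lt_of_le_of_ne hx.2 hne.2⟩,
        by simp only; linarith, by simp only; linarith⟩
    obtain ⟨-, ht1, ht2⟩ := ht
    rcases hx' with hx' | hx'
    · exact Or.inl (nat_eq_of_abs_sub_lt (by linarith) (by linarith))
    · refine Or.inr ⟨hj, nat_eq_of_abs_sub_lt ?_ ?_⟩ <;> push_cast <;> linarith
  · obtain ⟨-, ht1, ht2⟩ := ht
    rcases h with h | h
    · cases b <;> simp only [eta, Bool.false_eq_true, if_false, if_true] at h <;> linarith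
    · exact Or.inl (nat_eq_of_abs_sub_lt (by linarith) (by linarith))

theorem IsWall.index_eq {i j : ℕ} {b b' : Bool} {p : ℝ × ℝ × ℝ}
    (hi : IsWall g b i p) (hj : IsWall g b' j p) (h1 : 7 / 5 < p.2.1) (h2 : p.2.1 < 8 / 5) :
    i = j := by
  have key : ∀ {b i}, IsWall g b i p → IsWall g false i p := by
    rintro b i (h | ⟨rfl, h | h⟩)
    · exact Or.inl h
    · cases b <;> simp only [eta, Bool.false_eq_true, if_false, if_true] at h <;> linarith
    · exact Or.inr ⟨rfl, Or.inr h⟩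
  exact (key hi).unique (key hj) (by simp) (by simp)

end Geometry

/-! ### A cocycle on the standard surface -/

section Value

/-- Elements of a group assigned to the overlaps of the four regions of the standard surface. -/
structure HandleData (g : ℕ) (G : Type*) [Group G] where
  s : ℕ → G
  u : ℕ → G
  v : ℕ → G
  s_zero : s 0 = 1
  u_last : u g = 1
  v_last : v g = 1
  -- Tooth `i + 1` touches the walls `i` and `i + 1`. Its transition on the bottom face can be
  -- computed past either of them, and the results must agree.
  rel : ∀ i < g, v (i + 1) * s (i + 1) * (u (i + 1))⁻¹ = v i * s (i + 1) * (u i)⁻¹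

namespace HandleData

variable {g : ℕ} {G : Type*} [Group G] (d : HandleData g G)

/-- Transition at the teeth. -/
def side (a : Bool) (i : ℕ) : G := if a then d.v i * d.s i * (d.u i)⁻¹ else d.s i

/-- Transition at the walls. -/
def wall (b : Bool) (j : ℕ) : G := if b then d.v j else d.u j

/-- The local frames of the cocycle. -/
def value (k : Bool × Bool) (p : ℝ × ℝ × ℝ) : G :=
  let τ := Classical.epsilon fun i => IsTooth g i p
  let ω := fun b => Classical.epsilon fun j => IsWall g b j p
  let t : G := if k.2 = true ∧ p.2.1 < 8 / 5 then (d.s τ)⁻¹ else 1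
  if k.1 = true then
    if 0 < p.2.2 then t * (d.wall k.2 (ω k.2))⁻¹
    else if k.2 = true ∧ p.2.1 < 8 / 5 then (d.side true τ)⁻¹ else 1
  else t

theorem epsilon_isTooth {i : ℕ} {p : ℝ × ℝ × ℝ} (h : IsTooth g i p) :
    (Classical.epsilon fun i => IsTooth g i p) = i :=
  (Classical.epsilon_spec (p := fun i => IsTooth g i p) ⟨i, h⟩).unique h (by simp)

theorem epsilon_isWall {b : Bool} {j : ℕ} {p : ℝ × ℝ × ℝ} (h : IsWall g b j p) :
    (Classical.epsilon fun j => IsWall g b j p) = j :=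
  (Classical.epsilon_spec (p := fun j => IsWall g b j p) ⟨j, h⟩).unique h (by simp) (by simp)

theorem side_true_of_wall {i j : ℕ} (h : i = j ∨ (j < g ∧ i = j + 1)) :
    d.v j * d.s i * (d.u j)⁻¹ = d.side true i := by
  rcases h with rfl | ⟨hj, rfl⟩
  · rfl
  · exact (d.rel j hj).symm

/-- For `a = true` and positive height the point lies on a wall, whose index is the same in both
halves. By `side_true_of_wall` it does not matter which adjacent wall this is; here the relation in
the data is used. -/
theorem value_tooth {p : ℝ × ℝ × ℝ} (hp : p ∈ stdSurface g) {a : Bool} {i : ℕ}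
    (h1 : p ∈ region (a, false)) (h2 : p ∈ region (a, true)) (ht : IsTooth g i p) :
    (d.value (a, true) p)⁻¹ * d.value (a, false) p = d.side a i := by
  obtain ⟨hy1, hy2⟩ := mem_region_false_true h1 h2
  cases a
  · simp [value, hy2, epsilon_isTooth ht, side]
  · by_cases hz : 0 < p.2.2
    · have hz1 : p.2.2 < 1 := by
        have := h1.1
        simp only [zeta, if_true] at this
        linarith
      obtain ⟨j, hj⟩ := exists_isWall hp hz hz1 h1.2
      obtain ⟨j', hj'⟩ := exists_isWall hp hz hz1 h2.2
      obtain rfl := hj.index_eq hj' hy1 hy2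
      rw [← d.side_true_of_wall (hj.isTooth hp.1 hy1 hy2 ht)]
      simp [value, hy2, hz, epsilon_isTooth ht, epsilon_isWall hj, epsilon_isWall hj', wall]
    · simp [value, hy2, hz, epsilon_isTooth ht]

theorem value_wall {p : ℝ × ℝ × ℝ} {b : Bool} {j : ℕ}
    (h1 : p ∈ region (false, b)) (h2 : p ∈ region (true, b)) (hw : IsWall g b j p) :
    (d.value (true, b) p)⁻¹ * d.value (false, b) p = d.wall b j := by
  have hz := (mem_region_height h1 h2).1
  have e := epsilon_isWall hw
  by_cases hy : p.2.1 < 8 / 5 <;> cases b <;> simp [value, hz, e, hy]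

/-- The frames themselves may jump, but their transitions depend only on the index of a tooth or a
wall, which is locally constant. -/
theorem value_eventually {p : stdSurface g} {k l : Bool × Bool} (hk : p.1 ∈ region k)
    (hl : p.1 ∈ region l) : ∀ᶠ q : stdSurface g in 𝓝 p,
      (d.value l q.1)⁻¹ * d.value k q.1 = (d.value l p.1)⁻¹ * d.value k p.1 := by
  have hmem : ∀ k, p.1 ∈ region k → ∀ᶠ q : stdSurface g in 𝓝 p, q.1 ∈ region k := fun k hk =>
    continuous_subtype_val.continuousAt.eventually ((isOpen_region k).mem_nhds hk)
  have hnear1 : ∀ᶠ q : stdSurface g in 𝓝 p, |p.1.1 - q.1.1| < 1 / 2 := by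
    have : ContinuousAt (fun q : stdSurface g => |p.1.1 - q.1.1|) p := by fun_prop
    exact this.eventually_lt continuousAt_const (by simp)
  have hnear2 : ∀ᶠ q : stdSurface g in 𝓝 p, |p.1.2.1 - q.1.2.1| < 1 / 2 := by
    have : ContinuousAt (fun q : stdSurface g => |p.1.2.1 - q.1.2.1|) p := by fun_prop
    exact this.eventually_lt continuousAt_const (by simp)
  refine region_induction (p := p.1) (r := fun k l => ∀ᶠ q : stdSurface g in 𝓝 p,
      (d.value l q.1)⁻¹ * d.value k q.1 = (d.value l p.1)⁻¹ * d.value k p.1)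
      ?_ ?_ ?_ ?_ ?_ hk hl
  · intro k _
    simp
  · intro k l _ _ h
    filter_upwards [h] with q hq
    rw [← inv_inj]
    simpa using hq
  · intro k l m _ _ _ h1 h2
    filter_upwards [h1, h2] with q hq1 hq2
    have := congrArg₂ (· * ·) hq2 hq1
    simpa [mul_assoc] using this
  · intro a h1 h2
    obtain ⟨i, hi⟩ := exists_isTooth p.2.1 (mem_region_false_true h1 h2).1
      (mem_region_false_true h1 h2).2
    rw [d.value_tooth p.2 h1 h2 hi]
    filter_upwards [hmem _ h1, hmem _ h2, hnear1] with q hq1 hq2 hq3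
    obtain ⟨i', hi'⟩ := exists_isTooth q.2.1 (mem_region_false_true hq1 hq2).1
      (mem_region_false_true hq1 hq2).2
    rw [d.value_tooth q.2 hq1 hq2 hi', hi.unique hi' hq3]
  · intro b h1 h2
    obtain ⟨j, hj⟩ := exists_isWall p.2 (mem_region_height h1 h2).1 (mem_region_height h1 h2).2 h1.2
    rw [d.value_wall h1 h2 hj]
    filter_upwards [hmem _ h1, hmem _ h2, hnear1, hnear2] with q hq1 hq2 hq3 hq4
    obtain ⟨j', hj'⟩ := exists_isWall q.2 (mem_region_height hq1 hq2).1
      (mem_region_height hq1 hq2).2 hq1.2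
    rw [d.value_wall hq1 hq2 hj', hj.unique hj' hq3 hq4]

/-- The cocycle on the standard surface. -/
def cocycle : Cocycle (Bool × Bool) (stdSurface g) G where
  U k := Subtype.val ⁻¹' region k
  isOpen_U k := (isOpen_region k).preimage continuous_subtype_val
  cover p := exists_mem_region p.1
  g k p := d.value k p.1
  eventually_eq _ _ _ hk hl := d.value_eventually hk hl

end HandleData

end Value

/-! ### The cocycle on the standard handlebody -/

section Solid

variable {g : ℕ} {G : Type*} [Group G] (s : ℕ → G)

/-- The local frames of the cocycle on the standard handlebody. -/
def solidValue (g : ℕ) (b : Bool) (p : ℝ × ℝ × ℝ) : G :=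
  if b = true ∧ p.2.1 < 8 / 5 then (s (Classical.epsilon fun i => IsTooth g i p))⁻¹ else 1

/-- The cocycle on the standard handlebody. -/
def solidCocycle : Cocycle Bool (stdHandlebody g) G where
  U b := {p | eta b p.1.2.1 < 8 / 5}
  isOpen_U b := isOpen_lt ((continuous_eta b).comp (continuous_fst.comp
    (continuous_snd.comp continuous_subtype_val))) continuous_const
  cover p := by
    obtain ⟨k, hk⟩ := exists_mem_region p.1
    exact ⟨k.2, hk.2⟩
  g b p := solidValue s g b p.1
  eventually_eq := by
    have key : ∀ p : stdHandlebody g, 7 / 5 < p.1.2.1 → p.1.2.1 < 8 / 5 → ∀ᶠ q in 𝓝 p,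
        solidValue s g false q.1 = 1 ∧ solidValue s g true q.1 = solidValue s g true p.1 := by
      intro p h1 h2
      have e1 : ∀ᶠ q : stdHandlebody g in 𝓝 p, 7 / 5 < q.1.2.1 :=
        ContinuousAt.eventually_lt continuousAt_const (by fun_prop) h1
      have e2 : ∀ᶠ q : stdHandlebody g in 𝓝 p, q.1.2.1 < 8 / 5 :=
        ContinuousAt.eventually_lt (by fun_prop) continuousAt_const h2
      have e3 : ∀ᶠ q : stdHandlebody g in 𝓝 p, |p.1.1 - q.1.1| < 1 / 2 := by
        have : ContinuousAt (fun q : stdHandlebody g => |p.1.1 - q.1.1|) p := by fun_prop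
        exact this.eventually_lt continuousAt_const (by simp)
      obtain ⟨i, hi⟩ := exists_isTooth p.2 h1 h2
      filter_upwards [e1, e2, e3] with q hq1 hq2 hq3
      obtain ⟨i', hi'⟩ := exists_isTooth q.2 hq1 hq2
      refine ⟨by simp [solidValue], ?_⟩
      simp only [solidValue, h2, hq2, HandleData.epsilon_isTooth hi,
        HandleData.epsilon_isTooth hi', hi.unique hi' hq3]
    have band : ∀ p : stdHandlebody g, eta false p.1.2.1 < 8 / 5 → eta true p.1.2.1 < 8 / 5 →
        7 / 5 < p.1.2.1 ∧ p.1.2.1 < 8 / 5 := by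
      intro p h1 h2
      simp only [eta, Bool.false_eq_true, if_false, if_true] at h1 h2
      exact ⟨by linarith, h1⟩
    intro k l p hk hl
    cases k <;> cases l
    · simp
    · obtain ⟨h1, h2⟩ := band p hk hl
      filter_upwards [key p h1 h2] with q hq
      rw [hq.1, hq.2, (key p h1 h2).self_of_nhds.1]
    · obtain ⟨h1, h2⟩ := band p hl hk
      filter_upwards [key p h1 h2] with q hq
      rw [hq.1, hq.2, (key p h1 h2).self_of_nhds.1]
    · simp

end Solid

/-! ### Contracting the regions -/

section Contract

theorem contractibleSpace_of_push {A : Set (ℝ × ℝ × ℝ)} {y₀ z₀ : ℝ} (h0 : (0, y₀, z₀) ∈ A)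
    (hz : ∀ p ∈ A, ∀ t ∈ I, (p.1, p.2.1, (1 - t) * p.2.2 + t * z₀) ∈ A)
    (hy : ∀ p ∈ A, p.2.2 = z₀ → ∀ t ∈ I, (p.1, (1 - t) * p.2.1 + t * y₀, z₀) ∈ A)
    (hx : ∀ p ∈ A, p.2.1 = y₀ → p.2.2 = z₀ → ∀ t ∈ I, ((1 - t) * p.1, y₀, z₀) ∈ A) :
    ContractibleSpace A := by
  have hz' : ∀ p ∈ A, (p.1, p.2.1, z₀) ∈ A := fun p hp => by
    simpa using hz p hp 1 unitInterval.one_mem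
  have hy' : ∀ p ∈ A, (p.1, y₀, z₀) ∈ A := fun p hp => by
    simpa using hy _ (hz' p hp) rfl 1 unitInterval.one_mem
  let r1 : C(A, A) := ⟨fun p => ⟨(p.1.1, p.1.2.1, z₀), hz' p p.2⟩, by fun_prop⟩
  let r2 : C(A, A) := ⟨fun p => ⟨(p.1.1, y₀, z₀), hy' p p.2⟩, by fun_prop⟩
  rw [contractible_iff_id_nullhomotopic]
  refine ⟨⟨(0, y₀, z₀), h0⟩, ?_⟩
  have H1 : (ContinuousMap.id A).Homotopic r1 :=
    ⟨{  toFun := fun q => ⟨(q.2.1.1, q.2.1.2.1, (1 - (q.1 : ℝ)) * q.2.1.2.2 + q.1 * z₀),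
          hz _ q.2.2 _ q.1.2⟩
        continuous_toFun := by fun_prop
        map_zero_left := fun p => by simp
        map_one_left := fun p => by simp [r1] }⟩
  have H2 : r1.Homotopic r2 :=
    ⟨{  toFun := fun q => ⟨(q.2.1.1, (1 - (q.1 : ℝ)) * q.2.1.2.1 + q.1 * y₀, z₀),
          hy _ (hz' _ q.2.2) rfl _ q.1.2⟩
        continuous_toFun := by fun_prop
        map_zero_left := fun p => by simp [r1]
        map_one_left := fun p => by simp [r2] }⟩
  have H3 : r2.Homotopic (ContinuousMap.const A ⟨(0, y₀, z₀), h0⟩) :=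
    ⟨{  toFun := fun q => ⟨((1 - (q.1 : ℝ)) * q.2.1.1, y₀, z₀),
          hx _ (hy' _ q.2.2) rfl rfl _ q.1.2⟩
        continuous_toFun := by fun_prop
        map_zero_left := fun p => by simp [r2]
        map_one_left := fun p => by simp }⟩
  exact (H1.trans H2).trans H3

variable {g : ℕ}

theorem mem_stdHandlebody_iff {x y z : ℝ} : (x, y, z) ∈ stdHandlebody g ↔
    (0 ≤ x ∧ x ≤ 2 * (g : ℝ) + 1) ∧ (0 ≤ y ∧ y ≤ 3) ∧ (0 ≤ z ∧ z ≤ 1) ∧ ∀ i : ℕ, i < g →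
      2 * (i : ℝ) + 1 < x → x < 2 * (i : ℝ) + 2 → 1 < y → 2 ≤ y := by
  simp only [stdHandlebody, holedRectangle, Set.mem_ofPred_eq, Set.mem_Icc, Set.mem_Ioo, not_and,
    not_lt, and_imp]
  tauto

theorem mem_stdSurface_iff {x y z : ℝ} : (x, y, z) ∈ stdSurface g ↔
    (x, y, z) ∈ stdHandlebody g ∧ (z = 0 ∨ z = 1 ∨ y = 0 ∨ y = 3 ∨
    x = 2 * (g : ℝ) + 1 ∨ ∃ i : ℕ, i < g ∧
      (2 * (i : ℝ) + 1 ≤ x ∧ x ≤ 2 * (i : ℝ) + 2) ∧ 1 ≤ y ∧ y ≤ 2) :=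
  Iff.rfl

theorem mem_region_iff {x y z : ℝ} {a b : Bool} : (x, y, z) ∈ region (a, b) ↔
    0 < zeta a z ∧ eta b y < 8 / 5 := Iff.rfl

theorem stdHandlebody_eta {x y z : ℝ} (b : Bool) (h : (x, y, z) ∈ stdHandlebody g) :
    (x, eta b y, z) ∈ stdHandlebody g := by
  cases b
  · exact h
  · rw [mem_stdHandlebody_iff] at h ⊢
    obtain ⟨hx, hy, hz, hole⟩ := h
    refine ⟨hx, ?_, hz, fun i hi h1 h2 h3 => ?_⟩
    · simp only [eta, if_true]
      constructor <;> linarith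
    · simp only [eta, if_true] at h3 ⊢
      by_contra hlt
      linarith [hole i hi h1 h2 (by linarith)]

theorem stdHandlebody_zeta {x y z : ℝ} (a : Bool) (h : (x, y, z) ∈ stdHandlebody g) :
    (x, y, zeta a z) ∈ stdHandlebody g := by
  cases a
  · exact h
  · rw [mem_stdHandlebody_iff] at h ⊢
    obtain ⟨hx, hy, hz, hole⟩ := h
    refine ⟨hx, hy, ?_, hole⟩
    simp only [zeta, if_true]
    constructor <;> linarith

theorem eta_eta (b : Bool) (y : ℝ) : eta b (eta b y) = y := by cases b <;> simp [eta]

theorem zeta_zeta (a : Bool) (z : ℝ) : zeta a (zeta a z) = z := by cases a <;> simp [zeta]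

theorem stdSurface_eta {x y z : ℝ} (b : Bool) (h : (x, y, z) ∈ stdSurface g) :
    (x, eta b y, z) ∈ stdSurface g := by
  refine ⟨stdHandlebody_eta b h.1, ?_⟩
  cases b
  · exact h.2
  · rw [mem_stdSurface_iff] at h
    simp only [eta, if_true, Set.mem_Icc]
    rcases h.2 with h | h | h | h | h | ⟨i, hi, h, h'⟩
    · tauto
    · tauto
    · exact Or.inr (Or.inr (Or.inr (Or.inl (by linarith))))
    · exact Or.inr (Or.inr (Or.inl (by linarith)))
    · tauto
    · exact Or.inr (Or.inr (Or.inr (Or.inr (Or.inr ⟨i, hi, h, by linarith, by linarith⟩))))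

theorem stdSurface_zeta {x y z : ℝ} (a : Bool) (h : (x, y, z) ∈ stdSurface g) :
    (x, y, zeta a z) ∈ stdSurface g := by
  refine ⟨stdHandlebody_zeta a h.1, ?_⟩
  cases a
  · exact h.2
  · rw [mem_stdSurface_iff] at h
    simp only [zeta, if_true, Set.mem_Icc]
    rcases h.2 with h | h | h
    · exact Or.inr (Or.inl (by linarith))
    · exact Or.inl (by linarith)
    · tauto

/-- The part of the standard surface in a region. -/
def patch (g : ℕ) (k : Bool × Bool) : Set (ℝ × ℝ × ℝ) := stdSurface g ∩ region k

/-- Reflections in height and depth reduce the four patches to one. -/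
theorem mem_patch_iff {x y z : ℝ} {a b : Bool} : (x, y, z) ∈ patch g (a, b) ↔
    (x, eta b y, zeta a z) ∈ patch g (false, false) := by
  constructor
  · rintro ⟨h1, h2, h3⟩
    exact ⟨stdSurface_zeta a (stdSurface_eta b h1), h2, h3⟩
  · rintro ⟨h1, h2, h3⟩
    refine ⟨?_, h2, h3⟩
    simpa only [eta_eta, zeta_zeta] using stdSurface_zeta a (stdSurface_eta b h1)

theorem patch_push_height {x y z w : ℝ} (h : (x, y, z) ∈ patch g (false, false)) (h1 : z ≤ w)
    (h2 : w ≤ 1) : (x, y, w) ∈ patch g (false, false) := by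
  obtain ⟨h, hz, hy⟩ := h
  simp only [zeta, Bool.false_eq_true, if_false] at hz
  rw [mem_stdSurface_iff, mem_stdHandlebody_iff] at h
  refine ⟨mem_stdSurface_iff.2 ⟨mem_stdHandlebody_iff.2 ?_, ?_⟩, ?_, hy⟩
  · exact ⟨h.1.1, h.1.2.1, ⟨by linarith, h2⟩, h.1.2.2.2⟩
  · rcases h.2 with h | h | h
    · exact absurd h hz.ne'
    · exact Or.inr (Or.inl (by linarith))
    · exact Or.inr (Or.inr h)
  · simp only [zeta, Bool.false_eq_true, if_false]
    linarith

theorem patch_push_depth {x y w : ℝ} (h : (x, y, 1) ∈ patch g (false, false)) (h1 : 0 ≤ w)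
    (h2 : w ≤ y) : (x, w, 1) ∈ patch g (false, false) := by
  obtain ⟨h, -, hy⟩ := h
  simp only [eta, Bool.false_eq_true, if_false] at hy
  rw [mem_stdSurface_iff, mem_stdHandlebody_iff] at h
  refine ⟨mem_stdSurface_iff.2 ⟨mem_stdHandlebody_iff.2 ?_, Or.inr (Or.inl rfl)⟩, ?_, ?_⟩
  · refine ⟨h.1.1, ⟨h1, by linarith⟩, h.1.2.2.1, fun i hi h3 h4 h5 => ?_⟩
    -- Over the interior of a hole's `x`-range, depth above `1` means depth at least `2`, which `y <
    -- 8 / 5` excludes.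
    linarith [h.1.2.2.2 i hi h3 h4 (by linarith)]
  · simp [zeta]
  · simp only [eta, Bool.false_eq_true, if_false]
    linarith

theorem mem_patch_corner {x z : ℝ} (h1 : 0 ≤ x) (h2 : x ≤ 2 * (g : ℝ) + 1) (h3 : 0 < z)
    (h4 : z ≤ 1) : (x, 0, z) ∈ patch g (false, false) := by
  refine ⟨mem_stdSurface_iff.2 ⟨mem_stdHandlebody_iff.2 ?_, Or.inr (Or.inr (Or.inl rfl))⟩, h3, ?_⟩
  · refine ⟨⟨h1, h2⟩, ⟨le_rfl, by norm_num⟩, ⟨h3.le, h4⟩, fun i hi _ _ h5 => ?_⟩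
    linarith
  · simp only [eta, Bool.false_eq_true, if_false]
    norm_num

theorem eta_convex (b : Bool) (t y w : ℝ) :
    eta b ((1 - t) * y + t * w) = (1 - t) * eta b y + t * eta b w := by
  cases b <;> simp [eta]; ring

theorem zeta_convex (a : Bool) (t z w : ℝ) :
    zeta a ((1 - t) * z + t * w) = (1 - t) * zeta a z + t * zeta a w := by
  cases a <;> simp [zeta]; ring

theorem patch_bounds {x y z : ℝ} (h : (x, y, z) ∈ patch g (false, false)) :
    0 ≤ x ∧ x ≤ 2 * (g : ℝ) + 1 ∧ 0 ≤ y ∧ y < 8 / 5 ∧ 0 < z ∧ z ≤ 1 := by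
  obtain ⟨h, hz, hy⟩ := h
  simp only [zeta, eta, Bool.false_eq_true, if_false] at hz hy
  rw [mem_stdSurface_iff, mem_stdHandlebody_iff] at h
  exact ⟨h.1.1.1, h.1.1.2, h.1.2.1.1, hy, hz, h.1.2.2.1.2⟩

instance contractibleSpace_patch (k : Bool × Bool) : ContractibleSpace (patch g k) := by
  obtain ⟨a, b⟩ := k
  refine contractibleSpace_of_push (y₀ := eta b 0) (z₀ := zeta a 1) ?_ ?_ ?_ ?_
  · rw [mem_patch_iff, eta_eta, zeta_zeta]
    exact mem_patch_corner le_rfl (by positivity) one_pos le_rfl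
  · rintro ⟨x, y, z⟩ h t ⟨ht0, ht1⟩
    rw [mem_patch_iff] at h ⊢
    rw [zeta_convex, zeta_zeta]
    have := patch_bounds h
    exact patch_push_height h (by nlinarith) (by nlinarith)
  · rintro ⟨x, y, z⟩ h rfl t ⟨ht0, ht1⟩
    rw [mem_patch_iff] at h ⊢
    rw [zeta_zeta] at h ⊢
    rw [eta_convex, eta_eta]
    have := patch_bounds h
    exact patch_push_depth h (by nlinarith) (by nlinarith)
  · rintro ⟨x, y, z⟩ h rfl rfl t ⟨ht0, ht1⟩
    rw [mem_patch_iff] at h ⊢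
    rw [zeta_zeta, eta_eta] at h ⊢
    have := patch_bounds h
    exact mem_patch_corner (by nlinarith) (by nlinarith) one_pos le_rfl

/-- The lower half of the standard handlebody. -/
def lowerHalf (g : ℕ) : Set (ℝ × ℝ × ℝ) := {p | p ∈ stdHandlebody g ∧ p.2.1 < 8 / 5}

instance contractibleSpace_lowerHalf : ContractibleSpace (lowerHalf g) := by
  have key : ∀ {x y z y' z' : ℝ}, (x, y, z) ∈ lowerHalf g → 0 ≤ y' → y' ≤ y → 0 ≤ z' → z' ≤ 1 →
      (x, y', z') ∈ lowerHalf g := by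
    rintro x y z y' z' ⟨h, h'⟩ h1 h2 h3 h4
    rw [mem_stdHandlebody_iff] at h
    simp only at h'
    refine ⟨mem_stdHandlebody_iff.2 ⟨h.1, ⟨h1, by linarith⟩, ⟨h3, h4⟩, fun i hi h5 h6 h7 => ?_⟩,
      by simp only; linarith⟩
    linarith [h.2.2.2 i hi h5 h6 (by linarith)]
  have corner : ∀ {x : ℝ}, 0 ≤ x → x ≤ 2 * (g : ℝ) + 1 → (x, 0, 1) ∈ lowerHalf g := by
    intro x h1 h2
    refine ⟨mem_stdHandlebody_iff.2 ⟨⟨h1, h2⟩, ⟨le_rfl, by norm_num⟩, ⟨by norm_num, le_rfl⟩,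
      fun i hi _ _ h5 => ?_⟩, by norm_num⟩
    linarith
  refine contractibleSpace_of_push (y₀ := 0) (z₀ := 1) (corner le_rfl (by positivity)) ?_ ?_ ?_
  · rintro ⟨x, y, z⟩ h t ⟨ht0, ht1⟩
    have h' := mem_stdHandlebody_iff.1 h.1
    exact key h h'.2.1.1 le_rfl (by nlinarith) (by nlinarith)
  · rintro ⟨x, y, z⟩ h hz t ⟨ht0, ht1⟩
    have h' := mem_stdHandlebody_iff.1 h.1
    exact key h (by nlinarith) (by nlinarith) zero_le_one le_rfl
  · rintro ⟨x, y, z⟩ h hy hz t ⟨ht0, ht1⟩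
    have h' := mem_stdHandlebody_iff.1 h.1
    exact corner (by nlinarith) (by nlinarith)

end Contract

/-! ### Components of the overlaps of regions -/

section Joined

variable {g : ℕ}

theorem joinedIn_line {A : Set (ℝ × ℝ × ℝ)} {p q : ℝ × ℝ × ℝ}
    (h : ∀ t ∈ I, ((1 - t) * p.1 + t * q.1, (1 - t) * p.2.1 + t * q.2.1,
      (1 - t) * p.2.2 + t * q.2.2) ∈ A) : JoinedIn A p q := by
  refine JoinedIn.ofLine (f := fun t => ((1 - t) * p.1 + t * q.1, (1 - t) * p.2.1 + t * q.2.1,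
      (1 - t) * p.2.2 + t * q.2.2)) (by fun_prop) (by simp) (by simp) ?_
  rintro _ ⟨t, ht, rfl⟩
  exact h t ht

theorem convex_same (t x : ℝ) : (1 - t) * x + t * x = x := by ring

theorem convex_mem {a b x y t : ℝ} (hx : a ≤ x ∧ x ≤ b) (hy : a ≤ y ∧ y ≤ b) (h0 : 0 ≤ t)
    (h1 : t ≤ 1) : a ≤ (1 - t) * x + t * y ∧ (1 - t) * x + t * y ≤ b := by
  constructor <;> nlinarith

theorem convex_mem_open {a b x y t : ℝ} (hx : a < x ∧ x < b) (hy : a < y ∧ y < b) (h0 : 0 ≤ t)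
    (h1 : t ≤ 1) : a < (1 - t) * x + t * y ∧ (1 - t) * x + t * y < b := by
  rcases h0.eq_or_lt with rfl | h0
  · simpa using hx
  · constructor <;> nlinarith

/-- The overlap of the two halves of the top or bottom part of the standard surface. -/
def toothSet (g : ℕ) (a : Bool) : Set (ℝ × ℝ × ℝ) :=
  stdSurface g ∩ (region (a, false) ∩ region (a, true))

/-- The overlap of the top and bottom part in one half of the standard surface. -/
def wallSet (g : ℕ) (b : Bool) : Set (ℝ × ℝ × ℝ) :=
  stdSurface g ∩ (region (false, b) ∩ region (true, b))

/-- A base point for each component of `toothSet`. -/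
def toothPoint (a : Bool) (i : ℕ) : ℝ × ℝ × ℝ := (2 * (i : ℝ), 3 / 2, zeta a 1)

/-- A base point for each component of `wallSet`. -/
def wallPoint (g : ℕ) (b : Bool) (j : ℕ) : ℝ × ℝ × ℝ :=
  if j < g then (2 * (j : ℝ) + 1, eta b 1, 1 / 2) else (0, eta b 0, 1 / 2)

theorem mem_toothSet_iff {x y z : ℝ} {a : Bool} : (x, y, z) ∈ toothSet g a ↔
    (x, y, zeta a z) ∈ toothSet g false := by
  constructor
  · rintro ⟨h1, h2, h3⟩
    exact ⟨stdSurface_zeta a h1, h2, h3⟩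
  · rintro ⟨h1, h2, h3⟩
    refine ⟨?_, h2, h3⟩
    simpa only [zeta_zeta] using stdSurface_zeta a h1

theorem mem_wallSet_iff {x y z : ℝ} {b : Bool} : (x, y, z) ∈ wallSet g b ↔
    (x, eta b y, z) ∈ wallSet g false := by
  constructor
  · rintro ⟨h1, h2, h3⟩
    exact ⟨stdSurface_eta b h1, ⟨h2.1, h2.2⟩, ⟨h3.1, h3.2⟩⟩
  · rintro ⟨h1, h2, h3⟩
    refine ⟨?_, ⟨h2.1, h2.2⟩, ⟨h3.1, h3.2⟩⟩
    simpa only [eta_eta] using stdSurface_eta b h1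

theorem mem_toothSet_false {x y z : ℝ} : (x, y, z) ∈ toothSet g false ↔
    (x, y, z) ∈ stdSurface g ∧ 0 < z ∧ 7 / 5 < y ∧ y < 8 / 5 := by
  simp only [toothSet, Set.mem_inter_iff, mem_region_iff, zeta, eta, Bool.false_eq_true, if_false,
    if_true]
  constructor
  · rintro ⟨h1, ⟨h2, h3⟩, -, h4⟩
    exact ⟨h1, h2, by linarith, h3⟩
  · rintro ⟨h1, h2, h3, h4⟩
    exact ⟨h1, ⟨h2, h4⟩, h2, by linarith⟩

theorem mem_wallSet_false {x y z : ℝ} : (x, y, z) ∈ wallSet g false ↔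
    (x, y, z) ∈ stdSurface g ∧ 0 < z ∧ z < 1 ∧ y < 8 / 5 := by
  simp only [wallSet, Set.mem_inter_iff, mem_region_iff, zeta, eta, Bool.false_eq_true, if_false,
    if_true]
  constructor
  · rintro ⟨h1, ⟨h2, h3⟩, h4, -⟩
    exact ⟨h1, h2, by linarith, h3⟩
  · rintro ⟨h1, h2, h3, h4⟩
    exact ⟨h1, ⟨h2, h4⟩, by linarith, h4⟩

theorem IsTooth.mem_stdHandlebody {i : ℕ} {x y z : ℝ} (h : IsTooth g i (x, y, z)) {y' z' : ℝ}
    (hy : 0 ≤ y' ∧ y' ≤ 3) (hz : 0 ≤ z' ∧ z' ≤ 1) : (x, y', z') ∈ stdHandlebody g := by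
  obtain ⟨hi, hx, hx'⟩ := h
  simp only at hx hx'
  have hig : (i : ℝ) ≤ g := by exact_mod_cast hi
  have hi0 : (0 : ℝ) ≤ i := i.cast_nonneg
  refine mem_stdHandlebody_iff.2 ⟨⟨by linarith, by linarith⟩, hy, hz, fun k _ h1 h2 _ => ?_⟩
  have : k = i := nat_eq_of_abs_sub_lt (by linarith) (by linarith)
  subst this
  linarith

theorem joinedIn_toothPoint_false {p : ℝ × ℝ × ℝ} (hp : p ∈ toothSet g false) {i : ℕ}
    (hi : IsTooth g i p) : JoinedIn (toothSet g false) p (toothPoint false i) := by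
  obtain ⟨x, y, z⟩ := p
  obtain ⟨hX, hz, hy1, hy2⟩ := mem_toothSet_false.1 hp
  have hX' := mem_stdHandlebody_iff.1 hX.1
  have top : ∀ {x y : ℝ}, IsTooth g i (x, 0, 0) → 7 / 5 < y → y < 8 / 5 →
      (x, y, 1) ∈ toothSet g false := fun hx h1 h2 => mem_toothSet_false.2
    ⟨⟨hx.mem_stdHandlebody ⟨by linarith, by linarith⟩ ⟨zero_le_one, le_rfl⟩,
      Or.inr (Or.inl rfl)⟩, one_pos, h1, h2⟩
  have s1 : JoinedIn (toothSet g false) (x, y, z) (x, y, 1) := by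
    refine joinedIn_line ?_
    rintro t ⟨h0, h1⟩
    simp only [convex_same]
    have := patch_push_height (w := (1 - t) * z + t * 1) ⟨hX, hp.2.1⟩ (by nlinarith)
      (by nlinarith)
    refine mem_toothSet_false.2 ⟨this.1, ?_, hy1, hy2⟩
    nlinarith
  have s2 : JoinedIn (toothSet g false) (x, y, 1) (x, 3 / 2, 1) := by
    refine joinedIn_line ?_
    rintro t ⟨h0, h1⟩
    simp only [convex_same]
    have := convex_mem_open ⟨hy1, hy2⟩ (y := 3 / 2) ⟨by norm_num, by norm_num⟩ h0 h1
    exact top hi this.1 this.2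
  have s3 : JoinedIn (toothSet g false) (x, 3 / 2, 1) (2 * (i : ℝ), 3 / 2, 1) := by
    refine joinedIn_line ?_
    rintro t ⟨h0, h1⟩
    simp only [convex_same]
    exact top ⟨hi.1, convex_mem hi.2 (y := 2 * (i : ℝ)) ⟨le_rfl, by linarith⟩ h0 h1⟩
      (by norm_num) (by norm_num)
  exact (s1.trans s2).trans s3

theorem joinedIn_toothPoint {p : ℝ × ℝ × ℝ} {a : Bool} (hp : p ∈ toothSet g a) {i : ℕ}
    (hi : IsTooth g i p) : JoinedIn (toothSet g a) p (toothPoint a i) := by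
  obtain ⟨x, y, z⟩ := p
  have h := (joinedIn_toothPoint_false (mem_toothSet_iff.1 hp) (i := i) hi).map
    (f := fun q => (q.1, q.2.1, zeta a q.2.2)) (by have := continuous_zeta a; fun_prop)
  have h2 : (fun q : ℝ × ℝ × ℝ => (q.1, q.2.1, zeta a q.2.2)) (toothPoint false i) =
      toothPoint a i := by simp [toothPoint, zeta]
  beta_reduce at h2
  rw [h2] at h
  simp only [zeta_zeta] at h
  refine h.mono ?_
  rintro _ ⟨⟨x, y, z⟩, hq, rfl⟩
  rw [mem_toothSet_iff, zeta_zeta]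
  exact hq

/-- The wall is contracted in depth, then in length, then in height. In the lower half the wall of a
hole has the shape of a U, and the outer wall that of an L, since the face `x = 0` is not part of
the surface. -/
theorem joinedIn_wallPoint_false {p : ℝ × ℝ × ℝ} (hp : p ∈ wallSet g false) {j : ℕ}
    (hj : IsWall g false j p) : JoinedIn (wallSet g false) p (wallPoint g false j) := by
  obtain ⟨x, y, z⟩ := p
  obtain ⟨hX, hz1, hz2, hy⟩ := mem_wallSet_false.1 hp
  have hX' := mem_stdHandlebody_iff.1 hX.1
  have level : ∀ {x y : ℝ}, (x, y, z) ∈ wallSet g false →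
      JoinedIn (wallSet g false) (x, y, z) (x, y, 1 / 2) := by
    intro x y h
    refine joinedIn_line ?_
    rintro t ⟨h0, h1⟩
    simp only [convex_same]
    have hz := convex_mem_open ⟨hz1, hz2⟩ (y := 1 / 2) ⟨by norm_num, by norm_num⟩ h0 h1
    obtain ⟨h3, -, -, h4⟩ := mem_wallSet_false.1 h
    have h5 := mem_stdHandlebody_iff.1 h3.1
    refine mem_wallSet_false.2 ⟨⟨mem_stdHandlebody_iff.2 ⟨h5.1, h5.2.1, ⟨hz.1.le, hz.2.le⟩,
      h5.2.2.2⟩, ?_⟩, hz.1, hz.2, h4⟩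
    rcases h3.2 with h | h | h
    · exact absurd h hz1.ne'
    · exact absurd h hz2.ne
    · exact Or.inr (Or.inr h)
  rcases hj with ⟨hj, ⟨hx1, hx2⟩, hy1, hy2⟩ | ⟨rfl, h⟩
  · simp only at hx1 hx2 hy1 hy2
    have hjg : (j : ℝ) + 1 ≤ g := by exact_mod_cast hj
    have hj0 : (0 : ℝ) ≤ j := j.cast_nonneg
    have base : ∀ {x y : ℝ}, 2 * (j : ℝ) + 1 ≤ x → x ≤ 2 * (j : ℝ) + 2 → 1 ≤ y → y < 8 / 5 →
        (y = 1 ∨ x = 2 * (j : ℝ) + 1 ∨ x = 2 * (j : ℝ) + 2) → (x, y, z) ∈ wallSet g false := by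
      intro x y h1 h2 h3 h4 h5
      refine mem_wallSet_false.2 ⟨⟨mem_stdHandlebody_iff.2 ⟨⟨by linarith, by linarith⟩,
        ⟨by linarith, by linarith⟩, ⟨hz1.le, hz2.le⟩, fun k _ h6 h7 h8 => ?_⟩, ?_⟩, hz1, hz2, h4⟩
      · exfalso
        rcases h5 with rfl | rfl | rfl
        · linarith
        · have h9 : (j : ℝ) < (k : ℝ) + 1 := by linarith
          have h10 : (k : ℝ) < j := by linarith
          have h9' : j < k + 1 := by exact_mod_cast h9
          have h10' : k < j := by exact_mod_cast h10
          omega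
        · have h9 : (j : ℝ) < (k : ℝ) := by linarith
          have h10 : (k : ℝ) < j + 1 := by linarith
          have h9' : j < k := by exact_mod_cast h9
          have h10' : k < j + 1 := by exact_mod_cast h10
          omega
      · exact Or.inr (Or.inr (Or.inr (Or.inr (Or.inr ⟨j, hj, ⟨h1, h2⟩, h3, by
          simp only; linarith⟩))))
    have hcases : y = 1 ∨ x = 2 * (j : ℝ) + 1 ∨ x = 2 * (j : ℝ) + 2 := by
      by_contra hne
      push Not at hne
      linarith [hX'.2.2.2 j hj (lt_of_le_of_ne hx1 hne.2.1.symm) (lt_of_le_of_ne hx2 hne.2.2)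
        (lt_of_le_of_ne hy1 hne.1.symm)]
    have s1 : JoinedIn (wallSet g false) (x, y, z) (x, 1, z) := by
      refine joinedIn_line ?_
      rintro t ⟨h0, h1⟩
      simp only [convex_same]
      refine base hx1 hx2 (by nlinarith) (by nlinarith) ?_
      rcases hcases with rfl | h
      · left; ring
      · exact Or.inr h
    have s2 : JoinedIn (wallSet g false) (x, 1, z) (2 * (j : ℝ) + 1, 1, z) := by
      refine joinedIn_line ?_
      rintro t ⟨h0, h1⟩
      simp only [convex_same]
      have := convex_mem ⟨hx1, hx2⟩ (y := 2 * (j : ℝ) + 1) ⟨le_rfl, by linarith⟩ h0 h1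
      exact base this.1 this.2 le_rfl (by norm_num) (Or.inl rfl)
    have := (s1.trans s2).trans (level s2.target_mem)
    simpa [wallPoint, hj, eta] using this
  · have base : ∀ {x y : ℝ}, 0 ≤ x → x ≤ 2 * (j : ℝ) + 1 → 0 ≤ y → y < 8 / 5 →
        (y = 0 ∨ x = 2 * (j : ℝ) + 1) → (x, y, z) ∈ wallSet j false := by
      intro x y h1 h2 h3 h4 h5
      refine mem_wallSet_false.2 ⟨⟨mem_stdHandlebody_iff.2 ⟨⟨h1, h2⟩,
        ⟨h3, by linarith⟩, ⟨hz1.le, hz2.le⟩, fun k hk h6 h7 h8 => ?_⟩, ?_⟩, hz1, hz2, h4⟩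
      · exfalso
        rcases h5 with rfl | rfl
        · linarith
        · have h9 : (j : ℝ) < (k : ℝ) + 1 := by linarith
          have h9' : j < k + 1 := by exact_mod_cast h9
          have h10 : (k : ℝ) + 1 ≤ j := by exact_mod_cast hk
          linarith
      · rcases h5 with h5 | h5
        · exact Or.inr (Or.inr (Or.inl h5))
        · exact Or.inr (Or.inr (Or.inr (Or.inr (Or.inl h5))))
    have hj0 : (0 : ℝ) ≤ j := j.cast_nonneg
    simp only [eta, Bool.false_eq_true, if_false] at h
    have s1 : JoinedIn (wallSet j false) (x, y, z) (x, 0, z) := by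
      refine joinedIn_line ?_
      rintro t ⟨h0, h1⟩
      simp only [convex_same]
      refine base hX'.1.1 hX'.1.2 (by nlinarith [hX'.2.1.1]) (by nlinarith [hX'.2.1.1]) ?_
      rcases h with rfl | h
      · left; ring
      · exact Or.inr h
    have s2 : JoinedIn (wallSet j false) (x, 0, z) (0, 0, z) := by
      refine joinedIn_line ?_
      rintro t ⟨h0, h1⟩
      simp only [convex_same]
      exact base (by nlinarith [hX'.1.1]) (by nlinarith [hX'.1.1]) le_rfl (by norm_num) (Or.inl rfl)
    have := (s1.trans s2).trans (level s2.target_mem)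
    simpa [wallPoint, eta] using this

theorem isWall_eta {b : Bool} {j : ℕ} {x y z : ℝ} (h : IsWall g b j (x, y, z)) :
    IsWall g false j (x, eta b y, z) := by
  rcases h with ⟨hj, hx, hy⟩ | h
  · refine Or.inl ⟨hj, hx, ?_⟩
    cases b
    · exact hy
    · simp only [eta, if_true, Set.mem_Icc] at hy ⊢
      constructor <;> linarith [hy.1, hy.2]
  · exact Or.inr h

theorem joinedIn_wallPoint {p : ℝ × ℝ × ℝ} {b : Bool} (hp : p ∈ wallSet g b) {j : ℕ}
    (hj : IsWall g b j p) : JoinedIn (wallSet g b) p (wallPoint g b j) := by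
  obtain ⟨x, y, z⟩ := p
  have h := (joinedIn_wallPoint_false (mem_wallSet_iff.1 hp) (isWall_eta hj)).map
    (f := fun q => (q.1, eta b q.2.1, q.2.2)) (by have := continuous_eta b; fun_prop)
  have h2 : (fun q : ℝ × ℝ × ℝ => (q.1, eta b q.2.1, q.2.2)) (wallPoint g false j) =
      wallPoint g b j := by
    by_cases hj : j < g <;> simp [wallPoint, eta, hj]
  beta_reduce at h2
  rw [h2] at h
  simp only [eta_eta] at h
  refine h.mono ?_
  rintro _ ⟨⟨x, y, z⟩, hq, rfl⟩
  rw [mem_wallSet_iff, eta_eta]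
  exact hq

end Joined

/-! ### Frames of path classes on the standard surface -/

section Frames

open Path.Homotopic (Quotient)

theorem trans_symm_cancel {X : Type*} [TopologicalSpace X] {x y z : X}
    (p : Path.Homotopic.Quotient x y) (q : Path.Homotopic.Quotient x z) :
    p.trans (p.symm.trans q) = q := by
  rw [← Path.Homotopic.Quotient.trans_assoc, Path.Homotopic.Quotient.trans_symm,
    Path.Homotopic.Quotient.refl_trans]

theorem symm_trans_cancel {X : Type*} [TopologicalSpace X] {x y z : X}
    (p : Path.Homotopic.Quotient x y) (q : Path.Homotopic.Quotient y z) :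
    p.symm.trans (p.trans q) = q := by
  rw [← Path.Homotopic.Quotient.trans_assoc, Path.Homotopic.Quotient.symm_trans,
    Path.Homotopic.Quotient.refl_trans]

theorem symm_trans_rev {X : Type*} [TopologicalSpace X] {x y z : X}
    (p : Path.Homotopic.Quotient x y) (q : Path.Homotopic.Quotient y z) :
    (p.trans q).symm = q.symm.trans p.symm := by
  rw [← symm_trans_cancel q (p.trans q).symm, ← symm_trans_cancel p (q.trans _),
    ← Path.Homotopic.Quotient.trans_assoc p, Path.Homotopic.Quotient.trans_symm,
    Path.Homotopic.Quotient.trans_refl]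

theorem quotient_map_trans {X Y : Type*} [TopologicalSpace X] [TopologicalSpace Y] {x y z : X}
    (p : Path.Homotopic.Quotient x y) (q : Path.Homotopic.Quotient y z) (f : C(X, Y)) :
    (p.trans q).map f = (p.map f).trans (q.map f) := by
  induction p using Path.Homotopic.Quotient.ind
  induction q using Path.Homotopic.Quotient.ind
  exact congrArg Path.Homotopic.Quotient.mk (Path.map_trans _ _ f.continuous)

theorem quotient_map_symm {X Y : Type*} [TopologicalSpace X] [TopologicalSpace Y] {x y : X}
    (p : Path.Homotopic.Quotient x y) (f : C(X, Y)) : p.symm.map f = (p.map f).symm := by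
  induction p using Path.Homotopic.Quotient.ind
  rfl

variable {g : ℕ}

/-- The inclusion of a patch. -/
def patchIncl (g : ℕ) (k : Bool × Bool) : C(patch g k, stdSurface g) :=
  ⟨Set.inclusion Set.inter_subset_left, continuous_inclusion _⟩

/-- The unique class of paths in a patch between two points. -/
def patchPath (k : Bool × Bool) (x y : stdSurface g) (hx : x.1 ∈ region k) (hy : y.1 ∈ region k) :
    Path.Homotopic.Quotient x y :=
  (Path.Homotopic.Quotient.mk (PathConnectedSpace.somePath (⟨x.1, x.2, hx⟩ : patch g k)
    ⟨y.1, y.2, hy⟩)).map (patchIncl g k)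

/-- Patches are contractible, so paths in one with common endpoints are homotopic. -/
theorem patchPath_eq_map {k : Bool × Bool} {x y : stdSurface g} (hx : x.1 ∈ region k)
    (hy : y.1 ∈ region k)
    (γ : Path.Homotopic.Quotient (⟨x.1, x.2, hx⟩ : patch g k) ⟨y.1, y.2, hy⟩) :
    patchPath k x y hx hy = γ.map (patchIncl g k) :=
  congrArg (Path.Homotopic.Quotient.map · (patchIncl g k)) (Subsingleton.elim _ _)

theorem patchPath_eq_mk {k : Bool × Bool} {x y : stdSurface g} (γ : Path x y)
    (hγ : ∀ t, (γ t).1 ∈ region k) :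
    patchPath k x y (by simpa using hγ 0) (by simpa using hγ 1) = .mk γ := by
  let δ : Path (⟨x.1, x.2, by simpa using hγ 0⟩ : patch g k) ⟨y.1, y.2, by simpa using hγ 1⟩ :=
    { toFun := fun t => ⟨(γ t).1, (γ t).2, hγ t⟩
      continuous_toFun := by fun_prop
      source' := by simp
      target' := by simp }
  exact patchPath_eq_map _ _ (.mk δ)

theorem patchPath_trans {k : Bool × Bool} {x y z : stdSurface g} (hx : x.1 ∈ region k)
    (hy : y.1 ∈ region k) (hz : z.1 ∈ region k) :
    (patchPath k x y hx hy).trans (patchPath k y z hy hz) = patchPath k x z hx hz := by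
  rw [patchPath_eq_map hx hz ((Path.Homotopic.Quotient.mk (PathConnectedSpace.somePath _
    (⟨y.1, y.2, hy⟩ : patch g k))).trans (.mk (PathConnectedSpace.somePath _ _)))]
  exact (quotient_map_trans _ _ (patchIncl g k)).symm

theorem patchPath_self {k : Bool × Bool} {x : stdSurface g} (hx : x.1 ∈ region k) :
    patchPath k x x hx hx = .refl x :=
  patchPath_eq_map hx hx (.refl _)

/-- Base points of the four patches. -/
def basePoint : Bool × Bool → ℝ × ℝ × ℝ
  | (false, false) => (0, 0, 1)
  | (false, true) => (0, 3 / 2, 1)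
  | (true, false) => (0, 0, 1 / 2)
  | (true, true) => (0, 3, 1 / 2)

theorem basePoint_mem (k : Bool × Bool) : basePoint k ∈ stdSurface g := by
  have hg : (0 : ℝ) ≤ g := g.cast_nonneg
  have h : ∀ y z : ℝ, 0 ≤ y → y ≤ 3 → 0 ≤ z → z ≤ 1 → (0, y, z) ∈ stdHandlebody g := by
    intro y z h1 h2 h3 h4
    refine mem_stdHandlebody_iff.2 ⟨⟨le_rfl, by positivity⟩, ⟨h1, h2⟩, ⟨h3, h4⟩,
      fun i _ h5 _ _ => ?_⟩
    have : (0 : ℝ) ≤ i := i.cast_nonneg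
    linarith
  obtain ⟨_ | _, _ | _⟩ := k
  · exact ⟨h _ _ (by norm_num) (by norm_num) (by norm_num) (by norm_num), Or.inr (Or.inl rfl)⟩
  · exact ⟨h _ _ (by norm_num) (by norm_num) (by norm_num) (by norm_num), Or.inr (Or.inl rfl)⟩
  · exact ⟨h _ _ (by norm_num) (by norm_num) (by norm_num) (by norm_num),
      Or.inr (Or.inr (Or.inl rfl))⟩
  · exact ⟨h _ _ (by norm_num) (by norm_num) (by norm_num) (by norm_num),
      Or.inr (Or.inr (Or.inr (Or.inl rfl)))⟩

/-- Base points of the four patches, in the standard surface. -/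
def base (g : ℕ) (k : Bool × Bool) : stdSurface g := ⟨basePoint k, basePoint_mem k⟩

theorem base_mem (k : Bool × Bool) : (base g k).1 ∈ region k := by
  obtain ⟨_ | _, _ | _⟩ := k <;> constructor <;> simp [base, basePoint, zeta, eta] <;> norm_num

theorem base_mem_false_false : ∀ {k : Bool × Bool}, k ≠ (true, true) →
    (base g k).1 ∈ region (false, false) := by
  rintro ⟨_ | _, _ | _⟩ h
  · exact base_mem _
  · constructor <;> simp [base, basePoint, zeta, eta]; norm_num
  · constructor <;> simp [base, basePoint, zeta, eta]
  · exact absurd rfl h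

theorem base_true_true_mem : (base g (true, true)).1 ∈ region (false, true) := by
  constructor <;> simp [base, basePoint, zeta, eta]

/-- Path classes from the base point of the surface to the base points of the patches. -/
def trunk (g : ℕ) : ∀ k, Path.Homotopic.Quotient (base g (false, false)) (base g k)
  | (false, false) => .refl _
  | (false, true) => patchPath (false, false) _ _ (base_mem _) (base_mem_false_false (by decide))
  | (true, false) => patchPath (false, false) _ _ (base_mem _) (base_mem_false_false (by decide))
  | (true, true) =>
    (patchPath (false, false) _ (base g (false, true)) (base_mem _)
      (base_mem_false_false (by decide))).trans
      (patchPath (false, true) _ _ (base_mem _) base_true_true_mem)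

/-- A path class from the base point to each point of a patch. -/
def frame (k : Bool × Bool) (x : stdSurface g) (hx : x.1 ∈ region k) :
    Path.Homotopic.Quotient (base g (false, false)) x :=
  (trunk g k).trans (patchPath k _ x (base_mem k) hx)

theorem frame_trans {k : Bool × Bool} {x y : stdSurface g} (hx : x.1 ∈ region k)
    (hy : y.1 ∈ region k) : (frame k x hx).trans (patchPath k x y hx hy) = frame k y hy := by
  rw [frame, Path.Homotopic.Quotient.trans_assoc, patchPath_trans, frame]

theorem frame_base (k : Bool × Bool) : frame k (base g k) (base_mem k) = trunk g k := by
  rw [frame, patchPath_self, Path.Homotopic.Quotient.trans_refl]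

theorem frame_false_false (x : stdSurface g) (hx : x.1 ∈ region (false, false)) :
    frame (false, false) x hx = patchPath (false, false) _ x (base_mem _) hx :=
  Path.Homotopic.Quotient.refl_trans _

/-- The fundamental group of the standard surface. -/
abbrev StdPi1 (g : ℕ) : Type := FundamentalGroup (stdSurface g) (base g (false, false))

/-- The loop through two patches meeting at a point. -/
def edge (k l : Bool × Bool) (x : stdSurface g) (hk : x.1 ∈ region k) (hl : x.1 ∈ region l) :
    StdPi1 g :=
  FundamentalGroup.fromPath ((frame k x hk).trans (frame l x hl).symm)

theorem edge_self {k : Bool × Bool} {x : stdSurface g} (hk : x.1 ∈ region k) :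
    edge k k x hk hk = 1 :=
  Path.Homotopic.Quotient.trans_symm _

/-- Multiplication in the fundamental group is concatenation in the opposite order, which explains
the order of the factors in this cocycle identity. -/
theorem edge_mul {k l m : Bool × Bool} {x : stdSurface g} (hk : x.1 ∈ region k)
    (hl : x.1 ∈ region l) (hm : x.1 ∈ region m) :
    edge l m x hl hm * edge k l x hk hl = edge k m x hk hm := by
  rw [FundamentalGroup.mul_def]
  simp only [edge, Path.Homotopic.Quotient.trans_assoc, symm_trans_cancel]

theorem edge_inv {k l : Bool × Bool} {x : stdSurface g} (hk : x.1 ∈ region k)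
    (hl : x.1 ∈ region l) : (edge k l x hk hl)⁻¹ = edge l k x hl hk := by
  rw [inv_eq_iff_mul_eq_one, edge_mul hl hk hl, edge_self]

open Classical in
/-- The loop through two patches meeting at a point of the ambient space, or `1`. -/
def edgeAt (g : ℕ) (k l : Bool × Bool) (p : ℝ × ℝ × ℝ) : StdPi1 g :=
  if h : p ∈ stdSurface g ∧ p ∈ region k ∧ p ∈ region l then edge k l ⟨p, h.1⟩ h.2.1 h.2.2 else 1

theorem edgeAt_eq {k l : Bool × Bool} {x : stdSurface g} (hk : x.1 ∈ region k)
    (hl : x.1 ∈ region l) : edgeAt g k l x.1 = edge k l x hk hl :=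
  dif_pos ⟨x.2, hk, hl⟩

/-- Sliding the point along a path in the overlap changes both frames by the same path class, which
cancels. -/
theorem edgeAt_congr {k l : Bool × Bool} {p q : ℝ × ℝ × ℝ}
    (h : JoinedIn (stdSurface g ∩ (region k ∩ region l)) p q) :
    edgeAt g k l p = edgeAt g k l q := by
  obtain ⟨γ, hγ⟩ := h
  let x : stdSurface g := ⟨p, by simpa using (hγ 0).1⟩
  let y : stdSurface g := ⟨q, by simpa using (hγ 1).1⟩
  let δ : Path x y :=
    { toFun := fun t => ⟨γ t, (hγ t).1⟩
      continuous_toFun := by fun_prop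
      source' := by simp [x]
      target' := by simp [y] }
  have hxk : x.1 ∈ region k := by simpa [x] using (hγ 0).2.1
  have hxl : x.1 ∈ region l := by simpa [x] using (hγ 0).2.2
  have hyk : y.1 ∈ region k := by simpa [y] using (hγ 1).2.1
  have hyl : y.1 ∈ region l := by simpa [y] using (hγ 1).2.2
  have e1 : edgeAt g k l p = edge k l x hxk hxl := edgeAt_eq hxk hxl
  have e2 : edgeAt g k l q = edge k l y hyk hyl := edgeAt_eq hyk hyl
  rw [e1, e2, edge, edge, ← frame_trans hxk hyk, ← frame_trans hxl hyl,
    patchPath_eq_mk δ fun t => (hγ t).2.1, patchPath_eq_mk δ fun t => (hγ t).2.2]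
  congr 1
  rw [symm_trans_rev, Path.Homotopic.Quotient.trans_assoc, trans_symm_cancel]

theorem edgeAt_tooth {p : ℝ × ℝ × ℝ} (hp : p ∈ stdSurface g) {a : Bool} {i : ℕ}
    (h1 : p ∈ region (a, false)) (h2 : p ∈ region (a, true)) (ht : IsTooth g i p) :
    edgeAt g (a, false) (a, true) p = edgeAt g (a, false) (a, true) (toothPoint a i) :=
  edgeAt_congr (joinedIn_toothPoint ⟨hp, h1, h2⟩ ht)

theorem edgeAt_wall {p : ℝ × ℝ × ℝ} (hp : p ∈ stdSurface g) {b : Bool} {j : ℕ}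
    (h1 : p ∈ region (false, b)) (h2 : p ∈ region (true, b)) (hw : IsWall g b j p) :
    edgeAt g (false, b) (true, b) p = edgeAt g (false, b) (true, b) (wallPoint g b j) :=
  edgeAt_congr (joinedIn_wallPoint ⟨hp, h1, h2⟩ hw)

end Frames

/-! ### The fundamental group of the standard surface -/

section Frames

variable {g : ℕ}

theorem mem_region_middle {x : ℝ} (k : Bool × Bool) : (x, 3 / 2, 1 / 2) ∈ region k := by
  obtain ⟨_ | _, _ | _⟩ := k <;> constructor <;> simp [zeta, eta] <;> norm_num

/-- A point at depth `3 / 2` and height `1 / 2` lies in all four regions, so passing from `(false,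
false)` to `(true, true)` factors through either of the other two. -/
theorem edgeAt_middle {x : ℝ} {i j : ℕ} (hi : IsTooth g i (x, 3 / 2, 1 / 2))
    (hj : ∀ b, IsWall g b j (x, 3 / 2, 1 / 2)) :
    edgeAt g (true, false) (true, true) (toothPoint true i) *
      edgeAt g (false, false) (true, false) (wallPoint g false j) =
    edgeAt g (false, true) (true, true) (wallPoint g true j) *
      edgeAt g (false, false) (false, true) (toothPoint false i) := by
  have hp : (x, 3 / 2, 1 / 2) ∈ stdSurface g := by
    refine ⟨hi.mem_stdHandlebody ⟨by norm_num, by norm_num⟩ ⟨by norm_num, by norm_num⟩, ?_⟩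
    rcases hj false with ⟨hj, h⟩ | ⟨-, h | h⟩
    · exact Or.inr (Or.inr (Or.inr (Or.inr (Or.inr ⟨j, hj, h⟩))))
    · exact Or.inr (Or.inr (Or.inl h))
    · exact Or.inr (Or.inr (Or.inr (Or.inr (Or.inl h))))
  let w : stdSurface g := ⟨_, hp⟩
  have hm : ∀ k, w.1 ∈ region k := mem_region_middle
  rw [← edgeAt_tooth hp (hm _) (hm _) hi, ← edgeAt_tooth hp (hm _) (hm _) hi,
    ← edgeAt_wall hp (hm _) (hm _) (hj _), ← edgeAt_wall hp (hm _) (hm _) (hj _)]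
  have e : ∀ k l, edgeAt g k l (x, 3 / 2, 1 / 2) = edge k l w (hm k) (hm l) := fun k l =>
    edgeAt_eq (x := w) _ _
  rw [e, e, e, e, edge_mul, edge_mul]

theorem edgeAt_middle_left {i : ℕ} (hi : i ≤ g) :
    edgeAt g (true, false) (true, true) (toothPoint true i) *
      edgeAt g (false, false) (true, false) (wallPoint g false i) =
    edgeAt g (false, true) (true, true) (wallPoint g true i) *
      edgeAt g (false, false) (false, true) (toothPoint false i) := by
  refine edgeAt_middle (x := 2 * (i : ℝ) + 1) ⟨hi, by simp⟩ fun b => ?_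
  rcases hi.eq_or_lt with rfl | hi
  · exact Or.inr ⟨rfl, Or.inr rfl⟩
  · exact Or.inl ⟨hi, by simp, by norm_num, by norm_num⟩

theorem edgeAt_middle_right {i : ℕ} (hi : i < g) :
    edgeAt g (true, false) (true, true) (toothPoint true (i + 1)) *
      edgeAt g (false, false) (true, false) (wallPoint g false i) =
    edgeAt g (false, true) (true, true) (wallPoint g true i) *
      edgeAt g (false, false) (false, true) (toothPoint false (i + 1)) := by
  refine edgeAt_middle (x := 2 * (i : ℝ) + 2) ⟨hi, ?_, ?_⟩ fun b =>
    Or.inl ⟨hi, by simp, by norm_num, by norm_num⟩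
  · push_cast; linarith
  · push_cast; linarith

/-- The trunk acts as a maximal tree: it was built by crossing at these points, so these loops are
trivial. With `edgeAt_base_true` this yields the normalisations of the data. -/
theorem edgeAt_base {l : Bool × Bool} (hl : l ≠ (true, true)) :
    edgeAt g (false, false) l (base g l).1 = 1 := by
  rw [edgeAt_eq (base_mem_false_false hl) (base_mem l), edge, frame_base, frame_false_false]
  obtain ⟨_ | _, _ | _⟩ := l
  · rw [patchPath_self]
    exact Path.Homotopic.Quotient.trans_symm _
  · exact Path.Homotopic.Quotient.trans_symm _
  · exact Path.Homotopic.Quotient.trans_symm _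
  · exact absurd rfl hl

theorem edgeAt_base_true : edgeAt g (false, true) (true, true) (base g (true, true)).1 = 1 := by
  rw [edgeAt_eq base_true_true_mem (base_mem _), edge, frame_base]
  exact Path.Homotopic.Quotient.trans_symm _

/-- The classes in the fundamental group attached to teeth and walls. -/
def stdData (g : ℕ) : HandleData g (StdPi1 g) where
  s i := edgeAt g (false, false) (false, true) (toothPoint false i)
  u j := edgeAt g (false, false) (true, false) (wallPoint g false j)
  v j := edgeAt g (false, true) (true, true) (wallPoint g true j)
  s_zero := by
    have h : toothPoint false 0 = (base g (false, true)).1 := by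
      simp [toothPoint, base, basePoint, zeta]
    rw [h, edgeAt_base (by decide)]
  u_last := by
    have h : wallPoint g false g = (base g (true, false)).1 := by
      simp [wallPoint, base, basePoint, eta]
    rw [h, edgeAt_base (by decide)]
  v_last := by
    have h : wallPoint g true g = (base g (true, true)).1 := by
      simp [wallPoint, base, basePoint, eta]
    rw [h, edgeAt_base_true]
  rel i hi := by
    rw [← edgeAt_middle_left (Nat.succ_le_of_lt hi), mul_inv_cancel_right,
      ← edgeAt_middle_right hi, mul_inv_cancel_right]

theorem stdData_side {a : Bool} {i : ℕ} (hi : i ≤ g) : (stdData g).side a i =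
    edgeAt g (a, false) (a, true) (toothPoint a i) := by
  cases a
  · rfl
  · change edgeAt g _ _ _ * edgeAt g _ _ _ * (edgeAt g _ _ _)⁻¹ = _
    rw [← edgeAt_middle_left hi, mul_inv_cancel_right]

theorem stdData_wall (b : Bool) (j : ℕ) : (stdData g).wall b j =
    edgeAt g (false, b) (true, b) (wallPoint g b j) := by
  cases b <;> rfl

namespace HandleData

variable {G : Type*} [Group G] {d : HandleData g G} {ψ : G →* StdPi1 g}

theorem map_value (hs : ∀ i ≤ g, ψ (d.s i) = (stdData g).s i)
    (hu : ∀ j ≤ g, ψ (d.u j) = (stdData g).u j) (hv : ∀ j ≤ g, ψ (d.v j) = (stdData g).v j)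
    {x : stdSurface g} {k l : Bool × Bool} (hk : x.1 ∈ region k) (hl : x.1 ∈ region l) :
    ψ ((d.value l x.1)⁻¹ * d.value k x.1) = edge k l x hk hl := by
  rw [← edgeAt_eq hk hl]
  refine region_induction (r := fun k l => ψ ((d.value l x.1)⁻¹ * d.value k x.1) =
    edgeAt g k l x.1) ?_ ?_ ?_ ?_ ?_ hk hl
  · intro k hk
    rw [edgeAt_eq hk hk, edge_self, inv_mul_cancel, map_one]
  · intro k l hk hl h
    rw [edgeAt_eq hl hk, ← edge_inv hk hl, ← edgeAt_eq, ← h, ← map_inv, mul_inv_rev, inv_inv]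
  · intro k l m hk hl hm h1 h2
    rw [edgeAt_eq hk hm, ← edge_mul hk hl hm, ← edgeAt_eq, ← edgeAt_eq, ← h1, ← h2, ← map_mul]
    congr 1
    group
  · intro a h1 h2
    obtain ⟨i, hi⟩ := exists_isTooth x.2.1 (mem_region_false_true h1 h2).1
      (mem_region_false_true h1 h2).2
    rw [d.value_tooth x.2 h1 h2 hi, edgeAt_tooth x.2 h1 h2 hi, ← stdData_side hi.1]
    cases a
    · exact hs i hi.1
    · simp only [side, if_true, map_mul, map_inv, hs i hi.1, hu i hi.1, hv i hi.1]
  · intro b h1 h2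
    obtain ⟨j, hj⟩ := exists_isWall x.2 (mem_region_height h1 h2).1 (mem_region_height h1 h2).2 h1.2
    have hjg : j ≤ g := by
      rcases hj with hj | hj
      · exact hj.1.le
      · exact hj.1.le
    rw [d.value_wall h1 h2 hj, edgeAt_wall x.2 h1 h2 hj, ← stdData_wall]
    cases b
    · exact hu j hjg
    · exact hv j hjg

/-- Path induction. For a path in one patch both sides are a product of two transitions, compared by
`map_value`; a concatenation inserts an intermediate frame, which cancels. On loops this makes `ψ` a
left inverse of holonomy. -/
theorem map_hol (hs : ∀ i ≤ g, ψ (d.s i) = (stdData g).s i)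
    (hu : ∀ j ≤ g, ψ (d.u j) = (stdData g).u j) (hv : ∀ j ≤ g, ψ (d.v j) = (stdData g).v j)
    {x y : stdSurface g} (γ : Path.Homotopic.Quotient x y) :
    ∀ (k l : Bool × Bool) (hk : x.1 ∈ region k) (hl : y.1 ∈ region l),
      ψ ((d.value l y.1)⁻¹ * d.cocycle.hol γ * d.value k x.1) =
        FundamentalGroup.fromPath (((frame k x hk).trans γ).trans (frame l y hl).symm) := by
  refine path_induction (U := d.cocycle.U) (p := fun {x y} γ =>
    ∀ (k l : Bool × Bool) (hk : x.1 ∈ region k) (hl : y.1 ∈ region l),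
      ψ ((d.value l y.1)⁻¹ * d.cocycle.hol γ * d.value k x.1) =
        FundamentalGroup.fromPath (((frame k x hk).trans γ).trans (frame l y hl).symm))
    d.cocycle.isOpen_U d.cocycle.cover ?_ ?_ γ
  · intro x y γ m hγ k l hk hl
    have hx : x.1 ∈ region m := by have := hγ 0; rwa [γ.source] at this
    have hy : y.1 ∈ region m := by have := hγ 1; rwa [γ.target] at this
    rw [d.cocycle.hol_mk γ m hγ]
    change ψ ((d.value l y.1)⁻¹ * (d.value m y.1 * (d.value m x.1)⁻¹) * d.value k x.1) = _
    have e : (d.value l y.1)⁻¹ * (d.value m y.1 * (d.value m x.1)⁻¹) * d.value k x.1 =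
      ((d.value l y.1)⁻¹ * d.value m y.1) * ((d.value m x.1)⁻¹ * d.value k x.1) := by group
    rw [e, map_mul, map_value hs hu hv hy hl, map_value hs hu hv hk hx,
      FundamentalGroup.mul_def]
    simp only [edge]
    rw [← frame_trans hx hy, patchPath_eq_mk γ hγ]
    simp only [Path.Homotopic.Quotient.trans_assoc, symm_trans_cancel]
  · intro x y z γ γ' h1 h2 k l hk hl
    obtain ⟨m, hm⟩ := exists_mem_region y.1
    have e : (d.value l z.1)⁻¹ * d.cocycle.hol (γ.trans γ') * d.value k x.1 =
        ((d.value l z.1)⁻¹ * d.cocycle.hol γ' * d.value m y.1) *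
          ((d.value m y.1)⁻¹ * d.cocycle.hol γ * d.value k x.1) := by
      rw [Cocycle.hol_trans]; group
    rw [e, map_mul, h1 k m hk hm, h2 m l hm hl, FundamentalGroup.mul_def]
    simp only [Path.Homotopic.Quotient.trans_assoc, symm_trans_cancel]

theorem value_false_false (p : ℝ × ℝ × ℝ) : d.value (false, false) p = 1 := by
  simp [value]

theorem map_holHom (hs : ∀ i ≤ g, ψ (d.s i) = (stdData g).s i)
    (hu : ∀ j ≤ g, ψ (d.u j) = (stdData g).u j) (hv : ∀ j ≤ g, ψ (d.v j) = (stdData g).v j)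
    (γ : StdPi1 g) : ψ (d.cocycle.holHom _ γ) = γ := by
  have := map_hol hs hu hv γ.toPath (false, false) (false, false) (base_mem _) (base_mem _)
  rw [value_false_false, frame_base] at this
  simp only [inv_one, one_mul, mul_one] at this
  refine this.trans ?_
  change ((Path.Homotopic.Quotient.refl _).trans γ.toPath).trans
    (Path.Homotopic.Quotient.refl _).symm = γ
  rw [Path.Homotopic.Quotient.refl_trans]
  exact Path.Homotopic.Quotient.trans_refl _

variable (d)

theorem value_base (k : Bool × Bool) : d.value k (base g k).1 = 1 := by
  obtain ⟨_ | _, _ | _⟩ := k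
  · exact d.value_false_false _
  · have h : IsTooth g 0 (base g (false, true)).1 := ⟨Nat.zero_le _, by simp [base, basePoint]⟩
    simp [value, epsilon_isTooth h, d.s_zero]
  · have h : IsWall g false g (base g (true, false)).1 :=
      Or.inr ⟨rfl, Or.inl (by simp [base, basePoint, eta])⟩
    simp [value, epsilon_isWall h, wall, d.u_last]
  · have h : IsWall g true g (base g (true, true)).1 :=
      Or.inr ⟨rfl, Or.inl (by simp [base, basePoint, eta])⟩
    have hy : ¬ (base g (true, true)).1.2.1 < 8 / 5 := by simp [base, basePoint]; norm_num
    simp [value, epsilon_isWall h, wall, d.v_last, hy]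

theorem value_base_true : d.value (false, true) (base g (true, true)).1 = 1 := by
  have hy : ¬ (base g (true, true)).1.2.1 < 8 / 5 := by simp [base, basePoint]; norm_num
  simp [value, hy]

theorem hol_patchPath {k : Bool × Bool} {x y : stdSurface g} (hx : x.1 ∈ region k)
    (hy : y.1 ∈ region k) :
    d.cocycle.hol (patchPath k x y hx hy) = d.value k y.1 * (d.value k x.1)⁻¹ := by
  rw [patchPath, ← Path.Homotopic.Quotient.mk_map]
  exact d.cocycle.hol_mk _ k fun t => ((PathConnectedSpace.somePath
    (⟨x.1, x.2, hx⟩ : patch g k) ⟨y.1, y.2, hy⟩) t).2.2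

/-- The normalised data have value `1` at the points where the trunk passes between patches, so the
trunk has trivial holonomy. -/
theorem hol_frame {k : Bool × Bool} {x : stdSurface g} (hx : x.1 ∈ region k) :
    d.cocycle.hol (frame k x hx) = d.value k x.1 := by
  have ht : d.cocycle.hol (trunk g k) = 1 := by
    obtain ⟨_ | _, _ | _⟩ := k
    · exact d.cocycle.hol_refl _
    · rw [trunk, hol_patchPath, value_false_false, value_false_false, inv_one, mul_one]
    · rw [trunk, hol_patchPath, value_false_false, value_false_false, inv_one, mul_one]
    · rw [trunk, Cocycle.hol_trans, hol_patchPath, hol_patchPath, value_false_false,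
        value_false_false, value_base_true, value_base]
      simp
  rw [frame, Cocycle.hol_trans, ht, hol_patchPath, value_base, inv_one, mul_one,
    mul_one]

theorem holHom_edge {k l : Bool × Bool} {x : stdSurface g} (hk : x.1 ∈ region k)
    (hl : x.1 ∈ region l) :
    d.cocycle.holHom _ (edge k l x hk hl) = (d.value l x.1)⁻¹ * d.value k x.1 := by
  change d.cocycle.hol ((frame k x hk).trans (frame l x hl).symm) = _
  rw [Cocycle.hol_trans, Cocycle.hol_symm, hol_frame, hol_frame]

end HandleData

end Frames

/-! ### Universal handle data and freeness of the fundamental group -/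

section FreeData

/-- The product of a finite descending segment of a sequence. -/
def descProd {G : Type*} [Group G] (c : ℕ → G) (g j : ℕ) : G :=
  ((List.range' j (g - j)).reverse.map c).prod

theorem descProd_of_le {G : Type*} [Group G] (c : ℕ → G) {g j : ℕ} (h : g ≤ j) :
    descProd c g j = 1 := by
  simp [descProd, Nat.sub_eq_zero_of_le h]

theorem descProd_succ {G : Type*} [Group G] (c : ℕ → G) {g j : ℕ} (h : j < g) :
    descProd c g j = descProd c g (j + 1) * c j := by
  obtain ⟨n, rfl⟩ : ∃ n, g = j + 1 + n := ⟨g - (j + 1), by omega⟩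
  have h1 : j + 1 + n - j = n + 1 := by omega
  have h2 : j + 1 + n - (j + 1) = n := by omega
  rw [descProd, descProd, h1, h2, List.range'_succ]
  simp

/-- A downward recursion determines a sequence. -/
theorem eq_of_descending {G : Type*} [Group G] {x y c : ℕ → G} {g : ℕ} (h0 : x g = y g)
    (hx : ∀ i < g, x i = x (i + 1) * c i) (hy : ∀ i < g, y i = y (i + 1) * c i) :
    ∀ i ≤ g, x i = y i := by
  have : ∀ n i, i + n = g → x i = y i := by
    intro n
    induction n with
    | zero => rintro i rfl; exact h0
    | succ n ih =>
      intro i hi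
      rw [hx i (by omega), hy i (by omega), ih (i + 1) (by omega)]
  exact fun i hi => this (g - i) i (by omega)

variable (g : ℕ)

/-- The first family of generators. -/
def genS : ℕ → FreeGroup (Fin g ⊕ Fin g)
  | 0 => 1
  | n + 1 => if h : n < g then FreeGroup.of (Sum.inl ⟨n, h⟩) else 1

/-- The second family of generators. -/
def genB (n : ℕ) : FreeGroup (Fin g ⊕ Fin g) :=
  if h : n < g then FreeGroup.of (Sum.inr ⟨n, h⟩) else 1

/-- The universal data on the standard surface. -/
def freeData : HandleData g (FreeGroup (Fin g ⊕ Fin g)) where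
  -- Given `u i = u (i + 1) * B`, the relation at tooth `i + 1` solves as `v i = v (i + 1) * (s * B
  -- * s⁻¹)` with `s = s (i + 1)`. So the data are freely parametrised by the `s (i + 1)` and the
  -- `B`'s; the shift of index reflects `s 0 = 1`.
  s := genS g
  u := descProd (genB g) g
  v := descProd (fun n => genS g (n + 1) * genB g n * (genS g (n + 1))⁻¹) g
  s_zero := rfl
  u_last := descProd_of_le _ le_rfl
  v_last := descProd_of_le _ le_rfl
  rel i hi := by
    rw [descProd_succ _ hi, descProd_succ _ hi]
    group

theorem descProd_zero_eq {G : Type*} [Group G] {c : ℕ → G} {d : Fin g → G}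
    (h : ∀ i : Fin g, c i = d i) : descProd c g 0 = ((List.finRange g).reverse.map d).prod := by
  have : (List.finRange g).map d = (List.range g).map c := by
    rw [← List.map_coe_finRange_eq_range, List.map_map]
    exact List.map_congr_left fun i _ => (h i).symm
  rw [descProd, List.map_reverse, List.map_reverse, this, Nat.sub_zero, List.range_eq_range']

variable {g}

/-- The inverse of the holonomy isomorphism. -/
def holInv (g : ℕ) : FreeGroup (Fin g ⊕ Fin g) →* StdPi1 g :=
  FreeGroup.lift (Sum.elim (fun i => (stdData g).s (i + 1))
    (fun i => ((stdData g).u (i + 1))⁻¹ * (stdData g).u i))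

theorem holInv_s {i : ℕ} (hi : i ≤ g) : holInv g ((freeData g).s i) = (stdData g).s i := by
  cases i with
  | zero => rw [HandleData.s_zero, HandleData.s_zero, map_one]
  | succ n =>
    have hn : n < g := hi
    simp [freeData, genS, hn, holInv]

theorem holInv_genB {n : ℕ} (hn : n < g) : holInv g (genB g n) =
    ((stdData g).u (n + 1))⁻¹ * (stdData g).u n := by
  simp [genB, hn, holInv]

theorem holInv_u : ∀ j ≤ g, holInv g ((freeData g).u j) = (stdData g).u j := by
  refine eq_of_descending (c := fun i => holInv g (genB g i)) ?_ ?_ ?_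
  · rw [HandleData.u_last, HandleData.u_last, map_one]
  · intro i hi
    rw [← map_mul]
    exact congrArg _ (descProd_succ _ hi)
  · intro i hi
    rw [holInv_genB hi, mul_inv_cancel_left]

theorem holInv_v : ∀ j ≤ g, holInv g ((freeData g).v j) = (stdData g).v j := by
  refine eq_of_descending (c := fun n =>
    holInv g (genS g (n + 1) * genB g n * (genS g (n + 1))⁻¹)) ?_ ?_ ?_
  · rw [HandleData.v_last, HandleData.v_last, map_one]
  · intro i hi
    rw [← map_mul]
    exact congrArg _ (descProd_succ _ hi)
  · intro i hi
    have hs : holInv g (genS g (i + 1)) = (stdData g).s (i + 1) := holInv_s hi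
    have := (stdData g).rel i hi
    rw [map_mul, map_mul, map_inv, holInv_genB hi, hs, ← mul_assoc, ← mul_assoc, ← mul_assoc, this]
    group

theorem isTooth_middle {i : ℕ} (hi : i ≤ g) : IsTooth g i (2 * (i : ℝ) + 1, 3 / 2, 1 / 2) :=
  ⟨hi, by simp⟩

theorem isWall_middle {i : ℕ} (hi : i ≤ g) (b : Bool) :
    IsWall g b i (2 * (i : ℝ) + 1, 3 / 2, 1 / 2) := by
  rcases hi.eq_or_lt with rfl | hi
  · exact Or.inr ⟨rfl, Or.inr rfl⟩
  · exact Or.inl ⟨hi, by simp, by norm_num, by norm_num⟩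

theorem middle_mem {i : ℕ} (hi : i ≤ g) : (2 * (i : ℝ) + 1, 3 / 2, 1 / 2) ∈ stdSurface g := by
  refine ⟨(isTooth_middle hi).mem_stdHandlebody ⟨by norm_num, by norm_num⟩
    ⟨by norm_num, by norm_num⟩, ?_⟩
  rcases isWall_middle hi false with ⟨hj, h⟩ | ⟨-, h | h⟩
  · exact Or.inr (Or.inr (Or.inr (Or.inr (Or.inr ⟨i, hj, h⟩))))
  · exact Or.inr (Or.inr (Or.inl h))
  · exact Or.inr (Or.inr (Or.inr (Or.inr (Or.inl h))))

/-- A point on the right of each strip between two holes, in all four regions. -/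
def middle (i : ℕ) (hi : i ≤ g) : stdSurface g := ⟨_, middle_mem hi⟩

theorem middle_mem_region (i : ℕ) (hi : i ≤ g) (k : Bool × Bool) : (middle i hi).1 ∈ region k :=
  mem_region_middle k

theorem stdData_s {i : ℕ} (hi : i ≤ g) : (stdData g).s i = edge (false, false) (false, true)
    (middle i hi) (middle_mem_region i hi _) (middle_mem_region i hi _) := by
  rw [← edgeAt_eq, edgeAt_tooth (middle i hi).2 (middle_mem_region i hi _)
    (middle_mem_region i hi _) (isTooth_middle hi)]
  rfl

theorem stdData_u {i : ℕ} (hi : i ≤ g) : (stdData g).u i = edge (false, false) (true, false)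
    (middle i hi) (middle_mem_region i hi _) (middle_mem_region i hi _) := by
  rw [← edgeAt_eq, edgeAt_wall (middle i hi).2 (middle_mem_region i hi _)
    (middle_mem_region i hi _) (isWall_middle hi _)]
  rfl

theorem holHom_stdData_s {i : ℕ} (hi : i ≤ g) :
    (freeData g).cocycle.holHom _ ((stdData g).s i) = (freeData g).s i := by
  rw [stdData_s hi, HandleData.holHom_edge, (freeData g).value_tooth (middle i hi).2
    (middle_mem_region i hi _) (middle_mem_region i hi _) (isTooth_middle hi)]
  rfl

theorem holHom_stdData_u {i : ℕ} (hi : i ≤ g) :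
    (freeData g).cocycle.holHom _ ((stdData g).u i) = (freeData g).u i := by
  rw [stdData_u hi, HandleData.holHom_edge, (freeData g).value_wall
    (middle_mem_region i hi _) (middle_mem_region i hi _) (isWall_middle hi _)]
  rfl

/-- The fundamental group of the standard surface is free. -/
def holEquiv (g : ℕ) : StdPi1 g ≃* FreeGroup (Fin g ⊕ Fin g) :=
  MonoidHom.toMulEquiv ((freeData g).cocycle.holHom _) (holInv g)
    (MonoidHom.ext fun γ => HandleData.map_holHom (fun _ hi => holInv_s hi) holInv_u holInv_v γ)
    (by
      ext z
      rcases z with i | i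
      · have := holHom_stdData_s (g := g) (i := i + 1) i.2
        simpa [holInv, freeData, genS] using this
      · have h1 := holHom_stdData_u (g := g) (i := i + 1) i.2
        have h2 := holHom_stdData_u (g := g) (i := i) i.2.le
        have h3 : (freeData g).u i = (freeData g).u (i + 1) * genB g i := descProd_succ _ i.2
        simp only [holInv, MonoidHom.comp_apply, FreeGroup.lift_apply_of, Sum.elim_inr, map_mul,
          map_inv, h1, h2, h3, inv_mul_cancel_left, MonoidHom.id_apply]
        simp [genB])

theorem holEquiv_apply (γ : StdPi1 g) :
    holEquiv g γ = (freeData g).cocycle.hol γ.toPath := rfl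

theorem holEquiv_symm_inr (i : Fin g) : (holEquiv g).symm (FreeGroup.of (Sum.inr i)) =
    ((stdData g).u (i + 1))⁻¹ * (stdData g).u i := by
  simp [holEquiv, holInv]

/-! ### The kernel of the map to the handlebody -/

/-- The inclusion of the standard surface in the standard handlebody. -/
def stdIncl (g : ℕ) : C(stdSurface g, stdHandlebody g) :=
  ⟨Set.inclusion fun _ hp => hp.1, continuous_inclusion _⟩

/-- The projection killing the second family of generators. -/
def killB (g : ℕ) : FreeGroup (Fin g ⊕ Fin g) →* FreeGroup (Fin g) :=
  FreeGroup.lift (Sum.elim FreeGroup.of fun _ => 1)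

theorem killB_genB (n : ℕ) : killB g (genB g n) = 1 := by
  by_cases h : n < g <;> simp [genB, killB, h]

theorem killB_descProd {c : ℕ → FreeGroup (Fin g ⊕ Fin g)} (hc : ∀ n, killB g (c n) = 1) (j : ℕ) :
    killB g (descProd c g j) = 1 := by
  rw [descProd, map_list_prod, List.map_map]
  refine List.prod_eq_one fun x hx => ?_
  obtain ⟨n, -, rfl⟩ := List.mem_map.1 hx
  exact hc n

theorem killB_u (j : ℕ) : killB g ((freeData g).u j) = 1 := killB_descProd killB_genB j

theorem killB_v (j : ℕ) : killB g ((freeData g).v j) = 1 :=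
  killB_descProd (fun n => by simp [killB_genB]) j

/-- Walls carry only products of conjugates of the `B`'s. Killing these merges the top and bottom
frames into the frame of a solid half. -/
theorem killB_value (k : Bool × Bool) (p : ℝ × ℝ × ℝ) : killB g ((freeData g).value k p) =
    solidValue (fun i => killB g ((freeData g).s i)) g k.2 p := by
  obtain ⟨a, b⟩ := k
  by_cases hz : 0 < p.2.2 <;> by_cases hy : p.2.1 < 8 / 5 <;> cases a <;> cases b <;>
    simp [HandleData.value, solidValue, hz, hy, HandleData.wall, HandleData.side, killB_u, killB_v]

/-- Consequently the projected holonomy depends only on the path class in the handlebody. -/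
theorem killB_hol {x y : stdSurface g} (γ : Path.Homotopic.Quotient x y) :
    killB g ((freeData g).cocycle.hol γ) =
      (solidCocycle (g := g) fun i => killB g ((freeData g).s i)).hol (γ.map (stdIncl g)) := by
  refine path_induction (U := (freeData g).cocycle.U) (p := fun {x y} γ =>
    killB g ((freeData g).cocycle.hol γ) =
      (solidCocycle (g := g) fun i => killB g ((freeData g).s i)).hol (γ.map (stdIncl g)))
    (freeData g).cocycle.isOpen_U (freeData g).cocycle.cover ?_ ?_ γ
  · intro x y γ k hγ
    rw [Cocycle.hol_mk _ γ k hγ, ← Path.Homotopic.Quotient.mk_map,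
      Cocycle.hol_mk _ _ k.2 fun t => (hγ t).2, map_mul, map_inv]
    exact congrArg₂ (fun a b => a * b⁻¹) (killB_value k y.1) (killB_value k x.1)
  · intro x y z γ γ' h1 h2
    rw [Cocycle.hol_trans, quotient_map_trans, Cocycle.hol_trans, map_mul, h1, h2]

end FreeData

section Kernel

variable {g : ℕ}

/-- The inclusion of the lower half of the handlebody. -/
def lowerIncl (g : ℕ) : C(lowerHalf g, stdHandlebody g) :=
  ⟨Set.inclusion fun _ hp => hp.1, continuous_inclusion _⟩

/-- The unique class of paths in the lower half of the handlebody between points of the surface. -/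
def lowerPath (x y : stdSurface g) (hx : x.1.2.1 < 8 / 5) (hy : y.1.2.1 < 8 / 5) :
    Path.Homotopic.Quotient (stdIncl g x) (stdIncl g y) :=
  (Path.Homotopic.Quotient.mk (PathConnectedSpace.somePath (⟨x.1, x.2.1, hx⟩ : lowerHalf g)
    ⟨y.1, y.2.1, hy⟩)).map (lowerIncl g)

theorem lowerPath_eq_map {x y : stdSurface g} (hx : x.1.2.1 < 8 / 5) (hy : y.1.2.1 < 8 / 5)
    (γ : Path.Homotopic.Quotient (⟨x.1, x.2.1, hx⟩ : lowerHalf g) ⟨y.1, y.2.1, hy⟩) :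
    lowerPath x y hx hy = γ.map (lowerIncl g) :=
  congrArg (Path.Homotopic.Quotient.map · (lowerIncl g)) (Subsingleton.elim _ _)

theorem lowerPath_trans {x y z : stdSurface g} (hx : x.1.2.1 < 8 / 5) (hy : y.1.2.1 < 8 / 5)
    (hz : z.1.2.1 < 8 / 5) :
    (lowerPath x y hx hy).trans (lowerPath y z hy hz) = lowerPath x z hx hz := by
  rw [lowerPath_eq_map hx hz ((Path.Homotopic.Quotient.mk (PathConnectedSpace.somePath _
    (⟨y.1, y.2.1, hy⟩ : lowerHalf g))).trans (.mk (PathConnectedSpace.somePath _ _)))]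
  exact (quotient_map_trans _ _ (lowerIncl g)).symm

theorem lower_of_mem_region {a : Bool} {p : ℝ × ℝ × ℝ} (h : p ∈ region (a, false)) :
    p.2.1 < 8 / 5 := h.2

theorem patchPath_map_stdIncl {a : Bool} {x y : stdSurface g} (hx : x.1 ∈ region (a, false))
    (hy : y.1 ∈ region (a, false)) : (patchPath (a, false) x y hx hy).map (stdIncl g) =
      lowerPath x y (lower_of_mem_region hx) (lower_of_mem_region hy) := by
  let j : C(patch g (a, false), lowerHalf g) :=
    ⟨Set.inclusion fun p hp => ⟨hp.1.1, hp.2.2⟩, continuous_inclusion _⟩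
  rw [lowerPath_eq_map _ _ ((Path.Homotopic.Quotient.mk (PathConnectedSpace.somePath
    (⟨x.1, x.2, hx⟩ : patch g (a, false)) ⟨y.1, y.2, hy⟩)).map j)]
  rfl

theorem frame_map_stdIncl {a : Bool} {x : stdSurface g} (hx : x.1 ∈ region (a, false)) :
    (frame (a, false) x hx).map (stdIncl g) = lowerPath (base g (false, false)) x
      (lower_of_mem_region (base_mem (false, false))) (lower_of_mem_region hx) := by
  cases a
  · rw [frame_false_false, patchPath_map_stdIncl]
  · rw [frame, quotient_map_trans, patchPath_map_stdIncl, trunk, patchPath_map_stdIncl,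
      lowerPath_trans]

/-- The kernel of the projection of the fundamental group killing the second family of
generators. -/
def stdKer (g : ℕ) : Subgroup (StdPi1 g) := ((killB g).comp (holEquiv g).toMonoidHom).ker

theorem mem_stdKer {x : StdPi1 g} : x ∈ stdKer g ↔ killB g (holEquiv g x) = 1 := Iff.rfl

theorem isSplitPair_std (g : ℕ) : IsSplitPair (stdKer g)
    (fun i => (holEquiv g).symm (FreeGroup.of (Sum.inl i)))
    (fun i => (holEquiv g).symm (FreeGroup.of (Sum.inr i)))
    ((holEquiv g).trans (splitEquiv (Fin g))) where
  mem_iff x := by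
    rw [splitKer, SemidirectProduct.range_inl_eq_ker_rightHom, MonoidHom.mem_ker, mem_stdKer,
      killB, ← rightHom_comp_splitEquiv]
    rfl
  apply_S i := by rw [MulEquiv.trans_apply, MulEquiv.apply_symm_apply, splitEquiv_inl]
  apply_B i := by rw [MulEquiv.trans_apply, MulEquiv.apply_symm_apply, splitEquiv_inr]

/-- This loop runs through the two lower patches only, hence inside the contractible lower half of
the handlebody. -/
theorem stdData_u_mem_ker {i : ℕ} (hi : i ≤ g) :
    (stdData g).u i ∈ (FundamentalGroup.map (stdIncl g) (base g (false, false))).ker := by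
  rw [stdData_u hi, MonoidHom.mem_ker]
  change ((frame (false, false) (middle i hi) (middle_mem_region i hi _)).trans
    (frame (true, false) (middle i hi) (middle_mem_region i hi _)).symm).map (stdIncl g) = _
  rw [quotient_map_trans, quotient_map_symm, frame_map_stdIncl, frame_map_stdIncl]
  exact Path.Homotopic.Quotient.trans_symm _

/-- One inclusion holds because the normal generators `(u (i + 1))⁻¹ * u i` bound in the handlebody,
the other because the projection factors through holonomy in the handlebody. -/
theorem stdKer_eq (g : ℕ) :
    stdKer g = (FundamentalGroup.map (stdIncl g) (base g (false, false))).ker := by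
  apply le_antisymm
  · refine (isSplitPair_std g).conj_closure.trans ((Subgroup.closure_le _).2 ?_)
    rintro _ ⟨⟨x, i⟩, rfl⟩
    refine Subgroup.Normal.conj_mem inferInstance _ ?_ _
    rw [holEquiv_symm_inr]
    exact mul_mem (inv_mem (stdData_u_mem_ker i.2)) (stdData_u_mem_ker i.2.le)
  · intro x hx
    rw [mem_stdKer, holEquiv_apply, killB_hol]
    have : x.toPath.map (stdIncl g) = .refl _ := hx
    rw [this, Cocycle.hol_refl]

end Kernel

/-! ### Paths in the boundary of the disk -/

section Boundary

/-- A path class represented by a path in a given set. -/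
def InSet {X : Type*} [TopologicalSpace X] (D : Set X) {x y : X}
    (c : Path.Homotopic.Quotient x y) : Prop :=
  ∃ γ : Path x y, .mk γ = c ∧ ∀ t, γ t ∈ D

theorem InSet.trans {X : Type*} [TopologicalSpace X] {D : Set X} {x y z : X}
    {c : Path.Homotopic.Quotient x y} {c' : Path.Homotopic.Quotient y z} (h : InSet D c)
    (h' : InSet D c') : InSet D (c.trans c') := by
  obtain ⟨γ, rfl, hγ⟩ := h
  obtain ⟨γ', rfl, hγ'⟩ := h'
  refine ⟨γ.trans γ', Path.Homotopic.Quotient.mk_trans _ _, fun t => ?_⟩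
  have := Set.mem_range_self (f := γ.trans γ') t
  rw [Path.trans_range] at this
  rcases this with ⟨s, hs⟩ | ⟨s, hs⟩
  · rw [← hs]; exact hγ s
  · rw [← hs]; exact hγ' s

theorem InSet.symm {X : Type*} [TopologicalSpace X] {D : Set X} {x y : X}
    {c : Path.Homotopic.Quotient x y} (h : InSet D c) : InSet D c.symm := by
  obtain ⟨γ, rfl, hγ⟩ := h
  exact ⟨γ.symm, Path.Homotopic.Quotient.mk_symm _, fun t => hγ _⟩

theorem InSet.map {X Y : Type*} [TopologicalSpace X] [TopologicalSpace Y] {D : Set X} {E : Set Y}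
    {x y : X} {c : Path.Homotopic.Quotient x y} (h : InSet D c) (f : C(X, Y))
    (hf : ∀ x ∈ D, f x ∈ E) : InSet E (c.map f) := by
  obtain ⟨γ, rfl, hγ⟩ := h
  exact ⟨γ.map f.continuous, Path.Homotopic.Quotient.mk_map _ _, fun t => hf _ (hγ t)⟩

variable {g : ℕ}

/-- The boundary of the disk in the standard surface. -/
def stdEdge (g : ℕ) : Set (stdSurface g) := {p | p.1.1 = 0}

theorem mem_stdSurface_zero {y z : ℝ} (hy : 0 ≤ y ∧ y ≤ 3) (hz : 0 ≤ z ∧ z ≤ 1)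
    (h : z = 0 ∨ z = 1 ∨ y = 0 ∨ y = 3) : (0, y, z) ∈ stdSurface g := by
  refine mem_stdSurface_iff.2 ⟨mem_stdHandlebody_iff.2 ⟨⟨le_rfl, by positivity⟩, hy, hz,
    fun i _ h5 _ _ => ?_⟩, by tauto⟩
  have : (0 : ℝ) ≤ i := i.cast_nonneg
  linarith

theorem of_mem_stdSurface_zero {y z : ℝ} (h : (0, y, z) ∈ stdSurface g) :
    (0 ≤ y ∧ y ≤ 3) ∧ (0 ≤ z ∧ z ≤ 1) ∧ (z = 0 ∨ z = 1 ∨ y = 0 ∨ y = 3) := by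
  rw [mem_stdSurface_iff, mem_stdHandlebody_iff] at h
  refine ⟨h.1.2.1, h.1.2.2.1, ?_⟩
  rcases h.2 with h | h | h | h | h | ⟨i, -, h, -⟩
  · tauto
  · tauto
  · tauto
  · tauto
  · have : (0 : ℝ) ≤ g := g.cast_nonneg
    linarith
  · have : (0 : ℝ) ≤ i := i.cast_nonneg
    linarith [h.1]

/-- A region is cut out by one inequality in height and one in depth, both affine, so a segment
stays in every region that contains its endpoints. One path therefore serves all regions and all
data. -/
theorem exists_edge_line {x x' : stdSurface g} (hx : x ∈ stdEdge g) (hx' : x' ∈ stdEdge g)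
    (h : (x.1.2.1 = x'.1.2.1 ∧ (x.1.2.1 = 0 ∨ x.1.2.1 = 3)) ∨
      (x.1.2.2 = x'.1.2.2 ∧ (x.1.2.2 = 0 ∨ x.1.2.2 = 1))) :
    ∃ c : Path.Homotopic.Quotient x x', InSet (stdEdge g) c ∧
      ∀ {G : Type} [Group G] (d : HandleData g G) (k : Bool × Bool), x.1 ∈ region k →
        x'.1 ∈ region k → d.cocycle.hol c = d.value k x'.1 * (d.value k x.1)⁻¹ := by
  obtain ⟨⟨x, y, z⟩, hp⟩ := x
  obtain ⟨⟨x', y', z'⟩, hp'⟩ := x'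
  obtain rfl : x = 0 := hx
  obtain rfl : x' = 0 := hx'
  simp only at h
  have hb := of_mem_stdSurface_zero hp
  have hb' := of_mem_stdSurface_zero hp'
  have hmem : ∀ t ∈ I, ((0 : ℝ), (1 - t) * y + t * y', (1 - t) * z + t * z') ∈ stdSurface g := by
    rintro t ⟨h0, h1⟩
    refine mem_stdSurface_zero (convex_mem hb.1 hb'.1 h0 h1) (convex_mem hb.2.1 hb'.2.1 h0 h1) ?_
    rcases h with ⟨h, h'⟩ | ⟨h, h'⟩
    · rw [← h, convex_same]
      tauto
    · rw [← h, convex_same]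
      tauto
  let γ : Path (⟨(0, y, z), hp⟩ : stdSurface g) ⟨(0, y', z'), hp'⟩ :=
    { toFun := fun t => ⟨_, hmem t t.2⟩
      continuous_toFun := by fun_prop
      source' := by simp
      target' := by simp }
  refine ⟨.mk γ, ⟨γ, rfl, fun t => rfl⟩, fun d k hk hk' => d.cocycle.hol_mk γ k fun t => ?_⟩
  obtain ⟨h0, h1⟩ := t.2
  constructor
  · change 0 < zeta k.1 ((1 - (t : ℝ)) * z + t * z')
    rw [zeta_convex]
    have h2 : 0 < zeta k.1 z := hk.1
    have h3 : 0 < zeta k.1 z' := hk'.1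
    rcases h0.eq_or_lt with h0 | h0
    · rw [← h0]; simpa using h2
    · nlinarith
  · change eta k.2 ((1 - (t : ℝ)) * y + t * y') < 8 / 5
    rw [eta_convex]
    have h2 : eta k.2 y < 8 / 5 := hk.2
    have h3 : eta k.2 y' < 8 / 5 := hk'.2
    rcases h0.eq_or_lt with h0 | h0
    · rw [← h0]; simpa using h2
    · nlinarith

/-- A point on the boundary of the disk. -/
def edgePoint (g : ℕ) (y z : ℝ) (hy : 0 ≤ y ∧ y ≤ 3) (hz : 0 ≤ z ∧ z ≤ 1)
    (h : z = 0 ∨ z = 1 ∨ y = 0 ∨ y = 3) : stdSurface g := ⟨_, mem_stdSurface_zero hy hz h⟩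

theorem exists_edge_path (x : stdSurface g) (hx : x ∈ stdEdge g) :
    ∃ c : Path.Homotopic.Quotient x (base g (false, false)), InSet (stdEdge g) c := by
  have corner : ∀ {x : stdSurface g}, x ∈ stdEdge g → (x.1.2.1 = 0 ∨ x.1.2.2 = 1) →
      ∃ c : Path.Homotopic.Quotient x (base g (false, false)), InSet (stdEdge g) c := by
    intro x hx h
    obtain ⟨c, hc, -⟩ := exists_edge_line (x' := base g (false, false)) hx rfl (by
      rcases h with h | h
      · exact Or.inl ⟨h, Or.inl h⟩
      · exact Or.inr ⟨h, Or.inr h⟩)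
    exact ⟨c, hc⟩
  obtain ⟨⟨x, y, z⟩, hp⟩ := x
  obtain rfl : x = 0 := hx
  obtain ⟨hy, hz, h⟩ := of_mem_stdSurface_zero hp
  rcases h with rfl | h | h | rfl
  · let w : stdSurface g := edgePoint g 0 0 (by norm_num) (by norm_num) (Or.inl rfl)
    obtain ⟨c, hc, -⟩ := exists_edge_line (x := ⟨(0, y, 0), hp⟩) (x' := w) rfl rfl
      (Or.inr ⟨rfl, Or.inl rfl⟩)
    obtain ⟨c', hc'⟩ := corner (x := w) rfl (Or.inl rfl)
    exact ⟨c.trans c', hc.trans hc'⟩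
  · exact corner rfl (Or.inr h)
  · exact corner rfl (Or.inl h)
  · let w : stdSurface g := edgePoint g 3 1 (by norm_num) (by norm_num) (Or.inr (Or.inl rfl))
    obtain ⟨c, hc, -⟩ := exists_edge_line (x := ⟨(0, 3, z), hp⟩) (x' := w) rfl rfl
      (Or.inl ⟨rfl, Or.inr rfl⟩)
    obtain ⟨c', hc'⟩ := corner (x := w) rfl (Or.inr rfl)
    exact ⟨c.trans c', hc.trans hc'⟩

/-- The boundary curve of the standard surface. -/
theorem exists_boundary_loop (g : ℕ) : ∃ c : Path.Homotopic.Quotient (base g (false, false))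
    (base g (false, false)), InSet (stdEdge g) c ∧
      (freeData g).cocycle.hol c = (freeData g).u 0 * ((freeData g).v 0)⁻¹ := by
  -- The boundary of the square disk is cut at its corners and at the midpoints of its sides. The
  -- eight segments then each lie in one region, and the region changes only at midpoints.
  let P2 := edgePoint g 3 1 (by norm_num) (by norm_num) (by norm_num)
  let P4 := edgePoint g 3 0 (by norm_num) (by norm_num) (by norm_num)
  let P5 := edgePoint g (3 / 2) 0 (by norm_num) (by norm_num) (by norm_num)
  let P6 := edgePoint g 0 0 (by norm_num) (by norm_num) (by norm_num)
  obtain ⟨c1, i1, h1⟩ := exists_edge_line (x := base g (false, false)) (x' := base g (false, true))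
    rfl rfl (Or.inr ⟨rfl, Or.inr rfl⟩)
  obtain ⟨c2, i2, h2⟩ := exists_edge_line (x := base g (false, true)) (x' := P2)
    rfl rfl (Or.inr ⟨rfl, Or.inr rfl⟩)
  obtain ⟨c3, i3, h3⟩ := exists_edge_line (x := P2) (x' := base g (true, true))
    rfl rfl (Or.inl ⟨rfl, Or.inr rfl⟩)
  obtain ⟨c4, i4, h4⟩ := exists_edge_line (x := base g (true, true)) (x' := P4)
    rfl rfl (Or.inl ⟨rfl, Or.inr rfl⟩)
  obtain ⟨c5, i5, h5⟩ := exists_edge_line (x := P4) (x' := P5)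
    rfl rfl (Or.inr ⟨rfl, Or.inl rfl⟩)
  obtain ⟨c6, i6, h6⟩ := exists_edge_line (x := P5) (x' := P6)
    rfl rfl (Or.inr ⟨rfl, Or.inl rfl⟩)
  obtain ⟨c7, i7, h7⟩ := exists_edge_line (x := P6) (x' := base g (true, false))
    rfl rfl (Or.inl ⟨rfl, Or.inl rfl⟩)
  obtain ⟨c8, i8, h8⟩ := exists_edge_line (x := base g (true, false))
    (x' := base g (false, false)) rfl rfl (Or.inl ⟨rfl, Or.inl rfl⟩)
  refine ⟨c1.trans (c2.trans (c3.trans (c4.trans (c5.trans (c6.trans (c7.trans c8)))))),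
    i1.trans (i2.trans (i3.trans (i4.trans (i5.trans (i6.trans (i7.trans i8)))))), ?_⟩
  have r2 : P2.1 ∈ region (false, true) := by
    constructor <;> simp [P2, edgePoint, zeta, eta]
  have r4 : P4.1 ∈ region (true, true) := by
    constructor <;> simp [P4, edgePoint, zeta, eta]
  have r5 : P5.1 ∈ region (true, true) := by
    constructor <;> simp [P5, edgePoint, zeta, eta]; norm_num
  have r5' : P5.1 ∈ region (true, false) := by
    constructor <;> simp [P5, edgePoint, zeta, eta]; norm_num
  have r6 : P6.1 ∈ region (true, false) := by
    constructor <;> simp [P6, edgePoint, zeta, eta]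
  have n3 : ¬ (3 : ℝ) < 8 / 5 := by norm_num
  have n5 : (3 / 2 : ℝ) < 8 / 5 := by norm_num
  have t5 : IsTooth g 0 P5.1 := ⟨Nat.zero_le _, by simp [P5, edgePoint]⟩
  have v2 : (freeData g).value (false, true) P2.1 = 1 := by
    simp [HandleData.value, P2, edgePoint, n3]
  have v4 : (freeData g).value (true, true) P4.1 = 1 := by
    simp [HandleData.value, P4, edgePoint, n3]
  have v5 : (freeData g).value (true, true) P5.1 = ((freeData g).side true 0)⁻¹ := by
    have := HandleData.epsilon_isTooth t5
    simp only [P5, edgePoint] at this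
    simp [HandleData.value, P5, edgePoint, n5, this]
  have v5' : (freeData g).value (true, false) P5.1 = 1 := by
    simp [HandleData.value, P5, edgePoint]
  have v6 : (freeData g).value (true, false) P6.1 = 1 := by
    simp [HandleData.value, P6, edgePoint]
  simp only [Cocycle.hol_trans]
  rw [h1 _ (false, false) (base_mem _) (base_mem_false_false (by decide)),
    h2 _ (false, true) (base_mem _) r2, h3 _ (false, true) r2 base_true_true_mem,
    h4 _ (true, true) (base_mem _) r4, h5 _ (true, true) r4 r5, h6 _ (true, false) r5' r6,
    h7 _ (true, false) r6 (base_mem _),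
    h8 _ (false, false) (base_mem_false_false (by decide)) (base_mem _),
    v2, v4, v5, v5', v6]
  simp only [HandleData.value_false_false, HandleData.value_base, HandleData.value_base_true,
    HandleData.side, if_true, HandleData.s_zero]
  group

end Boundary

/-! ### The surface of a handlebody with a disk -/

section Frontier

variable {g : ℕ}

theorem isClosed_box (x x' y y' : ℝ) :
    IsClosed {p : ℝ × ℝ × ℝ | p.1 ∈ Set.Icc x x' ∧ p.2.1 ∈ Set.Icc y y'} :=
  (isClosed_Icc.preimage continuous_fst).inter
    (isClosed_Icc.preimage (continuous_fst.comp continuous_snd))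

theorem isOpen_box (x x' y y' : ℝ) :
    IsOpen {p : ℝ × ℝ × ℝ | p.1 ∈ Set.Ioo x x' ∧ p.2.1 ∈ Set.Ioo y y'} :=
  (isOpen_Ioo.preimage continuous_fst).inter
    (isOpen_Ioo.preimage (continuous_fst.comp continuous_snd))

theorem isClosed_stdHandlebody (g : ℕ) : IsClosed (stdHandlebody g) := by
  have : stdHandlebody g = ({p | p.1 ∈ Set.Icc (0 : ℝ) (2 * (g : ℝ) + 1) ∧
      p.2.1 ∈ Set.Icc (0 : ℝ) 3} ∩ ⋂ i : ℕ, ⋂ _ : i < g,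
        {p | p.1 ∈ Set.Ioo (2 * (i : ℝ) + 1) (2 * (i : ℝ) + 2) ∧ p.2.1 ∈ Set.Ioo (1 : ℝ) 2}ᶜ) ∩
      {p | p.2.2 ∈ Set.Icc (0 : ℝ) 1} := by
    ext p
    simp only [stdHandlebody, holedRectangle, Set.mem_inter_iff, Set.mem_iInter,
      Set.mem_compl_iff, Set.mem_ofPred_eq, and_assoc]
  rw [this]
  refine ((isClosed_box _ _ _ _).inter (isClosed_iInter fun i => isClosed_iInter fun _ =>
    (isOpen_box _ _ _ _).isClosed_compl)).inter
    (isClosed_Icc.preimage (continuous_snd.comp continuous_snd))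

theorem exists_line_mem {O : Set (ℝ × ℝ × ℝ)} {x y z : ℝ} (hO : O ∈ 𝓝 (x, y, z)) (a b c : ℝ)
    {r : ℝ} (hr : 0 < r) : ∃ t : ℝ, 0 < t ∧ t < r ∧ (x + t * a, y + t * b, z + t * c) ∈ O := by
  have h1 : Tendsto (fun t : ℝ => (x + t * a, y + t * b, z + t * c)) (𝓝[>] 0) (𝓝 (x, y, z)) := by
    have : Continuous fun t : ℝ => (x + t * a, y + t * b, z + t * c) := by fun_prop
    simpa using (this.tendsto 0).mono_left nhdsWithin_le_nhds
  obtain ⟨t, h2, h3⟩ := ((h1.eventually hO).and (Ioo_mem_nhdsGT hr)).exists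
  exact ⟨t, h3.1, h3.2, h2⟩

/-- The faces of the standard handlebody, including the standard disk. -/
def OnFace (g : ℕ) (p : ℝ × ℝ × ℝ) : Prop :=
  p.2.2 = 0 ∨ p.2.2 = 1 ∨ p.2.1 = 0 ∨ p.2.1 = 3 ∨ p.1 = 0 ∨ p.1 = 2 * (g : ℝ) + 1 ∨
    ∃ i : ℕ, i < g ∧ p.1 ∈ Set.Icc (2 * (i : ℝ) + 1) (2 * (i : ℝ) + 2) ∧ p.2.1 ∈ Set.Icc (1 : ℝ) 2

theorem mem_stdBoundary_iff {p : ℝ × ℝ × ℝ} :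
    p ∈ stdBoundary g ↔ p ∈ stdHandlebody g ∧ OnFace g p := by
  rw [stdBoundary, (isClosed_stdHandlebody g).frontier_eq, Set.mem_sdiff, mem_interior_iff_mem_nhds]
  refine and_congr_right fun hp => ⟨fun h => ?_, fun h hn => ?_⟩
  · by_contra hf
    refine h ?_
    obtain ⟨⟨hx, hy, -⟩, hz⟩ := hp
    simp only [OnFace, not_or, not_exists, not_and] at hf hx hy
    obtain ⟨f1, f2, f3, f4, f5, f6, f7⟩ := hf
    have h1 : ∀ᶠ q : ℝ × ℝ × ℝ in 𝓝 p, q.1 ∈ Set.Ioo (0 : ℝ) (2 * (g : ℝ) + 1) ∧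
        q.2.1 ∈ Set.Ioo (0 : ℝ) 3 := (isOpen_box _ _ _ _).mem_nhds
      ⟨⟨hx.1.lt_of_ne' f5, hx.2.lt_of_ne f6⟩, hy.1.lt_of_ne' f3, hy.2.lt_of_ne f4⟩
    have h2 : ∀ᶠ q : ℝ × ℝ × ℝ in 𝓝 p, q.2.2 ∈ Set.Ioo (0 : ℝ) 1 :=
      (isOpen_Ioo.preimage (continuous_snd.comp continuous_snd)).mem_nhds
        (⟨hz.1.lt_of_ne' f1, hz.2.lt_of_ne f2⟩ : p.2.2 ∈ Set.Ioo (0 : ℝ) 1)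
    have h3 : ∀ᶠ q : ℝ × ℝ × ℝ in 𝓝 p, ∀ i ∈ Set.Iio g,
        ¬ (q.1 ∈ Set.Icc (2 * (i : ℝ) + 1) (2 * (i : ℝ) + 2) ∧ q.2.1 ∈ Set.Icc (1 : ℝ) 2) :=
      (eventually_all_finite (Set.finite_Iio g)).2 fun i hi =>
        (isClosed_box _ _ _ _).isOpen_compl.mem_nhds fun h => f7 i hi h.1 h.2
    filter_upwards [h1, h2, h3] with q h1 h2 h3
    exact ⟨⟨Set.Ioo_subset_Icc_self h1.1, Set.Ioo_subset_Icc_self h1.2, fun i hi h =>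
      h3 i hi ⟨Set.Ioo_subset_Icc_self h.1, Set.Ioo_subset_Icc_self h.2⟩⟩,
      Set.Ioo_subset_Icc_self h2⟩
  · obtain ⟨x, y, z⟩ := p
    rcases h with h | h | h | h | h | h | h <;> dsimp only at h
    · obtain ⟨t, h0, -, ht⟩ := exists_line_mem hn 0 0 (-1) one_pos
      have : 0 ≤ z + t * (-1) := ht.2.1
      linarith
    · obtain ⟨t, h0, -, ht⟩ := exists_line_mem hn 0 0 1 one_pos
      have : z + t * 1 ≤ 1 := ht.2.2
      linarith
    · obtain ⟨t, h0, -, ht⟩ := exists_line_mem hn 0 (-1) 0 one_pos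
      have : 0 ≤ y + t * (-1) := ht.1.2.1.1
      linarith
    · obtain ⟨t, h0, -, ht⟩ := exists_line_mem hn 0 1 0 one_pos
      have : y + t * 1 ≤ 3 := ht.1.2.1.2
      linarith
    · obtain ⟨t, h0, -, ht⟩ := exists_line_mem hn (-1) 0 0 one_pos
      have : 0 ≤ x + t * (-1) := ht.1.1.1
      linarith
    · obtain ⟨t, h0, -, ht⟩ := exists_line_mem hn 1 0 0 one_pos
      have : x + t * 1 ≤ 2 * (g : ℝ) + 1 := ht.1.1.2
      linarith
    · obtain ⟨i, hi, hx, hy⟩ := h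
      -- The direction points to the centre line of the hole, so a step with `0 < t < 1` enters the
      -- open hole.
      obtain ⟨t, h0, h1, ht⟩ := exists_line_mem hn (2 * (i : ℝ) + 3 / 2 - x) (3 / 2 - y) 0 one_pos
      refine ht.1.2.2 i hi ⟨⟨?_, ?_⟩, ?_, ?_⟩ <;> obtain ⟨hx0, hx1⟩ := hx <;>
        obtain ⟨hy0, hy1⟩ := hy <;> simp only at hx0 hx1 hy0 hy1 ⊢ <;> nlinarith

theorem mem_relInterior_iff {X : Type*} [TopologicalSpace X] {S D : Set X} {x : X} :
    x ∈ relInterior S D ↔ x ∈ S ∧ ∃ U ∈ 𝓝 x, U ∩ S ⊆ D := by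
  constructor
  · rintro ⟨⟨x, hx⟩, h, rfl⟩
    obtain ⟨U, hU, h⟩ := mem_nhds_subtype _ _ _ |>.1 (mem_interior_iff_mem_nhds.1 h)
    exact ⟨hx, U, hU, fun y hy => h (show (⟨y, hy.2⟩ : S).1 ∈ U from hy.1)⟩
  · rintro ⟨hx, U, hU, h⟩
    exact ⟨⟨x, hx⟩, mem_interior_iff_mem_nhds.2
      ((mem_nhds_subtype _ _ _).2 ⟨U, hU, fun y hy => h ⟨hy, y.2⟩⟩), rfl⟩

/-- Only the open face is removed: a point on the edge of the disk is a limit of points with `x > 0`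
on an adjacent face. -/
theorem mem_stdSurface_iff_relInterior {p : ℝ × ℝ × ℝ} :
    p ∈ stdSurface g ↔ p ∈ stdBoundary g ∧ p ∉ relInterior (stdBoundary g) stdDisk := by
  rw [mem_relInterior_iff]
  constructor
  · intro h
    have hb : p ∈ stdBoundary g :=
      mem_stdBoundary_iff.2 ⟨h.1, by have := h.2; unfold OnFace; tauto⟩
    refine ⟨hb, ?_⟩
    rintro ⟨-, U, hU, hUD⟩
    obtain ⟨x, y, z⟩ := p
    obtain rfl : x = 0 := (hUD ⟨mem_of_mem_nhds hU, hb⟩).1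
    obtain ⟨hy, hz, hf⟩ := of_mem_stdSurface_zero h
    obtain ⟨t, h0, h1, ht⟩ := exists_line_mem hU 1 0 0 one_pos
    have hmem : (0 + t * 1, y + t * 0, z + t * 0) ∈ stdBoundary g := by
      have hg : (0 : ℝ) ≤ g := g.cast_nonneg
      simp only [zero_add, mul_one, mul_zero, add_zero]
      refine mem_stdBoundary_iff.2 ⟨⟨⟨⟨h0.le, by simp only; linarith⟩, hy, fun i _ h => ?_⟩, hz⟩,
        by simp only [OnFace]; tauto⟩
      have hi : (0 : ℝ) ≤ i := i.cast_nonneg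
      have := h.1.1
      simp only at this
      linarith
    have : 0 + t * 1 = 0 := (hUD ⟨ht, hmem⟩).1
    linarith
  · rintro ⟨hb, h⟩
    obtain ⟨hM, hf⟩ := mem_stdBoundary_iff.1 hb
    refine ⟨hM, ?_⟩
    by_contra hn
    refine h ⟨hb, {q | (q.1 ∈ Set.Ioo (-1 : ℝ) 1 ∧ q.2.1 ∈ Set.Ioo (0 : ℝ) 3) ∧
      q.2.2 ∈ Set.Ioo (0 : ℝ) 1}, ?_, ?_⟩
    · obtain ⟨⟨hx, hy, -⟩, hz⟩ := hM
      simp only [not_or] at hn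
      obtain ⟨n1, n2, n3, n4, n5, n6⟩ := hn
      have h0 : p.1 = 0 := by
        rcases hf with hf | hf | hf | hf | hf | hf | hf
        all_goals first | exact hf | exact absurd hf ‹_›
      refine ((isOpen_box _ _ _ _).inter (isOpen_Ioo.preimage
        (continuous_snd.comp continuous_snd))).mem_nhds ⟨⟨?_, ?_⟩, ?_⟩
      · rw [h0]; norm_num
      · exact ⟨hy.1.lt_of_ne' n3, hy.2.lt_of_ne n4⟩
      · exact ⟨hz.1.lt_of_ne' n1, hz.2.lt_of_ne n2⟩
    · rintro q ⟨⟨⟨hx, hy⟩, hz⟩, hq⟩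
      obtain ⟨-, hq⟩ := mem_stdBoundary_iff.1 hq
      refine ⟨?_, Set.Ioo_subset_Icc_self hy, Set.Ioo_subset_Icc_self hz⟩
      rcases hq with h | h | h | h | h | h | ⟨i, -, h, -⟩
      · exact absurd h hz.1.ne'
      · exact absurd h hz.2.ne
      · exact absurd h hy.1.ne'
      · exact absurd h hy.2.ne
      · exact h
      · have hg : (0 : ℝ) ≤ g := g.cast_nonneg
        linarith [hx.2]
      · have hi : (0 : ℝ) ≤ i := i.cast_nonneg
        linarith [hx.2, h.1]

variable {V : Type*} [TopologicalSpace V] {S D : Set V}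

theorem mem_surface_iff (h : V ≃ₜ stdHandlebody g)
    (hS : ∀ x, x ∈ S ↔ (h x : ℝ × ℝ × ℝ) ∈ stdBoundary g)
    (hD : ∀ x, x ∈ D ↔ (h x : ℝ × ℝ × ℝ) ∈ stdDisk) (x : V) :
    x ∈ surface S D ↔ (h x : ℝ × ℝ × ℝ) ∈ stdSurface g := by
  rw [mem_stdSurface_iff_relInterior, surface, Set.mem_sdiff, hS x]
  refine and_congr_right fun hx => not_congr ?_
  rw [mem_relInterior_iff, mem_relInterior_iff, hS x]
  refine and_congr_right fun _ => ⟨?_, ?_⟩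
  · rintro ⟨U, hU, hUD⟩
    have : h '' U ∈ 𝓝 (h x) := h.isOpenMap.image_mem_nhds hU
    obtain ⟨W, hW, hWU⟩ := (mem_nhds_subtype _ _ _).1 this
    refine ⟨W, hW, fun p hp => ?_⟩
    obtain ⟨y, hy, hyp⟩ := hWU (show (⟨p, (mem_stdBoundary_iff.1 hp.2).1⟩ : stdHandlebody g).1 ∈ W
      from hp.1)
    have hyp' : (h y : ℝ × ℝ × ℝ) = p := congrArg Subtype.val hyp
    rw [← hyp', ← hD]
    exact hUD ⟨hy, (hS y).2 (by rw [hyp']; exact hp.2)⟩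
  · rintro ⟨W, hW, hWD⟩
    refine ⟨(fun y => (h y : ℝ × ℝ × ℝ)) ⁻¹' W, (continuous_subtype_val.comp
      h.continuous).continuousAt.preimage_mem_nhds hW, fun y hy => (hD y).2 ?_⟩
    exact hWD ⟨hy.1, (hS y).1 hy.2⟩

end Frontier

/-! ### Transport of fundamental groups -/

section Transport

variable {X Y : Type*} [TopologicalSpace X] [TopologicalSpace Y]

/-- Change of base point along a class of paths. -/
def conjPath {x y : X} (δ : Path.Homotopic.Quotient x y) :
    FundamentalGroup X x ≃* FundamentalGroup X y where
  toFun γ := .fromPath (δ.symm.trans (γ.toPath.trans δ))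
  invFun γ := .fromPath (δ.trans (γ.toPath.trans δ.symm))
  left_inv γ := by
    change δ.trans ((δ.symm.trans (γ.toPath.trans δ)).trans δ.symm) = γ
    rw [Path.Homotopic.Quotient.trans_assoc, trans_symm_cancel, Path.Homotopic.Quotient.trans_assoc,
      Path.Homotopic.Quotient.trans_symm, Path.Homotopic.Quotient.trans_refl]
  right_inv γ := by
    change δ.symm.trans ((δ.trans (γ.toPath.trans δ.symm)).trans δ) = γ
    rw [Path.Homotopic.Quotient.trans_assoc, symm_trans_cancel, Path.Homotopic.Quotient.trans_assoc,
      Path.Homotopic.Quotient.symm_trans, Path.Homotopic.Quotient.trans_refl]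
  map_mul' γ γ' := by
    change δ.symm.trans ((γ'.toPath.trans γ.toPath).trans δ) =
      (δ.symm.trans (γ'.toPath.trans δ)).trans (δ.symm.trans (γ.toPath.trans δ))
    simp only [Path.Homotopic.Quotient.trans_assoc, trans_symm_cancel]

theorem conjPath_symm_apply {x y : X} (δ : Path.Homotopic.Quotient x y)
    (γ : FundamentalGroup X y) :
    (conjPath δ).symm γ = .fromPath (δ.trans (γ.toPath.trans δ.symm)) := rfl

theorem map_conjPath {x y : X} (δ : Path.Homotopic.Quotient x y) (γ : FundamentalGroup X x)
    (f : C(X, Y)) :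
    FundamentalGroup.map f y (conjPath δ γ) = conjPath (δ.map f) (FundamentalGroup.map f x γ) := by
  change (δ.symm.trans (γ.toPath.trans δ)).map f =
    (δ.map f).symm.trans ((γ.toPath.map f).trans (δ.map f))
  rw [quotient_map_trans, quotient_map_trans, quotient_map_symm]

/-- The isomorphism of fundamental groups induced by a homeomorphism. -/
def homeoEquiv (h : X ≃ₜ Y) (x : X) : FundamentalGroup X x ≃* FundamentalGroup Y (h x) :=
  MonoidHom.toMulEquiv (FundamentalGroup.map (h : C(X, Y)) x)
    (FundamentalGroup.mapOfEq (h.symm : C(Y, X)) (h.symm_apply_apply x))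
    (by
      ext γ
      induction γ using Path.Homotopic.Quotient.ind with | mk γ
      rw [MonoidHom.comp_apply, FundamentalGroup.mapOfEq_apply]
      refine congrArg Path.Homotopic.Quotient.mk ?_
      ext t
      exact h.symm_apply_apply _)
    (by
      ext γ
      induction γ using Path.Homotopic.Quotient.ind with | mk γ
      rw [MonoidHom.comp_apply, FundamentalGroup.mapOfEq_apply]
      refine congrArg Path.Homotopic.Quotient.mk ?_
      ext t
      exact h.apply_symm_apply _)

theorem homeoEquiv_symm_apply (h : X ≃ₜ Y) (x : X) (γ : FundamentalGroup Y (h x)) :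
    (homeoEquiv h x).symm γ =
      (Path.Homotopic.Quotient.map γ (h.symm : C(Y, X))).cast (h.symm_apply_apply x).symm
        (h.symm_apply_apply x).symm :=
  FundamentalGroup.mapOfEq_apply _ (h.symm_apply_apply x) _

theorem InSet.cast {D : Set X} {x y x' y' : X} {c : Path.Homotopic.Quotient x y} (h : InSet D c)
    (hx : x' = x) (hy : y' = y) : InSet D (c.cast hx hy) := by
  obtain ⟨γ, rfl, hγ⟩ := h
  exact ⟨γ.cast hx hy, rfl, hγ⟩

theorem IsSplitPair.transport {P P' : Type*} [Group P] [Group P'] {A : Subgroup P} {ι : Type}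
    {S B : ι → P} {e : P ≃* SplitFree ι} (h : IsSplitPair A S B e) (φ : P' ≃* P)
    {A' : Subgroup P'} (hA : ∀ x, x ∈ A' ↔ φ x ∈ A) :
    IsSplitPair A' (fun i => φ.symm (S i)) (fun i => φ.symm (B i)) (φ.trans e) where
  mem_iff x := (hA x).trans (h.mem_iff _)
  apply_S i := by rw [MulEquiv.trans_apply, MulEquiv.apply_symm_apply, h.apply_S]
  apply_B i := by rw [MulEquiv.trans_apply, MulEquiv.apply_symm_apply, h.apply_B]

end Transport

/-! ### The fundamental group of the surface of a handlebody -/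

section Surface

variable {V : Type*} [TopologicalSpace V] {S D : Set V}

/-- The map `f` is defined on all of `V`, so it carries null-homotopies in `V` to null-homotopies.
-/
theorem inducedHom_mem_kerA {star : surface S D} (hstar : (star : V) ∈ D) (f : homeoRel S D)
    {x : Pi1 star} (hx : x ∈ kerA star) : inducedHom hstar f x ∈ kerA star := by
  obtain ⟨γ, rfl⟩ := loopClass_surjective x
  rw [inducedHom_loopClass]
  have h1 : (Path.Homotopic.Quotient.mk γ).map (surfaceIncl S D) = .refl _ := hx
  have h2 := congrArg (fun c => (Path.Homotopic.Quotient.map c (f.1 : C(V, V))).cast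
    (f.2.2 _ hstar).symm (f.2.2 _ hstar).symm) h1
  refine Eq.trans ?_ (h2.trans ?_)
  · rfl
  · refine congrArg Path.Homotopic.Quotient.mk (Path.ext ?_)
    funext t
    exact f.2.2 _ hstar

theorem homeoAction_mem_autPair {star : surface S D} (hstar : (star : V) ∈ D)
    (f : homeoRel S D) : homeoAction hstar f ∈ autPair (kerA star) := by
  change (kerA star).map (homeoAction hstar f).toMonoidHom = kerA star
  refine le_antisymm ?_ fun x hx => ⟨inducedHom hstar f⁻¹ x, inducedHom_mem_kerA hstar f⁻¹ hx,
    (homeoAction hstar f).apply_symm_apply x⟩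
  rintro _ ⟨x, hx, rfl⟩
  exact inducedHom_mem_kerA hstar f hx

theorem exists_homeoAction_eq {star : surface S D} {hstar : (star : V) ∈ D}
    {φ : MulAut (Pi1 star)} (hφ : φ ∈ handlebodyGroup hstar) : ∃ f, homeoAction hstar f = φ := by
  obtain ⟨q, rfl⟩ := hφ
  obtain ⟨f, rfl⟩ := QuotientGroup.mk_surjective q
  exact ⟨f, rfl⟩

theorem handlebodyGroup_le_autPair {star : surface S D} (hstar : (star : V) ∈ D) :
    handlebodyGroup hstar ≤ autPair (kerA star) := by
  intro φ hφ
  obtain ⟨f, rfl⟩ := exists_homeoAction_eq hφ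
  exact homeoAction_mem_autPair hstar f

/-- A loop in `D` is fixed pointwise, not merely up to homotopy. -/
theorem inducedHom_eq_self {star : surface S D} (hstar : (star : V) ∈ D) (f : homeoRel S D)
    {x : Pi1 star} (hx : InSet {p : surface S D | (p : V) ∈ D} x.toPath) :
    inducedHom hstar f x = x := by
  obtain ⟨γ, h, hγ⟩ := hx
  obtain rfl : loopClass γ = x := h
  rw [inducedHom_loopClass]
  refine congrArg loopClass (Path.ext (funext fun t => Subtype.ext ?_))
  exact f.2.2 _ (hγ t)

/-- The fundamental group of the surface of a handlebody is free on generators `S i` and `B i`,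
the kernel of the map to the handlebody is generated by the conjugates of the `B i`, and the
boundary curve is a product of the `B i` and their conjugates by the `S i`. -/
theorem exists_isSplitPair {g : ℕ} (hV : IsHandlebodyWithDisk g S D) (star : surface S D)
    (hstar : (star : V) ∈ D) : ∃ (s b : Fin g → Pi1 star) (e : Pi1 star ≃* SplitFree (Fin g)),
      IsSplitPair (kerA star) s b e ∧ InSet {p : surface S D | (p : V) ∈ D}
        ((((List.finRange g).reverse.map b).prod *
          ((List.finRange g).reverse.map fun i => s i * b i * (s i)⁻¹).prod⁻¹ : Pi1 star).toPath)
    := by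
  obtain ⟨h, hS, hD⟩ := hV
  have hsurf := mem_surface_iff h hS hD
  let Θ : surface S D ≃ₜ stdSurface g :=
    { toFun := fun x => ⟨h x, (hsurf x).1 x.2⟩
      invFun := fun p => ⟨h.symm ⟨p.1, p.2.1⟩, by
        rw [hsurf, h.apply_symm_apply]
        exact p.2⟩
      left_inv := fun x => Subtype.ext (h.symm_apply_apply x.1)
      right_inv := fun p => Subtype.ext (by
        change (h (h.symm ⟨p.1, p.2.1⟩) : ℝ × ℝ × ℝ) = p
        rw [h.apply_symm_apply])
      continuous_toFun := by
        refine Continuous.subtype_mk ?_ _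
        exact continuous_subtype_val.comp (h.continuous.comp continuous_subtype_val)
      continuous_invFun := by
        refine Continuous.subtype_mk ?_ _
        exact h.symm.continuous.comp (Continuous.subtype_mk continuous_subtype_val _) }
  have hedge : ∀ p ∈ stdEdge g, Θ.symm p ∈ {p : surface S D | (p : V) ∈ D} := by
    intro p hp
    refine (hD _).2 ?_
    change ((Θ (Θ.symm p) : stdSurface g) : ℝ × ℝ × ℝ) ∈ stdDisk
    rw [Θ.apply_symm_apply]
    exact ⟨hp, p.2.1.1.2.1, p.2.1.2⟩
  -- The base point is moved along the boundary of the disk, so that the transported boundary curve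
  -- still runs in `D`.
  obtain ⟨δ, hδ⟩ := exists_edge_path (Θ star) ((hD _).1 hstar).1
  let φ : Pi1 star ≃* StdPi1 g := (homeoEquiv Θ star).trans (conjPath δ)
  have hker : ∀ x, x ∈ kerA star ↔ φ x ∈ stdKer g := by
    intro x
    rw [stdKer_eq, MonoidHom.mem_ker]
    change _ ↔ FundamentalGroup.map (stdIncl g) _ (conjPath δ (homeoEquiv Θ star x)) = 1
    rw [map_conjPath, map_eq_one_iff _ (conjPath (δ.map (stdIncl g))).injective,
      kerA, MonoidHom.mem_ker]
    refine ((homeoEquiv h (surfaceIncl S D star)).map_eq_one_iff).symm.trans (Eq.congr ?_ rfl)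
    induction x using Path.Homotopic.Quotient.ind
    rfl
  obtain ⟨c, hc, hζ⟩ := exists_boundary_loop g
  refine ⟨_, _, _, (isSplitPair_std g).transport φ hker, ?_⟩
  let E : Pi1 star ≃* FreeGroup (Fin g ⊕ Fin g) := φ.trans (holEquiv g)
  have h1 : ((List.finRange g).reverse.map fun i => E.symm (.of (.inr i))).prod *
      ((List.finRange g).reverse.map fun i => E.symm (.of (.inl i)) * E.symm (.of (.inr i)) *
        (E.symm (.of (.inl i)))⁻¹).prod⁻¹ = φ.symm (.fromPath c) := by
    apply E.injective
    have h2 : E (φ.symm (.fromPath c)) = (freeData g).cocycle.hol c := by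
      rw [MulEquiv.trans_apply, MulEquiv.apply_symm_apply]
      rfl
    rw [h2, hζ]
    change _ = descProd (genB g) g 0 *
      (descProd (fun n => genS g (n + 1) * genB g n * (genS g (n + 1))⁻¹) g 0)⁻¹
    rw [descProd_zero_eq g (d := fun i => FreeGroup.of (Sum.inr i)) (fun i => by simp [genB]),
      descProd_zero_eq g (d := fun i => FreeGroup.of (Sum.inl i) * FreeGroup.of (Sum.inr i) *
        (FreeGroup.of (Sum.inl i))⁻¹)
        (fun i => by simp [genB, genS]), map_mul, map_inv, map_list_prod, map_list_prod,
      List.map_map, List.map_map]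
    congr 3
    · funext i
      exact E.apply_symm_apply _
    · congr 1
      funext i
      simp only [Function.comp_apply, map_mul, map_inv, MulEquiv.apply_symm_apply]
  refine h1 ▸ ?_
  have h3 : φ.symm (.fromPath c) = (homeoEquiv Θ star).symm ((conjPath δ).symm (.fromPath c)) := rfl
  rw [h3, homeoEquiv_symm_apply, conjPath_symm_apply]
  exact ((hδ.trans (hc.trans hδ.symm)).map _ hedge).cast _ _

theorem sum_map_reverse_finRange {g : ℕ} (c : Fin g → ℤ) :
    ((List.finRange g).reverse.map c).sum = ∑ i, c i := by
  rw [List.map_reverse, List.sum_reverse, ← List.ofFn_eq_map, List.sum_ofFn]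

end Surface

end HandlebodyJohnson
end

/-! ### The theorem on handlebody groups -/

theorem theorem5p3 (g : ℕ) (hg : 1 ≤ g) {V : Type*} [TopologicalSpace V] (S D : Set V)
    (hV : HandlebodyJohnson.IsHandlebodyWithDisk g S D)
    (star : HandlebodyJohnson.surface S D) (hstar : (star : V) ∈ D) :
    (HandlebodyJohnson.handlebodyGroup hstar ≤
        HandlebodyJohnson.autPair (HandlebodyJohnson.kerA star)) ∧
    (∀ m : ℕ, HandlebodyJohnson.handlebodyStep hstar m 0 =
        HandlebodyJohnson.handlebodyFiltration hstar m) ∧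
    (∀ m : ℕ, HandlebodyJohnson.handlebodyStep hstar m 1 =
        HandlebodyJohnson.handlebodyFiltration hstar m) ∧
    HandlebodyJohnson.handlebodyFiltration hstar 0 =
        HandlebodyJohnson.handlebodyGroup hstar ∧
    HandlebodyJohnson.IsExtendedNSeries (HandlebodyJohnson.handlebodyFiltration hstar) ∧
    (⨅ m : ℕ, HandlebodyJohnson.handlebodyFiltration hstar m) = ⊥ := by
  obtain ⟨s, b, e, h, hζ⟩ := HandlebodyJohnson.exists_isSplitPair hV star hstar
  -- Positive genus enters through `step_one_eq`, which needs some `B i` on which to test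
  -- conjugation.
  have : Nonempty (Fin g) := ⟨⟨0, hg⟩⟩
  refine ⟨HandlebodyJohnson.handlebodyGroup_le_autPair hstar, ?_, fun m => ?_, ?_,
    h.isExtendedNSeries _, h.iInf_eq_bot _⟩
  · refine h.step_zero_eq (fun c => HandlebodyJohnson.sum_map_reverse_finRange c) fun f hf => ?_
    obtain ⟨k, rfl⟩ := HandlebodyJohnson.exists_homeoAction_eq hf
    exact HandlebodyJohnson.inducedHom_eq_self hstar k hζ
  · exact congrArg (HandlebodyJohnson.handlebodyGroup hstar ⊓ ·) (h.step_one_eq m)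
  · refine inf_eq_left.2 ?_
    rw [HandlebodyJohnson.johnsonFiltration_zero]
    exact HandlebodyJohnson.handlebodyGroup_le_autPair hstar
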